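/- Let $I,J,L\subseteq\mathbb R$ be nonempty open intervals and $U=I\times J\times L\subseteq\mathbb R^3$ with coordinates $(x,y,z)$. Write $p=\partial_x$, $q=\partial_y$, $r=\partial_z$, and let $T=v+\eta$ ($v$ a vector field, $\eta$ a function) act on $f\in C^\infty(U)$ by $T(f)=v(f)+\eta f$. For a linear space $\mathfrak g$ of first order differential operators, a \emph{fixed module} is a finite-dimensional real subspace $\mathcal N\subseteq C^\infty(U)$ with $T(\mathcal N)\subseteq\mathcal N$ for all $T\in\mathfrak g$. It is \emph{locally nontrivial} if the functions in $\mathcal N$ do not all vanish on any nonempty open subset of $U$. Put $\mathfrak s=\{xq,\;xp-yq,\;yp\}$ and, for $c\in\mathbb R$, $\mathfrak p_c=\{p,q,xp,yq,xq,yp,\;x^2p+xyq+cx,\;xyp+y^2q+cy\}$. Below, $c,d,a\in\mathbb R$; $l$ is a nonnegative integer; $n,m$ denote nonnegative integers; $Z^1,\dots,Z^s$ and $K$ are smooth functions of $z\in L$; "$z^ke^{\lambda z}$" with $\lambda\in\mathbb C$ stands for the two real functions $\mathrm{Re}(z^ke^{\lambda z})$, $\mathrm{Im}(z^ke^{\lambda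 z})$; an \emph{exponential space} is the real span on $L$ of all $z^ke^{\lambda z}$ with $\lambda\in\Lambda$, $k\le m_\lambda$, for a finite set $\Lambda\subset\mathbb C$ and nonnegative integers $m_\lambda$. For finite-dimensional spaces $G^{(0)},\dots,G^{(n)}\subseteq C^\infty(L)$ put $\mathcal N_n(G)=\mathrm{Span}\{x^iy^jg(z): i+j\le n,\ g\in G^{(i+j)}\}$. 1. $\mathfrak g=\mathrm{Span}\{p,q,xp+K,yq+K,xq,yp,x^2p+xyq+3xK,xyp+y^2q+3yK,1\}$. If $\mathfrak g$ has a locally nontrivial fixed module, then $3K\equiv-n$ on $L$ for some $n$ (so that, modulo constants, the cocycle is given by $x^2p+xyq-nx$, $xyp+y^2q-ny$). If $3K\equiv -n$, the fixed modules are exactly the spaces $\mathcal N_n(G)$ with $G^{(l)}\subseteq G^{(l-1)}$ for $1\le l\le n$ and, in fact, $G^{(0)}=\dots=G^{(n)}$; and a space $\mathcal N_n(G)$ with $G^{(l)}\subseteq G^{(l-1)}$ for $1\le l\le n$ is a fixed module if and only if all $G^{(l)}$, $l\le n$, are equal. 2. $\mathfrak g=\mathrm{Span}(\mathfrak s\cup\{Z^ip,Z^iq\}_i\cup\{1\})$.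 The fixed modules are exactly the $\mathcal N_n(G)$ with $Z^iG^{(l)}\subseteq G^{(l-1)}$ for all $i$ and $1\le l\le n$ ($n$ arbitrary). 3. $\mathfrak g=\mathrm{Span}(\mathfrak s\cup\{Z^ip,Z^iq\}_i\cup\{xp+yq+K,1\})$. If there is a locally nontrivial fixed module then $K$ is constant on $L$ (the cocycle is $0$ modulo constants); if $K$ is constant on $L$, the fixed modules are exactly those described in 2. 4. $\mathfrak g=\mathrm{Span}(\mathfrak p_c\cup\{r,1\})$. A nonzero $\mathcal N$ is a fixed module iff $c=-n$ and $\mathcal N=\mathrm{Span}\{x^iy^jg(z): i+j\le n,\ g\in G\}$ for some $n$ and some exponential space $G$. 5. $\mathfrak g=\mathrm{Span}(\mathfrak s\cup\{\zeta p,\zeta q\}_{\zeta}\cup\{r,1\})$, $\zeta$ running over $z^ke^{\lambda z}$ with $\lambda\in\Lambda_0$, $k\le\nu_\lambda$ ($\Lambda_0\subset\mathbb C$ finite, $\nu_\lambda$ nonnegative integers). The fixed modules are exactly the $\mathcal N_n(G)$ in which every $G^{(l)}$, $l\le n$, is an exponential space and $\zeta G^{(l)}\subseteq G^{(l-1)}$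 for all $\zeta$ and $1\le l\le n$. 6. $\mathfrak g$ as in 5 with $xp+yq+cz$ added. A nonzero $\mathcal N$ is a fixed module iff $c=0$ and $\mathcal N$ is as in 5. 7. $\mathfrak g=\mathrm{Span}(\mathfrak p_c\cup\{r,zr,1\})$. A nonzero $\mathcal N$ is a fixed module iff, for some $n,m$, $c=-n$ and $\mathcal N=\mathrm{Span}\{x^iy^jz^k: i+j\le n,\ k\le m\}$. 8. $\mathfrak g=\mathrm{Span}(\mathfrak s\cup\{z^kp,z^kq\}_{k\le l}\cup\{r,\;zr+a(xp+yq),1\})$. For all $n,m$ the space $\mathrm{Span}\{x^iy^jz^k: i+j\le n,\ l(i+j)+k\le m\}$ is a fixed module. A nonzero $\mathcal N$ is a fixed module iff $\mathcal N=\mathrm{Span}\{x^iy^jz^k: i+j\le n,\ k\le\mu_{i+j}\}$ for some $n$ and some nonnegative integers $\mu_0,\mu_1,\dots$ with $l+\mu_{d+1}\le\mu_d$ for $0\le d<n$. 9. $\mathfrak g=\mathrm{Span}(\mathfrak s\cup\{z^kp,z^kq\}_{k\le l}\cup\{xp+yq,r,zr,1\})$. The same two assertions as in 8 hold. 10. $\mathfrak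 g=\mathrm{Span}(\mathfrak p_c\cup\{r,zr,z^2r+dz,1\})$. A nonzero $\mathcal N$ is a fixed module iff, for some $n,m$, $c=-n$, $d=-m$ and $\mathcal N=\mathrm{Span}\{x^iy^jz^k: i+j\le n,\ k\le m\}$. 11. $\mathfrak g=\mathrm{Span}(\mathfrak s\cup\{z^kp,z^kq\}_{k\le l}\cup\{r,\;zr+\tfrac l2(xp+yq),\;z^2r+lz(xp+yq)+cz,\;1\})$. A nonzero $\mathcal N$ is a fixed module iff, for some $n,m$, $c=-m$ and $\mathcal N=\mathrm{Span}\{x^iy^jz^k: i+j\le n,\ l(i+j)+k\le m\}$. 12. $\mathfrak g=\mathrm{Span}(\mathfrak s\cup\{z^kp,z^kq\}_{k\le l}\cup\{xp+yq,\;r,\;zr,\;z^2r+lz(xp+yq)+cz,\;1\})$. A nonzero $\mathcal N$ is a fixed module iff, for some $n,m$, $c=-m$ and $\mathcal N=\mathrm{Span}\{x^iy^jz^k: i+j\le n,\ l(i+j)+k\le m\}$. -/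

import Mathlib

open scoped ContDiff

noncomputable section

namespace QES

/-- Coordinate space with coordinates `(x, y, z)`. -/
abbrev Space : Type := ℝ × ℝ × ℝ

/-- The smooth real-valued functions on an open set `U`.  A function on `U` is represented by its
extension by zero to the whole space, so that equality is equality of functions on `U`. -/
def smoothFun {E : Type*} [NormedAddCommGroup E] [NormedSpace ℝ E] (U : Set E) :
    Submodule ℝ (E → ℝ) where
  carrier := {f | ContDiffOn ℝ ∞ f U ∧ ∀ a, a ∉ U → f a = 0}
  add_mem' := by
    rintro f g ⟨hf, hf0⟩ ⟨hg, hg0⟩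
    exact ⟨hf.add hg, fun a ha => by simp [hf0 a ha, hg0 a ha]⟩
  zero_mem' := ⟨contDiffOn_const, fun _ _ => rfl⟩
  smul_mem' := by
    rintro c f ⟨hf, hf0⟩
    exact ⟨hf.const_smul c, fun a ha => by simp [hf0 a ha]⟩

/-- A first-order differential operator `v + η`: a vector field `v` and a multiplier `η`. -/
abbrev DiffOp : Type := (Space → Space) × (Space → ℝ)

/-- The action of `T = v + η` on a function `f` on the open set `U`: `T f = v(f) + η f`. -/
def act (U : Set Space) (T : DiffOp) (f : Space → ℝ) : Space → ℝ :=
  U.indicator (fun a => fderiv ℝ f a (T.1 a) + T.2 a * f a)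

/-- `N` is a finite-dimensional `g`-module of smooth functions on `U`. -/
structure IsFixedModule (U : Set Space) (g : Submodule ℝ DiffOp)
    (N : Submodule ℝ (Space → ℝ)) : Prop where
  smooth : N ≤ smoothFun U
  finite : FiniteDimensional ℝ N
  stable : ∀ T ∈ g, ∀ f ∈ N, act U T f ∈ N

/-- `N` does not vanish identically on any nonempty open subset of `U`. -/
def LocallyNontrivial (U : Set Space) (N : Submodule ℝ (Space → ℝ)) : Prop :=
  ∀ V : Set Space, V ⊆ U → IsOpen V → V.Nonempty → ∃ f ∈ N, ∃ a ∈ V, f a ≠ 0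

/-! ### Coordinates, vector fields and generators -/

/-- The coordinate function `x`. -/
def cx : Space → ℝ := fun a => a.1
/-- The coordinate function `y`. -/
def cy : Space → ℝ := fun a => a.2.1
/-- The coordinate function `z`. -/
def cz : Space → ℝ := fun a => a.2.2
/-- A function of one variable, viewed as the function `K(z)` on space. -/
def ofZ (K : ℝ → ℝ) : Space → ℝ := fun a => K a.2.2

/-- `p = ∂/∂x`. -/
def vp : Space → Space := fun _ => (1, 0, 0)
/-- `q = ∂/∂y`. -/
def vq : Space → Space := fun _ => (0, 1, 0)
/-- `r = ∂/∂z`. -/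
def vr : Space → Space := fun _ => (0, 0, 1)

/-- `xp + yq`. -/
def euler : Space → Space := cx • vp + cy • vq

/-- The multiplication operator `1`. -/
def one : DiffOp := (0, 1)

/-- `xq, xp - yq, yp`. -/
def sl2 : Set DiffOp := {(cx • vq, 0), (cx • vp - cy • vq, 0), (cy • vp, 0)}

/-- `p, q, xp, yq, xq, yp, x²p + xyq + cx, xyp + y²q + cy`. -/
def sl3 (c : ℝ) : Set DiffOp :=
  {(vp, 0), (vq, 0), (cx • vp, 0), (cy • vq, 0), (cx • vq, 0), (cy • vp, 0),
    (cx ^ 2 • vp + (cx * cy) • vq, c • cx), ((cx * cy) • vp + cy ^ 2 • vq, c • cy)}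

/-- `ζ(z)p` and `ζ(z)q` for `ζ` in a set of functions of `z`. -/
def translations (S : Set (ℝ → ℝ)) : Set DiffOp :=
  {T | ∃ ζ ∈ S, T = (ofZ ζ • vp, 0) ∨ T = (ofZ ζ • vq, 0)}

/-- The functions `z^k e^{λz}`, `λ ∈ Λ`, `k ≤ m λ`, in real form: for a complex exponent the real
and the imaginary part are taken (for real `λ` these are `z^k e^{λz}` and `0`). -/
def expMonomials (Λ : Finset ℂ) (m : ℂ → ℕ) : Set (ℝ → ℝ) :=
  {ζ | ∃ lam ∈ Λ, ∃ k ≤ m lam,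
    ζ = (fun z : ℝ => ((z : ℂ) ^ k * Complex.exp (lam * z)).re) ∨
    ζ = (fun z : ℝ => ((z : ℂ) ^ k * Complex.exp (lam * z)).im)}

/-- The functions `1, z, …, z^l`. -/
def powers (l : ℕ) : Set (ℝ → ℝ) := {ζ | ∃ k ≤ l, ζ = fun z => z ^ k}

/-! ### The twelve Lie algebras of first-order differential operators -/

def alg1 (K : ℝ → ℝ) : Submodule ℝ DiffOp := Submodule.span ℝ
  {(vp, 0), (vq, 0), (cx • vp, ofZ K), (cy • vq, ofZ K), (cx • vq, 0), (cy • vp, 0),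
    (cx ^ 2 • vp + (cx * cy) • vq, 3 • (cx * ofZ K)),
    ((cx * cy) • vp + cy ^ 2 • vq, 3 • (cy * ofZ K)), one}

def alg2 {s : ℕ} (Z : Fin s → ℝ → ℝ) : Submodule ℝ DiffOp := Submodule.span ℝ
  (sl2 ∪ translations (Set.range Z) ∪ {one})

def alg3 {s : ℕ} (Z : Fin s → ℝ → ℝ) (K : ℝ → ℝ) : Submodule ℝ DiffOp := Submodule.span ℝ
  (sl2 ∪ translations (Set.range Z) ∪ {(euler, ofZ K), one})

def alg4 (c : ℝ) : Submodule ℝ DiffOp := Submodule.span ℝ (sl3 c ∪ {(vr, 0), one})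

def alg5 (Λ : Finset ℂ) (ν : ℂ → ℕ) : Submodule ℝ DiffOp := Submodule.span ℝ
  (sl2 ∪ translations (expMonomials Λ ν) ∪ {(vr, 0), one})

def alg6 (Λ : Finset ℂ) (ν : ℂ → ℕ) (c : ℝ) : Submodule ℝ DiffOp := Submodule.span ℝ
  (sl2 ∪ translations (expMonomials Λ ν) ∪ {(euler, c • cz), (vr, 0), one})

def alg7 (c : ℝ) : Submodule ℝ DiffOp := Submodule.span ℝ
  (sl3 c ∪ {(vr, 0), (cz • vr, 0), one})

def alg8 (l : ℕ) (a : ℝ) : Submodule ℝ DiffOp := Submodule.span ℝ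
  (sl2 ∪ translations (powers l) ∪ {(vr, 0), (cz • vr + a • euler, 0), one})

def alg9 (l : ℕ) : Submodule ℝ DiffOp := Submodule.span ℝ
  (sl2 ∪ translations (powers l) ∪ {(euler, 0), (vr, 0), (cz • vr, 0), one})

def alg10 (c d : ℝ) : Submodule ℝ DiffOp := Submodule.span ℝ
  (sl3 c ∪ {(vr, 0), (cz • vr, 0), (cz ^ 2 • vr, d • cz), one})

/-- Closure under brackets forces the coefficient `a` of `z²r + az(xp + yq)` to be `l`, because
`[z²r + az(xp + yq), z^l p] = (l - a) z^{l+1} p`. -/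
def alg11 (l : ℕ) (c : ℝ) : Submodule ℝ DiffOp := Submodule.span ℝ
  (sl2 ∪ translations (powers l) ∪
    {(vr, 0), (cz • vr + ((l : ℝ) / 2) • euler, 0),
      (cz ^ 2 • vr + (l : ℝ) • cz • euler, c • cz), one})

/-- As for `alg11`, the coefficient of `z(xp + yq)` has to be `l`. -/
def alg12 (l : ℕ) (c : ℝ) : Submodule ℝ DiffOp := Submodule.span ℝ
  (sl2 ∪ translations (powers l) ∪
    {(euler, 0), (vr, 0), (cz • vr, 0), (cz ^ 2 • vr + (l : ℝ) • cz • euler, c • cz), one})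

/-! ### The modules -/

/-- The box `I × J × L`. -/
def box (I J L : Set ℝ) : Set Space := I ×ˢ (J ×ˢ L)

/-- `Span {x^i y^j g(z) | i + j ≤ n, g ∈ G^{(i+j)}}` on the open set `U`. -/
def polyModule (U : Set Space) (n : ℕ) (G : ℕ → Submodule ℝ (ℝ → ℝ)) :
    Submodule ℝ (Space → ℝ) := Submodule.span ℝ
  {f | ∃ i j : ℕ, i + j ≤ n ∧ ∃ g ∈ G (i + j), f = U.indicator (cx ^ i * cy ^ j * ofZ g)}

/-- `Span {x^i y^j z^k | (i, j, k) ∈ S}` on the open set `U`. -/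
def monoModule (U : Set Space) (S : Set (ℕ × ℕ × ℕ)) : Submodule ℝ (Space → ℝ) :=
  Submodule.span ℝ
    {f | ∃ i j k : ℕ, (i, j, k) ∈ S ∧ f = U.indicator (cx ^ i * cy ^ j * cz ^ k)}

/-- `Span {z^k e^{λz} | λ ∈ Λ, k ≤ m λ}` (real form) on the interval `L`. -/
def expModule (L : Set ℝ) (Λ : Finset ℂ) (m : ℂ → ℕ) : Submodule ℝ (ℝ → ℝ) :=
  Submodule.span ℝ {g | ∃ ζ ∈ expMonomials Λ m, g = L.indicator ζ}

/-- Each `G^{(l)}`, `l ≤ n`, is a finite-dimensional space of smooth functions on `L`. -/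
def FiniteFamily (L : Set ℝ) (n : ℕ) (G : ℕ → Submodule ℝ (ℝ → ℝ)) : Prop :=
  ∀ l ≤ n, G l ≤ smoothFun L ∧ FiniteDimensional ℝ (G l)

/-- `ζ G^{(l)} ⊆ G^{(l-1)}` for every `ζ ∈ S` and `1 ≤ l ≤ n`. -/
def Lowers (S : Set (ℝ → ℝ)) (n : ℕ) (G : ℕ → Submodule ℝ (ℝ → ℝ)) : Prop :=
  ∀ ζ ∈ S, ∀ l < n, ∀ g ∈ G (l + 1), ζ * g ∈ G l

end QES

end

/-! Every algebra here contains the copy `xq, xp - yq, yp` of `sl₂`, and this alone forces the shape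
of a fixed module `N`. On the finite-dimensional `N` the relation `[H, E] = cE` with `c ≠ 0` makes
`E` nilpotent (`nilpotent_of_commutator`), so `xq` and `yp` are nilpotent. Since `(xq)^k = x^k q^k`,
and `x^k` can be cancelled by continuity, powers of `p` and `q` kill `N` (`exists_der_pow_eq_zero`).
Hence every function in `N` is a polynomial in `x, y` whose coefficients are smooth in `z`
(`exists_eq_sum_mono`).

The Casimir element plus the weight operator has pairwise distinct eigenvalues on the `x^i y^j
g(z)`, so `N` contains each term of each of its elements (`mono_mem_of_sum_mem`); `xq` and `yp` move
a term through all monomials of its degree. Thus `N` is the polynomial module built on its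
components `comp I J L N l` (`eq_polyModule_comp`), and `comp_polyModule` says that the components
are determined uniquely.

Each further generator now becomes a condition on spaces of functions of `z` alone. `ζp` and `ζq`
say that `ζ` maps component `l + 1` into component `l`. An operator `A r + B (xp + yq) + C` acts on
component `l` as `A d/dz + lB + C`. The operator `x(xp + yq) + Cx` maps component `l` to component
`l + 1` by `l + C`. At the top degree this last map must vanish, which gives `C = -n`; below the
top, together with `p`, it makes all components equal (`comp_eq_of_raise`).

What remains is one-variable analysis. A finite-dimensional space stable under `d/dz` is exponential
(`exists_eq_expModule`); if it is also stable under `z d/dz`, it is spanned by the first few powers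
of `z` (`exists_eq_powSpan`). The operator `z² d/dz + bdz + cz` must kill the top power, which fixes
its coefficient (`coeff_of_cz_sq`). A multiplier preserving all components satisfies a polynomial
equation, so by connectedness it is constant (`const_of_locallyNontrivial`). Conversely, stability
of a given module is a check on generators (`act_mem_of_generators`). -/

noncomputable section

namespace QES

/-! ### Linear algebra -/

section Algebra

open Finset

/-- On a finite-dimensional invariant subspace, `[H, E] = cE` with `c ≠ 0` makes `E` nilpotent. -/
theorem nilpotent_of_commutator {V : Type*} [AddCommGroup V] [Module ℝ V] (W : Submodule ℝ V)
    [FiniteDimensional ℝ W] (E H : Module.End ℝ V) (hE : ∀ w ∈ W, E w ∈ W)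
    (hH : ∀ w ∈ W, H w ∈ W) {c : ℝ} (hc : c ≠ 0)
    (h : ∀ w ∈ W, H (E w) - E (H w) = c • E w) : ∃ k : ℕ, ∀ w ∈ W, (E ^ k) w = 0 := by
  set e : Module.End ℝ W := E.restrict hE with he
  set η : Module.End ℝ W := H.restrict hH with hη
  have h1 : η * e - e * η = c • e := by
    ext w
    exact h w w.2
  -- The map `ad η` is a derivation, so the eigenvalues add up along powers of `e`.
  have hk : ∀ k : ℕ, η * e ^ k - e ^ k * η = ((k : ℝ) * c) • e ^ k := by
    intro k
    induction k with
    | zero => simp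
    | succ k ih =>
      have : η * e ^ (k + 1) - e ^ (k + 1) * η
          = (η * e ^ k - e ^ k * η) * e + e ^ k * (η * e - e * η) := by
        simp only [pow_succ, sub_mul, mul_sub, mul_assoc]; abel
      rw [this, ih, h1]
      push_cast
      rw [smul_mul_assoc, mul_smul_comm, ← pow_succ, ← add_smul]
      congr 1; ring
  by_contra! hne
  have hne' : ∀ k : ℕ, e ^ k ≠ 0 := by
    intro k h0
    obtain ⟨w, hw, hw0⟩ := hne k
    apply hw0
    have := congrArg (fun f : Module.End ℝ W => ((f ⟨w, hw⟩ : W) : V)) h0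
    rw [he, Module.End.pow_restrict] at this
    exact this
  -- If no power of `e` vanished, `ad η` would have the infinitely many eigenvalues `k * c` on the
  -- finite-dimensional space of endomorphisms of `W`.
  let L : Module.End ℝ (Module.End ℝ W) := LinearMap.mulLeft ℝ η - LinearMap.mulRight ℝ η
  have hL : ∀ k : ℕ, L.HasEigenvalue ((k : ℝ) * c) := by
    intro k
    refine Module.End.hasEigenvalue_of_hasEigenvector (x := e ^ k) ⟨?_, hne' k⟩
    rw [Module.End.mem_eigenspace_iff]
    simpa [L] using hk k
  refine Set.infinite_of_injective_forall_mem (f := fun k : ℕ => (k : ℝ) * c) ?_ hL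
    L.finite_hasEigenvalue
  intro a b hab
  exact_mod_cast mul_right_cancel₀ hc hab

/-! ### Pairs of operators with `[D, M] = 1`. -/

section Weyl

variable {𝕜 V : Type*} [Field 𝕜] [AddCommGroup V] [Module 𝕜 V]
  {D M : Module.End 𝕜 V}

theorem weyl_apply (h : D * M - M * D = 1) (v : V) : D (M v) = M (D v) + v := by
  have := congrArg (fun f : Module.End 𝕜 V => f v) h
  simp only [LinearMap.sub_apply, Module.End.mul_apply, Module.End.one_apply] at this
  exact (sub_eq_iff_eq_add'.1 this)

theorem weyl_apply_pow (h : D * M - M * D = 1) {v : V} (hv : D v = 0) (k : ℕ) :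
    D ((M ^ (k + 1)) v) = ((k : 𝕜) + 1) • (M ^ k) v := by
  induction k with
  | zero => simp [weyl_apply h, hv]
  | succ k ih =>
    rw [pow_succ' M (k + 1), Module.End.mul_apply, weyl_apply h, ih, map_smul, pow_succ' M k,
      Module.End.mul_apply]
    push_cast
    module

/-- The model is `D = d/dx`, `M = x` and `v` a constant: the formula for the `k`-th derivative of
`x^(m+k)`. -/
theorem weyl_pow_pow_add (h : D * M - M * D = 1) {v : V} (hv : D v = 0) (m k : ℕ) :
    (D ^ k) ((M ^ (m + k)) v) = ((m + k).descFactorial k : 𝕜) • (M ^ m) v := by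
  induction k with
  | zero => simp
  | succ k ih =>
    rw [pow_succ D, Module.End.mul_apply, ← add_assoc, weyl_apply_pow h hv, map_smul, ih, smul_smul,
      Nat.succ_descFactorial_succ]
    push_cast; rfl

theorem weyl_pow_pow_of_lt (h : D * M - M * D = 1) {v : V} (hv : D v = 0) {j k : ℕ} (hjk : j < k) :
    (D ^ k) ((M ^ j) v) = 0 := by
  obtain ⟨m, rfl⟩ := Nat.exists_eq_add_of_lt hjk
  have := weyl_pow_pow_add h hv 0 j
  rw [zero_add] at this
  rw [show j + m + 1 = m + 1 + j by ring, pow_add, Module.End.mul_apply, this]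
  simp [pow_succ, hv]

/-- If `[D, M] = 1`, then a vector killed by `D^k` is a polynomial in `M` of degree less than `k`
with coefficients in the kernel of `D`; the coefficients stay in any invariant subspace. -/
theorem weyl_expansion [CharZero 𝕜] (h : D * M - M * D = 1) (S : Submodule 𝕜 V)
    (hSD : ∀ v ∈ S, D v ∈ S) (hSM : ∀ v ∈ S, M v ∈ S) (k : ℕ) :
    ∀ v ∈ S, (D ^ k) v = 0 →
      ∃ g : ℕ → V, (∀ j, g j ∈ S ∧ D (g j) = 0) ∧ v = ∑ j ∈ range k, (M ^ j) (g j) := by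
  have hSDk : ∀ k, ∀ v ∈ S, (D ^ k) v ∈ S := by
    intro k
    induction k with
    | zero => simp
    | succ k ih => intro v hv; rw [pow_succ', Module.End.mul_apply]; exact hSD _ (ih v hv)
  have hSMk : ∀ k, ∀ v ∈ S, (M ^ k) v ∈ S := by
    intro k
    induction k with
    | zero => simp
    | succ k ih => intro v hv; rw [pow_succ', Module.End.mul_apply]; exact hSM _ (ih v hv)
  induction k with
  | zero => intro v _ hv; exact ⟨0, by simp, by simpa using hv⟩
  | succ k ih =>
    intro v hvS hv
    -- The leading Taylor coefficient: `D^k M^k w = k! w`, so subtracting `M^k w` leaves a vector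
    -- killed by `D^k`.
    set w : V := (k.factorial : 𝕜)⁻¹ • (D ^ k) v with hw
    have hwS : w ∈ S := S.smul_mem _ (hSDk k v hvS)
    have hDw : D w = 0 := by
      rw [hw, map_smul, ← Module.End.mul_apply, ← pow_succ', hv, smul_zero]
    have hf : (k.factorial : 𝕜) ≠ 0 := by exact_mod_cast k.factorial_ne_zero
    have h0 : (D ^ k) (v - (M ^ k) w) = 0 := by
      have := weyl_pow_pow_add h hDw 0 k
      rw [zero_add, Nat.descFactorial_self] at this
      rw [map_sub, this, hw, pow_zero, Module.End.one_apply, smul_smul, mul_inv_cancel₀ hf,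
        one_smul, sub_self]
    obtain ⟨g, hg, hs⟩ := ih _ (S.sub_mem hvS (hSMk k w hwS)) h0
    refine ⟨fun j => if j = k then w else g j, fun j => ?_, ?_⟩
    · by_cases hj : j = k
      · simp [hj, hwS, hDw]
      · simpa [hj] using hg j
    · rw [sum_range_succ]
      have : ∑ j ∈ range k, (M ^ j) (if j = k then w else g j) = ∑ j ∈ range k, (M ^ j) (g j) :=
        sum_congr rfl fun j hj => by rw [if_neg (mem_range.1 hj).ne]
      rw [this, ← hs]
      simp

/-- If `[D, M] = 1` and the kernel of `D` is spanned by `e`, the invariant subspaces on which `D`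
is nilpotent are the spans of `e, M e, …, M^{m-1} e`. -/
theorem jordan_string [CharZero 𝕜] (h : D * M - M * D = 1) {e : V} (he : D e = 0)
    (hker : ∀ v, D v = 0 → ∃ c : 𝕜, v = c • e) (W : Submodule 𝕜 V) (hW : ∀ w ∈ W, D w ∈ W)
    (k : ℕ) (hk : ∀ w ∈ W, (D ^ k) w = 0) :
    ∃ m : ℕ, W = Submodule.span 𝕜 {v | ∃ j < m, v = (M ^ j) e} := by
  classical
  have hex : ∃ k : ℕ, ∀ w ∈ W, (D ^ k) w = 0 := ⟨k, hk⟩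
  set m := Nat.find hex with hm
  have hexp : ∀ k v, (D ^ k) v = 0 → ∃ c : ℕ → 𝕜, v = ∑ j ∈ range k, c j • (M ^ j) e := by
    intro k v hv
    obtain ⟨g, hg, rfl⟩ := weyl_expansion h ⊤ (by simp) (by simp) k v trivial hv
    choose c hc using fun j => hker (g j) (hg j).2
    exact ⟨c, sum_congr rfl fun j _ => by rw [hc j, map_smul]⟩
  have hWk : ∀ k, ∀ v ∈ W, (D ^ k) v ∈ W := by
    intro k
    induction k with
    | zero => simp
    | succ k ih => intro v hv; rw [pow_succ', Module.End.mul_apply]; exact hW _ (ih v hv)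
  refine ⟨m, le_antisymm ?_ ?_⟩
  · intro w hw
    obtain ⟨c, rfl⟩ := hexp m w (Nat.find_spec hex w hw)
    exact Submodule.sum_mem _ fun j hj =>
      Submodule.smul_mem _ _ (Submodule.subset_span ⟨j, mem_range.1 hj, rfl⟩)
  · rw [Submodule.span_le]
    rintro _ ⟨j, hj, rfl⟩
    induction j using Nat.strong_induction_on with
    | _ j ih =>
      -- By minimality of `m` some `f` in `W` survives `D^(m-1)`. Then `D^(m-1-j) f` is killed by
      -- `D^(j+1)` but not by `D^j`, so its expansion has a nonzero `M^j e` term, with lower terms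
      -- already in `W`.
      have hmin := Nat.find_min hex (m := m - 1) (by omega)
      push Not at hmin
      obtain ⟨f, hf, hf0⟩ := hmin
      set u := (D ^ (m - 1 - j)) f with hu
      have huW : u ∈ W := hWk _ f hf
      have hu1 : (D ^ (j + 1)) u = 0 := by
        rw [hu, ← Module.End.mul_apply, ← pow_add, show j + 1 + (m - 1 - j) = m by omega]
        exact Nat.find_spec hex f hf
      have hu0 : (D ^ j) u ≠ 0 := by
        rw [hu, ← Module.End.mul_apply, ← pow_add, show j + (m - 1 - j) = m - 1 by omega]
        exact hf0
      obtain ⟨c, hc⟩ := hexp (j + 1) u hu1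
      rw [sum_range_succ] at hc
      have hs : ∑ i ∈ range j, c i • (M ^ i) e ∈ W := Submodule.sum_mem _ fun i hi =>
        W.smul_mem _ (ih i (mem_range.1 hi) (by have := mem_range.1 hi; omega))
      have hcj : c j ≠ 0 := by
        intro hcj
        apply hu0
        rw [hc, hcj, zero_smul, add_zero, map_sum]
        refine sum_eq_zero fun i hi => ?_
        rw [map_smul, weyl_pow_pow_of_lt h he (mem_range.1 hi), smul_zero]
      have : (M ^ j) e = (c j)⁻¹ • (u - ∑ i ∈ range j, c i • (M ^ i) e) := by
        rw [hc, add_sub_cancel_left, smul_smul, inv_mul_cancel₀ hcj, one_smul]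
      rw [SetLike.mem_coe, this]
      exact W.smul_mem _ (W.sub_mem huW hs)

end Weyl

/-- An invariant subspace containing a sum of eigenvectors with distinct eigenvalues contains
each of them. -/
theorem mem_of_sum_eigenvectors_mem {V ι : Type*} [AddCommGroup V] [Module ℝ V]
    (T : Module.End ℝ V) (S : Submodule ℝ V) (hS : ∀ v ∈ S, T v ∈ S) (μ : ι → ℝ) (v : ι → V)
    (s : Finset ι) :
    (∀ i ∈ s, T (v i) = μ i • v i) → Set.InjOn μ s → ∑ i ∈ s, v i ∈ S → ∀ i ∈ s, v i ∈ S := by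
  classical
  induction s using Finset.induction_on generalizing v with
  | empty => simp
  | insert a s ha ih =>
    intro hT hμ hsum
    have key : ∀ i ∈ s, v i ∈ S := by
      intro i hi
      -- Applying `T - μ a` deletes the term `a` and rescales the others by nonzero factors.
      have h1 : ∑ i ∈ s, (μ i - μ a) • v i ∈ S := by
        have h2 := S.sub_mem (hS _ hsum) (S.smul_mem (μ a) hsum)
        rw [sum_insert ha, map_add, hT a (mem_insert_self a s), smul_add, add_sub_add_left_eq_sub,
          map_sum, smul_sum, ← sum_sub_distrib] at h2
        convert h2 using 1
        exact sum_congr rfl fun i hi => by rw [hT i (mem_insert_of_mem hi), sub_smul]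
      have h3 := ih (fun i => (μ i - μ a) • v i)
        (fun i hi => by rw [map_smul, hT i (mem_insert_of_mem hi), smul_comm])
        (hμ.mono (by simp)) h1 i hi
      have h4 : μ i - μ a ≠ 0 := sub_ne_zero.2 fun h =>
        ha (hμ (by simp [hi]) (by simp) h ▸ hi)
      simpa [smul_smul, inv_mul_cancel₀ h4] using S.smul_mem (μ i - μ a)⁻¹ h3
    intro i hi
    rcases mem_insert.1 hi with rfl | hi
    · rw [sum_insert ha] at hsum
      exact (S.add_mem_iff_left (S.sum_mem key)).1 hsum
    · exact key i hi

/-- The generalized eigenspaces of an operator on a finite-dimensional invariant subspace. -/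
theorem exists_generalized_eigenspaces {V : Type*} [AddCommGroup V] [Module ℂ V]
    (D : Module.End ℂ V) (W : Submodule ℂ V) [FiniteDimensional ℂ W] (hW : ∀ w ∈ W, D w ∈ W) :
    ∃ (E : ℂ → Submodule ℂ V) (k : ℕ), ⨆ lam, E lam = W ∧ {lam | E lam ≠ ⊥}.Finite ∧
      ∀ lam, ∀ w ∈ E lam, (D - lam • 1) w ∈ E lam ∧ ((D - lam • 1) ^ k) w = 0 := by
  set d : Module.End ℂ W := D.restrict hW
  have hresk : ∀ (lam : ℂ) (k : ℕ) (x : W), (((d - lam • 1) ^ k) x : V) = ((D - lam • 1) ^ k) x := by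
    intro lam k
    induction k with
    | zero => intro x; rfl
    | succ k ih =>
      intro x
      rw [pow_succ, pow_succ, Module.End.mul_apply, Module.End.mul_apply, ih]
      rfl
  -- The dimension of `W` serves as one nilpotency exponent for all `lam`.
  refine ⟨fun lam => (d.maxGenEigenspace lam).map W.subtype, Module.finrank ℂ W, ?_, ?_, ?_⟩
  · rw [← Submodule.map_iSup, Module.End.iSup_maxGenEigenspace_eq_top, Submodule.map_top,
      Submodule.range_subtype]
  · refine d.finite_hasEigenvalue.subset fun lam hlam => ?_
    by_contra hne
    apply hlam
    beta_reduce
    rw [Module.End.maxGenEigenspace_eq_genEigenspace_finrank]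
    by_contra h0
    refine hne (Module.End.HasUnifEigenvalue.lt one_pos
      (show d.HasUnifEigenvalue lam (Module.finrank ℂ W : ℕ) from fun h1 => h0 ?_))
    rw [h1, Submodule.map_bot]
  · rintro lam _ ⟨x, hx, rfl⟩
    refine ⟨⟨(d - lam • 1) x, ?_, rfl⟩, ?_⟩
    · exact Module.End.mapsTo_maxGenEigenspace_of_comm
        ((Commute.refl d).sub_right ((Commute.one_right d).smul_right lam)) lam hx
    · rw [SetLike.mem_coe, Module.End.maxGenEigenspace_eq_genEigenspace_finrank,
        Module.End.mem_genEigenspace_nat, LinearMap.mem_ker] at hx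
      rw [Submodule.subtype_apply, ← hresk, hx]; rfl

/-- A function `φ` whose multiplication operator preserves a finite-dimensional space of functions
satisfies a polynomial equation wherever the space does not vanish. -/
theorem exists_polynomial_of_mul_stable {X : Type*} (N : Submodule ℝ (X → ℝ))
    [FiniteDimensional ℝ N] (φ : X → ℝ) (h : ∀ f ∈ N, φ * f ∈ N) :
    ∃ P : Polynomial ℝ, P ≠ 0 ∧ ∀ f ∈ N, ∀ a, f a ≠ 0 → P.eval (φ a) = 0 := by
  -- Since `P(m)` is multiplication by `P ∘ φ`, the minimal polynomial of `m` vanishes at `φ a` as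
  -- soon as some `f a ≠ 0`.
  let m : Module.End ℝ N := (LinearMap.mulLeft ℝ φ).restrict h
  have key : ∀ (P : Polynomial ℝ) (f : N) (a : X),
      (Polynomial.aeval m P f : X → ℝ) a = P.eval (φ a) * (f : X → ℝ) a := by
    intro P
    induction P using Polynomial.induction_on' with
    | add p q hp hq => intro f a; simp [hp, hq, add_mul]
    | monomial n c =>
      intro f a
      simp only [Polynomial.aeval_monomial, Polynomial.eval_monomial, Module.End.mul_apply,
        Module.algebraMap_end_apply, Submodule.coe_smul, Pi.smul_apply, smul_eq_mul, mul_assoc]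
      congr 1
      induction n generalizing f with
      | zero => simp
      | succ n ih =>
        rw [pow_succ', Module.End.mul_apply]
        change φ a * _ = _
        rw [Submodule.subtype_apply, ih]; ring
  refine ⟨minpoly ℝ m, minpoly.ne_zero (Algebra.IsIntegral.isIntegral m), fun f hf a ha => ?_⟩
  have := key (minpoly ℝ m) ⟨f, hf⟩ a
  have h0 : Polynomial.aeval m (minpoly ℝ m) = 0 := minpoly.aeval ℝ m
  rw [h0] at this
  simpa [ha] using this.symm

end Algebra

/-! ### Operators on smooth functions -/

section Operators

variable {E : Type*} [NormedAddCommGroup E] [NormedSpace ℝ E] {U : Set E}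

theorem smoothFun_ext {f g : E → ℝ} (hf : f ∈ smoothFun U) (hg : g ∈ smoothFun U)
    (h : ∀ a ∈ U, f a = g a) : f = g := by
  ext a
  by_cases ha : a ∈ U
  · exact h a ha
  · rw [hf.2 a ha, hg.2 a ha]

theorem indicator_mem_smoothFun {φ : E → ℝ} (hφ : ContDiffOn ℝ ∞ φ U) :
    U.indicator φ ∈ smoothFun U :=
  ⟨hφ.congr fun _ ha => Set.indicator_of_mem ha _, fun _ ha => Set.indicator_of_notMem ha _⟩

theorem mul_mem_smoothFun {φ f : E → ℝ} (hφ : ContDiffOn ℝ ∞ φ U) (hf : f ∈ smoothFun U) :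
    φ * f ∈ smoothFun U :=
  ⟨hφ.mul hf.1, fun a ha => by simp [hf.2 a ha]⟩

theorem contDiffAt_of_mem_smoothFun (hU : IsOpen U) {f : E → ℝ} (hf : f ∈ smoothFun U) {a : E}
    (ha : a ∈ U) : ContDiffAt ℝ ∞ f a := hf.1.contDiffAt (hU.mem_nhds ha)

theorem differentiableAt_of_mem_smoothFun (hU : IsOpen U) {f : E → ℝ} (hf : f ∈ smoothFun U)
    {a : E} (ha : a ∈ U) : DifferentiableAt ℝ f a :=
  (contDiffAt_of_mem_smoothFun hU hf ha).differentiableAt (by simp)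

theorem der_mem_smoothFun (hU : IsOpen U) (v : E) {f : E → ℝ} (hf : f ∈ smoothFun U) :
    U.indicator (fun a => fderiv ℝ f a v) ∈ smoothFun U :=
  indicator_mem_smoothFun ((hf.1.fderiv_of_isOpen hU (by simp)).clm_apply contDiffOn_const)

/-- The directional derivative along a constant vector. -/
def der (hU : IsOpen U) (v : E) : Module.End ℝ (smoothFun U) where
  toFun f := ⟨U.indicator (fun a => fderiv ℝ f a v), der_mem_smoothFun hU v f.2⟩
  map_add' f g := by
    ext a
    by_cases ha : a ∈ U
    · simp [ha, fderiv_add (differentiableAt_of_mem_smoothFun hU f.2 ha)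
        (differentiableAt_of_mem_smoothFun hU g.2 ha)]
    · simp [ha]
  map_smul' c f := by
    ext a
    by_cases ha : a ∈ U
    · simp [ha, fderiv_const_smul (differentiableAt_of_mem_smoothFun hU f.2 ha)]
    · simp [ha]

theorem der_apply (hU : IsOpen U) (v : E) (f : smoothFun U) {a : E} (ha : a ∈ U) :
    (der hU v f : E → ℝ) a = fderiv ℝ f a v := by
  change U.indicator (fun a => fderiv ℝ (f : E → ℝ) a v) a = _
  rw [Set.indicator_of_mem ha]

/-- Multiplication by a smooth function. -/
def mulBy {φ : E → ℝ} (hφ : ContDiffOn ℝ ∞ φ U) : Module.End ℝ (smoothFun U) where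
  toFun f := ⟨φ * f, mul_mem_smoothFun hφ f.2⟩
  map_add' f g := by ext a; simp [mul_add]
  map_smul' c f := by ext a; simp [mul_left_comm]

@[simp]
theorem mulBy_apply {φ : E → ℝ} (hφ : ContDiffOn ℝ ∞ φ U) (f : smoothFun U) (a : E) :
    (mulBy hφ f : E → ℝ) a = φ a * (f : E → ℝ) a := rfl

theorem mulBy_pow_apply {φ : E → ℝ} (hφ : ContDiffOn ℝ ∞ φ U) (f : smoothFun U) (a : E) (k : ℕ) :
    ((mulBy hφ ^ k) f : E → ℝ) a = φ a ^ k * (f : E → ℝ) a := by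
  induction k with
  | zero => simp
  | succ k ih => rw [pow_succ', Module.End.mul_apply, mulBy_apply, ih]; ring

theorem mulBy_comm {φ ψ : E → ℝ} (hφ : ContDiffOn ℝ ∞ φ U) (hψ : ContDiffOn ℝ ∞ ψ U) :
    Commute (mulBy hφ) (mulBy hψ) := by
  ext f a
  simp [Module.End.mul_apply]; ring

theorem der_comm (hU : IsOpen U) (v w : E) : Commute (der hU v) (der hU w) := by
  refine LinearMap.ext fun f => Subtype.ext (smoothFun_ext (der hU v (der hU w f)).2
    (der hU w (der hU v f)).2 fun a ha => ?_)
  have key : ∀ v w : E, (der hU v (der hU w f) : E → ℝ) a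
      = fderiv ℝ (fderiv ℝ (f : E → ℝ)) a v w := by
    intro v w
    rw [der_apply hU _ _ ha]
    have h1 : ((der hU w f : smoothFun U) : E → ℝ) =ᶠ[nhds a] fun b => fderiv ℝ f b w := by
      filter_upwards [hU.mem_nhds ha] with b hb using der_apply hU w f hb
    rw [h1.fderiv_eq]
    have h2 : DifferentiableAt ℝ (fderiv ℝ (f : E → ℝ)) a :=
      ((f.2.1.fderiv_of_isOpen hU (m := ∞) (by simp)).contDiffAt
        (hU.mem_nhds ha)).differentiableAt (by simp)
    rw [fderiv_clm_apply h2 (differentiableAt_const w)]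
    simp
  rw [Module.End.mul_apply, Module.End.mul_apply, key, key]
  exact ((contDiffAt_of_mem_smoothFun hU f.2 ha).isSymmSndFDerivAt
    (by simpa using ENat.LEInfty.out)) v w

theorem der_mulBy (hU : IsOpen U) (v : E) {φ : E → ℝ} (hφ : ContDiffOn ℝ ∞ φ U) (f : smoothFun U)
    {a : E} (ha : a ∈ U) {φ' : E →L[ℝ] ℝ} (h : HasFDerivAt φ φ' a) :
    (der hU v (mulBy hφ f) : E → ℝ) a
      = φ a * (der hU v f : E → ℝ) a + φ' v * (f : E → ℝ) a := by
  rw [der_apply hU _ _ ha, der_apply hU _ _ ha]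
  have := h.mul (differentiableAt_of_mem_smoothFun hU f.2 ha).hasFDerivAt
  rw [show ((mulBy hφ f : smoothFun U) : E → ℝ) = φ * f from rfl, this.fderiv]
  simp [mul_comm]

/-- The commutator of a derivative and a multiplication, when it is a constant. -/
theorem der_mul_mulBy (hU : IsOpen U) (v : E) {φ : E → ℝ} (hφ : ContDiffOn ℝ ∞ φ U)
    (φ' : E →L[ℝ] ℝ) (h : ∀ a ∈ U, HasFDerivAt φ φ' a) :
    der hU v * mulBy hφ - mulBy hφ * der hU v = φ' v • 1 := by
  refine LinearMap.ext fun f => Subtype.ext (smoothFun_ext (Subtype.property _)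
    (Subtype.property _) fun a ha => ?_)
  have := der_mulBy hU v hφ f ha (h a ha)
  simp only [LinearMap.sub_apply, Module.End.mul_apply, LinearMap.smul_apply,
    Module.End.one_apply, Submodule.coe_sub, Submodule.coe_smul, Pi.sub_apply, Pi.smul_apply,
    smul_eq_mul, mulBy_apply]
  rw [this]; ring

end Operators

/-! ### Functions of `z` -/

/-- The derivative of a function on `L`. -/
def dz (L : Set ℝ) (g : ℝ → ℝ) : ℝ → ℝ := L.indicator (deriv g)

theorem der_one_eq_dz {L : Set ℝ} (hL : IsOpen L) (g : smoothFun L) :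
    (der hL 1 g : ℝ → ℝ) = dz L g := by
  ext z
  change L.indicator (fun a => fderiv ℝ (g : ℝ → ℝ) a 1) z = _
  rfl

theorem dz_mem_smoothFun {L : Set ℝ} (hL : IsOpen L) {g : ℝ → ℝ} (hg : g ∈ smoothFun L) :
    dz L g ∈ smoothFun L := by
  rw [← der_one_eq_dz hL ⟨g, hg⟩]
  exact Subtype.property _

/-! ### The functions `x^i y^j g(z)` -/

theorem contDiff_cx : ContDiff ℝ ∞ cx := contDiff_fst
theorem contDiff_cy : ContDiff ℝ ∞ cy := contDiff_fst.comp contDiff_snd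
theorem contDiff_cz : ContDiff ℝ ∞ cz := contDiff_snd.comp contDiff_snd

theorem contDiffOn_ofZ {I J L : Set ℝ} {g : ℝ → ℝ} (hg : ContDiffOn ℝ ∞ g L) :
    ContDiffOn ℝ ∞ (ofZ g) (box I J L) :=
  hg.comp contDiff_cz.contDiffOn fun _ ha => ha.2.2

theorem hasFDerivAt_cx (a : Space) :
    HasFDerivAt cx (ContinuousLinearMap.fst ℝ ℝ (ℝ × ℝ)) a := hasFDerivAt_fst

theorem hasFDerivAt_cy (a : Space) :
    HasFDerivAt cy ((ContinuousLinearMap.fst ℝ ℝ ℝ).comp (ContinuousLinearMap.snd ℝ ℝ (ℝ × ℝ))) a :=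
  hasFDerivAt_fst.comp a hasFDerivAt_snd

theorem hasFDerivAt_cz (a : Space) :
    HasFDerivAt cz ((ContinuousLinearMap.snd ℝ ℝ ℝ).comp (ContinuousLinearMap.snd ℝ ℝ (ℝ × ℝ))) a :=
  hasFDerivAt_snd.comp a hasFDerivAt_snd

/-- The function `x^i y^j g(z)` on `U`. -/
def mono (U : Set Space) (i j : ℕ) (g : ℝ → ℝ) : Space → ℝ :=
  U.indicator (cx ^ i * cy ^ j * ofZ g)

/-- `mono` as a linear map. -/
def monoLin (U : Set Space) (i j : ℕ) : (ℝ → ℝ) →ₗ[ℝ] (Space → ℝ) where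
  toFun := mono U i j
  map_add' g h := by
    ext a
    by_cases ha : a ∈ U
    · simp [mono, ofZ, ha, mul_add]
    · simp [mono, ha]
  map_smul' c g := by
    ext a
    by_cases ha : a ∈ U
    · simp [mono, ofZ, ha, mul_left_comm]
    · simp [mono, ha]

theorem monoLin_apply (U : Set Space) (i j : ℕ) (g : ℝ → ℝ) : monoLin U i j g = mono U i j g := rfl

theorem mono_apply {U : Set Space} {i j : ℕ} {g : ℝ → ℝ} {a : Space} (ha : a ∈ U) :
    mono U i j g a = a.1 ^ i * a.2.1 ^ j * g a.2.2 := by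
  simp [mono, ha, cx, cy, ofZ]

theorem mono_of_notMem {U : Set Space} {i j : ℕ} {g : ℝ → ℝ} {a : Space} (ha : a ∉ U) :
    mono U i j g a = 0 := Set.indicator_of_notMem ha _

section Box

variable {I J L : Set ℝ}

theorem isOpen_box (hI : IsOpen I) (hJ : IsOpen J) (hL : IsOpen L) : IsOpen (box I J L) :=
  hI.prod (hJ.prod hL)

theorem mono_mem_smoothFun (i j : ℕ) {g : ℝ → ℝ} (hg : g ∈ smoothFun L) :
    mono (box I J L) i j g ∈ smoothFun (box I J L) :=
  indicator_mem_smoothFun (((contDiff_cx.pow i).mul (contDiff_cy.pow j)).contDiffOn.mul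
    (contDiffOn_ofZ hg.1))

theorem act_of_notMem {U : Set Space} {T : DiffOp} {f : Space → ℝ} {a : Space} (ha : a ∉ U) :
    act U T f a = 0 := Set.indicator_of_notMem ha _

theorem act_of_mem {U : Set Space} {T : DiffOp} {f : Space → ℝ} {a : Space} (ha : a ∈ U) :
    act U T f a = fderiv ℝ f a (T.1 a) + T.2 a * f a := Set.indicator_of_mem ha _

/-- The product rule, done once; the formulas for the single generators specialize it. The truncated
exponents `i - 1` and `j - 1` are harmless because they come with the factors `i` and `j`. -/
theorem act_mono (hU : IsOpen (box I J L)) (hL : IsOpen L) (T : DiffOp) (i j : ℕ) {g : ℝ → ℝ}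
    (hg : g ∈ smoothFun L) {a : Space} (ha : a ∈ box I J L) :
    act (box I J L) T (mono (box I J L) i j g) a =
      (T.1 a).1 * (i * a.1 ^ (i - 1) * a.2.1 ^ j * g a.2.2)
      + (T.1 a).2.1 * (a.1 ^ i * (j * a.2.1 ^ (j - 1)) * g a.2.2)
      + (T.1 a).2.2 * (a.1 ^ i * a.2.1 ^ j * dz L g a.2.2)
      + T.2 a * (a.1 ^ i * a.2.1 ^ j * g a.2.2) := by
  rw [act_of_mem ha, mono_apply ha]
  congr 1
  have h1 : mono (box I J L) i j g =ᶠ[nhds a] cx ^ i * cy ^ j * ofZ g := by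
    filter_upwards [hU.mem_nhds ha] with b hb using Set.indicator_of_mem hb _
  have hz : HasDerivAt g (deriv g (cz a)) (cz a) :=
    (differentiableAt_of_mem_smoothFun hL hg ha.2.2).hasDerivAt
  have h2 : HasFDerivAt (ofZ g) _ a := hz.comp_hasFDerivAt a (hasFDerivAt_cz a)
  have h3 : HasFDerivAt (cx ^ i * cy ^ j * ofZ g) _ a :=
    (((hasFDerivAt_cx a).pow i).mul ((hasFDerivAt_cy a).pow j)).mul h2
  have hd : dz L g a.2.2 = deriv g (cz a) := Set.indicator_of_mem ha.2.2 _
  rw [h1.fderiv_eq, h3.fderiv, hd]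
  simp [cx, cy, cz, ofZ]
  ring

/-! ### Action of the generators on `x^i y^j g(z)`. -/

section Generators

variable (hU : IsOpen (box I J L)) (hL : IsOpen L) {g : ℝ → ℝ} (hg : g ∈ smoothFun L) (i j : ℕ)
include hU hL hg

theorem act_xq : act (box I J L) (cx • vq, 0) (mono (box I J L) i j g)
    = (j : ℝ) • mono (box I J L) (i + 1) (j - 1) g := by
  ext a
  by_cases ha : a ∈ box I J L
  · rw [act_mono hU hL _ i j hg ha]
    simp [mono_apply ha, cx, vq]; ring
  · simp [act_of_notMem ha, mono_of_notMem ha]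

theorem act_yp : act (box I J L) (cy • vp, 0) (mono (box I J L) i j g)
    = (i : ℝ) • mono (box I J L) (i - 1) (j + 1) g := by
  ext a
  by_cases ha : a ∈ box I J L
  · rw [act_mono hU hL _ i j hg ha]
    simp [mono_apply ha, cy, vp]; ring
  · simp [act_of_notMem ha, mono_of_notMem ha]

theorem act_xp_add (C : ℝ → ℝ) : act (box I J L) (cx • vp, ofZ C) (mono (box I J L) i j g)
    = mono (box I J L) i j ((i : ℝ) • g + C * g) := by
  ext a
  by_cases ha : a ∈ box I J L
  · rw [act_mono hU hL _ i j hg ha]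
    rcases i with _ | i <;> simp [mono_apply ha, cx, vp, ofZ] <;> ring
  · simp [act_of_notMem ha, mono_of_notMem ha]

theorem act_yq_add (C : ℝ → ℝ) : act (box I J L) (cy • vq, ofZ C) (mono (box I J L) i j g)
    = mono (box I J L) i j ((j : ℝ) • g + C * g) := by
  ext a
  by_cases ha : a ∈ box I J L
  · rw [act_mono hU hL _ i j hg ha]
    rcases j with _ | j <;> simp [mono_apply ha, cy, vq, ofZ] <;> ring
  · simp [act_of_notMem ha, mono_of_notMem ha]

theorem act_xp_sub_yq : act (box I J L) (cx • vp - cy • vq, 0) (mono (box I J L) i j g)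
    = ((i : ℝ) - j) • mono (box I J L) i j g := by
  ext a
  by_cases ha : a ∈ box I J L
  · rw [act_mono hU hL _ i j hg ha]
    rcases i with _ | i <;> rcases j with _ | j <;>
      simp [mono_apply ha, cx, cy, vp, vq] <;> ring
  · simp [act_of_notMem ha, mono_of_notMem ha]

theorem act_zeta_p (ζ : ℝ → ℝ) : act (box I J L) (ofZ ζ • vp, 0) (mono (box I J L) i j g)
    = (i : ℝ) • mono (box I J L) (i - 1) j (ζ * g) := by
  ext a
  by_cases ha : a ∈ box I J L
  · rw [act_mono hU hL _ i j hg ha]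
    simp [mono_apply ha, vp, ofZ]; ring
  · simp [act_of_notMem ha, mono_of_notMem ha]

theorem act_zeta_q (ζ : ℝ → ℝ) : act (box I J L) (ofZ ζ • vq, 0) (mono (box I J L) i j g)
    = (j : ℝ) • mono (box I J L) i (j - 1) (ζ * g) := by
  ext a
  by_cases ha : a ∈ box I J L
  · rw [act_mono hU hL _ i j hg ha]
    simp [mono_apply ha, vq, ofZ]; ring
  · simp [act_of_notMem ha, mono_of_notMem ha]

/-- By Euler's relation `xp + yq` is the scalar `i + j` here, so the operator touches only the
coefficient `g`. -/
theorem act_vertical (A B C : ℝ → ℝ) :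
    act (box I J L) (ofZ A • vr + ofZ B • euler, ofZ C) (mono (box I J L) i j g)
      = mono (box I J L) i j (A * dz L g + ((i + j : ℕ) : ℝ) • (B * g) + C * g) := by
  ext a
  by_cases ha : a ∈ box I J L
  · rw [act_mono hU hL _ i j hg ha]
    rcases i with _ | i <;> rcases j with _ | j <;>
      simp [mono_apply ha, cx, cy, vp, vq, vr, euler, ofZ] <;> ring
  · simp [act_of_notMem ha, mono_of_notMem ha]

theorem act_raise_x (C : ℝ → ℝ) :
    act (box I J L) (cx ^ 2 • vp + (cx * cy) • vq, cx * ofZ C) (mono (box I J L) i j g)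
      = mono (box I J L) (i + 1) j (((i + j : ℕ) : ℝ) • g + C * g) := by
  ext a
  by_cases ha : a ∈ box I J L
  · rw [act_mono hU hL _ i j hg ha]
    rcases i with _ | i <;> rcases j with _ | j <;>
      simp [mono_apply ha, cx, cy, vp, vq, ofZ] <;> ring
  · simp [act_of_notMem ha, mono_of_notMem ha]

theorem act_raise_y (C : ℝ → ℝ) :
    act (box I J L) ((cx * cy) • vp + cy ^ 2 • vq, cy * ofZ C) (mono (box I J L) i j g)
      = mono (box I J L) i (j + 1) (((i + j : ℕ) : ℝ) • g + C * g) := by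
  ext a
  by_cases ha : a ∈ box I J L
  · rw [act_mono hU hL _ i j hg ha]
    rcases i with _ | i <;> rcases j with _ | j <;>
      simp [mono_apply ha, cx, cy, vp, vq, ofZ] <;> ring
  · simp [act_of_notMem ha, mono_of_notMem ha]

end Generators

theorem act_one {U : Set Space} {f : Space → ℝ} (hf : f ∈ smoothFun U) : act U one f = f := by
  ext a
  by_cases ha : a ∈ U
  · simp [act_of_mem ha, one]
  · rw [act_of_notMem ha, hf.2 a ha]

theorem act_add_left (U : Set Space) (S T : DiffOp) (f : Space → ℝ) :
    act U (S + T) f = act U S f + act U T f := by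
  ext a
  by_cases ha : a ∈ U
  · simp [act_of_mem ha]; ring
  · simp [act_of_notMem ha]

theorem act_smul_left (U : Set Space) (c : ℝ) (T : DiffOp) (f : Space → ℝ) :
    act U (c • T) f = c • act U T f := by
  ext a
  by_cases ha : a ∈ U
  · simp [act_of_mem ha]; ring
  · simp [act_of_notMem ha]

theorem act_add_right {U : Set Space} (hU : IsOpen U) (T : DiffOp) {f g : Space → ℝ}
    (hf : f ∈ smoothFun U) (hg : g ∈ smoothFun U) :
    act U T (f + g) = act U T f + act U T g := by
  ext a
  by_cases ha : a ∈ U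
  · simp [act_of_mem ha, fderiv_add (differentiableAt_of_mem_smoothFun hU hf ha)
        (differentiableAt_of_mem_smoothFun hU hg ha)]; ring
  · simp [act_of_notMem ha]

theorem act_smul_right {U : Set Space} (hU : IsOpen U) (T : DiffOp) (c : ℝ) {f : Space → ℝ}
    (hf : f ∈ smoothFun U) : act U T (c • f) = c • act U T f := by
  ext a
  by_cases ha : a ∈ U
  · simp [act_of_mem ha, fderiv_const_smul (differentiableAt_of_mem_smoothFun hU hf ha)]; ring
  · simp [act_of_notMem ha]

/-- Stability need only be checked on generators of the operators and of the functions. -/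
theorem act_mem_of_generators {U : Set Space} (hU : IsOpen U) {𝒯 : Set DiffOp}
    {S : Set (Space → ℝ)} {N : Submodule ℝ (Space → ℝ)} (hS : S ⊆ smoothFun U)
    (h : ∀ T ∈ 𝒯, ∀ f ∈ S, act U T f ∈ N) :
    ∀ T ∈ Submodule.span ℝ 𝒯, ∀ f ∈ Submodule.span ℝ S, act U T f ∈ N := by
  intro T hT f hf
  have hle : Submodule.span ℝ S ≤ smoothFun U := Submodule.span_le.2 hS
  induction hT using Submodule.span_induction with
  | mem T hT =>
    induction hf using Submodule.span_induction with
    | mem f hf => exact h T hT f hf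
    | zero =>
      have : act U T 0 = 0 := by
        simpa using act_smul_right hU T 0 (smoothFun U).zero_mem
      rw [this]; exact N.zero_mem
    | add f g hf hg ihf ihg =>
      rw [act_add_right hU T (hle hf) (hle hg)]; exact N.add_mem ihf ihg
    | smul c f hf ih => rw [act_smul_right hU T c (hle hf)]; exact N.smul_mem c ih
  | zero =>
    have : act U 0 f = 0 := by simpa using act_smul_left U 0 0 f
    rw [this]; exact N.zero_mem
  | add S T _ _ ihS ihT => rw [act_add_left]; exact N.add_mem ihS ihT
  | smul c T _ ih => rw [act_smul_left]; exact N.smul_mem c ih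

end Box

/-! ### Modules over `sl₂` -/

/-- The standing assumptions on the box: three nonempty open intervals. -/
structure IsOpenBox (I J L : Set ℝ) : Prop where
  oI : IsOpen I
  cI : I.OrdConnected
  nI : I.Nonempty
  oJ : IsOpen J
  cJ : J.OrdConnected
  nJ : J.Nonempty
  oL : IsOpen L
  cL : L.OrdConnected
  nL : L.Nonempty

theorem exists_ne_zero_mem {I : Set ℝ} (hI : IsOpen I) (hn : I.Nonempty) : ∃ x ∈ I, x ≠ 0 := by
  obtain ⟨x, hx⟩ := hn
  obtain ⟨y, hy, hy0⟩ := (infinite_of_mem_nhds x (hI.mem_nhds hx)).exists_notMem_finset {0}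
  exact ⟨y, hy, by simpa using hy0⟩

/-- The component of degree `l` of a space of functions: the `g(z)` with `x^i y^j g(z)` in the
space for all `i + j = l`. -/
def comp (I J L : Set ℝ) (N : Submodule ℝ (Space → ℝ)) (l : ℕ) : Submodule ℝ (ℝ → ℝ) :=
  smoothFun L ⊓ ⨅ p : {p : ℕ × ℕ // p.1 + p.2 = l}, N.comap (monoLin (box I J L) p.1.1 p.1.2)

theorem mem_comp {I J L : Set ℝ} {N : Submodule ℝ (Space → ℝ)} {l : ℕ} {g : ℝ → ℝ} :
    g ∈ comp I J L N l ↔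
      g ∈ smoothFun L ∧ ∀ i j, i + j = l → mono (box I J L) i j g ∈ N := by
  simp [comp, monoLin_apply]

theorem IsFixedModule.mono {U : Set Space} {g g' : Submodule ℝ DiffOp}
    {N : Submodule ℝ (Space → ℝ)} (h : IsFixedModule U g N) (hg : g' ≤ g) :
    IsFixedModule U g' N :=
  ⟨h.smooth, h.finite, fun T hT => h.stable T (hg hT)⟩

/-- The zero module turns `mono_mem_of_sum_mem` into linear independence of the `x^i y^j g(z)`; this
is how `comp_polyModule` uses it. -/
theorem isFixedModule_bot {U : Set Space} {g : Submodule ℝ DiffOp} : IsFixedModule U g ⊥ where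
  smooth := bot_le
  finite := inferInstance
  stable T _ f hf := by
    rw [Submodule.mem_bot] at hf ⊢
    ext a
    by_cases ha : a ∈ U
    · simp [act_of_mem ha, hf]
    · simp [act_of_notMem ha]

/-- A continuous function which vanishes wherever an affine coordinate is nonzero vanishes. -/
theorem mulBy_pow_injective {E : Type*} [NormedAddCommGroup E] [NormedSpace ℝ E] {U : Set E}
    (hU : IsOpen U) {φ : E → ℝ} (hφ : ContDiffOn ℝ ∞ φ U) (v : E)
    (hv : ∀ a (t : ℝ), φ (a + t • v) = φ a + t) (k : ℕ) {f : smoothFun U}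
    (hf : (mulBy hφ ^ k) f = 0) : f = 0 := by
  have h0 : ∀ b, φ b ≠ 0 → (f : E → ℝ) b = 0 := by
    intro b hb
    have := mulBy_pow_apply hφ f b k
    rw [hf] at this
    simpa [hb] using this.symm
  refine Subtype.ext (smoothFun_ext f.2 (Submodule.zero_mem _) fun a ha => ?_)
  by_contra hne
  have hc : ContinuousAt (f : E → ℝ) a := (contDiffAt_of_mem_smoothFun hU f.2 ha).continuousAt
  -- If `φ a = 0`, then `φ (a + t • v) = t ≠ 0` at points arbitrarily close to `a`; there `f`
  -- vanishes, against continuity at `a`.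
  have ht : Filter.Tendsto (fun t : ℝ => a + t • v) (nhdsWithin 0 {0}ᶜ) (nhds a) := by
    have : ContinuousAt (fun t : ℝ => a + t • v) 0 := by fun_prop
    simpa [ContinuousAt] using this.tendsto.mono_left nhdsWithin_le_nhds
  obtain ⟨t, ht1, ht2⟩ := ((ht.eventually (hc.eventually_ne hne)).and
    self_mem_nhdsWithin).exists
  have h1 : φ a = 0 := by
    by_contra h
    exact hne (h0 a h)
  exact ht1 (h0 _ (by rw [hv, h1, zero_add]; exact ht2))

/-- Presents a generator as a product in the endomorphism ring of smooth functions, where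
commutators and powers can be computed. -/
theorem mulBy_der_eq_act {U : Set Space} (hU : IsOpen U) {φ : Space → ℝ} (hφ : ContDiffOn ℝ ∞ φ U)
    (v : Space) (f : smoothFun U) :
    ((mulBy hφ * der hU v) f : Space → ℝ) = act U (φ • fun _ => v, 0) f := by
  ext a
  by_cases ha : a ∈ U
  · rw [act_of_mem ha, Module.End.mul_apply, mulBy_apply, der_apply _ _ _ ha]
    simp
  · rw [act_of_notMem ha, (Subtype.property ((mulBy hφ * der hU v) f)).2 a ha]

theorem mulBy_der_sub_eq_act {U : Set Space} (hU : IsOpen U) {φ ψ : Space → ℝ}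
    (hφ : ContDiffOn ℝ ∞ φ U) (hψ : ContDiffOn ℝ ∞ ψ U) (v w : Space) (f : smoothFun U) :
    ((mulBy hφ * der hU v - mulBy hψ * der hU w) f : Space → ℝ)
      = act U ((φ • fun _ => v) - ψ • fun _ => w, 0) f := by
  rw [LinearMap.sub_apply, Submodule.coe_sub, mulBy_der_eq_act, mulBy_der_eq_act]
  ext a
  by_cases ha : a ∈ U
  · simp [act_of_mem ha]
  · simp [act_of_notMem ha]

/-! ### Polynomial dependence on `x` and `y`. -/

section Structure

variable {I J L : Set ℝ} (hB : IsOpenBox I J L)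
include hB

theorem IsOpenBox.isOpen : IsOpen (box I J L) := isOpen_box hB.oI hB.oJ hB.oL

/-- Open intervals contain nonzero points, at which `x^i y^j` can be divided out. -/
theorem mono_injective {i j : ℕ} {g : ℝ → ℝ} (hg : g ∈ smoothFun L)
    (h : mono (box I J L) i j g = 0) : g = 0 := by
  obtain ⟨x, hx, hx0⟩ := exists_ne_zero_mem hB.oI hB.nI
  obtain ⟨y, hy, hy0⟩ := exists_ne_zero_mem hB.oJ hB.nJ
  refine smoothFun_ext hg (Submodule.zero_mem _) fun z hz => ?_
  have := congrFun h (x, y, z)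
  rw [mono_apply (show (x, y, z) ∈ box I J L from ⟨hx, hy, hz⟩)] at this
  simpa [hx0, hy0] using this

/-- A smooth function on the box with vanishing `x`- and `y`-derivatives depends on `z` only. -/
theorem exists_eq_mono_zero {f : Space → ℝ} (hf : f ∈ smoothFun (box I J L))
    (hx : ∀ a ∈ box I J L, fderiv ℝ f a (1, 0, 0) = 0)
    (hy : ∀ a ∈ box I J L, fderiv ℝ f a (0, 1, 0) = 0) :
    ∃ g ∈ smoothFun L, f = mono (box I J L) 0 0 g := by
  obtain ⟨x₀, hx₀⟩ := hB.nI
  obtain ⟨y₀, hy₀⟩ := hB.nJ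
  have hg : L.indicator (fun z => f (x₀, y₀, z)) ∈ smoothFun L := by
    refine indicator_mem_smoothFun (hf.1.comp (f := fun z : ℝ => ((x₀, y₀, z) : Space)) ?_ ?_)
    · exact (contDiff_const.prodMk (contDiff_const.prodMk contDiff_id)).contDiffOn
    · exact fun z hz => ⟨hx₀, hy₀, hz⟩
  refine ⟨_, hg, smoothFun_ext hf (mono_mem_smoothFun 0 0 hg) fun a ha => ?_⟩
  obtain ⟨x, y, z⟩ := a
  rw [mono_apply ha]
  simp only [pow_zero, one_mul, Set.indicator_of_mem ha.2.2]
  -- The function is constant along the segment from `(x₀, y₀, z)` to `(x, y, z)`, which stays in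
  -- the box because `I` and `J` are convex.
  set v : Space := (x - x₀, y - y₀, 0) with hv
  set b : Space := (x₀, y₀, z) with hb
  have hbU : b ∈ box I J L := ⟨hx₀, hy₀, ha.2.2⟩
  have hmem : ∀ t ∈ Set.Icc (0 : ℝ) 1, b + t • v ∈ box I J L := by
    intro t ht
    refine ⟨?_, ?_, ?_⟩
    · simpa [hb, hv] using hB.cI.convex.add_smul_sub_mem hx₀ ha.1 ht
    · simpa [hb, hv] using hB.cJ.convex.add_smul_sub_mem hy₀ ha.2.1 ht
    · simpa [hb, hv] using ha.2.2
  have hd : ∀ t ∈ Set.Icc (0 : ℝ) 1, HasDerivAt (fun t : ℝ => f (b + t • v)) 0 t := by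
    intro t ht
    have h1 := (differentiableAt_of_mem_smoothFun hB.isOpen hf (hmem t ht)).hasFDerivAt
    have h2 : HasDerivAt (fun t : ℝ => b + t • v) v t := by
      simpa using ((hasDerivAt_id t).smul_const v).const_add b
    have h3 := h1.comp_hasDerivAt t h2
    have h4 : v = (x - x₀) • ((1, 0, 0) : Space) + (y - y₀) • ((0, 1, 0) : Space) := by
      simp [hv]
    have h5 : fderiv ℝ f (b + t • v) v = 0 := by
      rw [h4, map_add, map_smul, map_smul, ← h4, hx _ (hmem t ht), hy _ (hmem t ht)]
      simp
    rw [h5] at h3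
    exact h3
  have := constant_of_has_deriv_right_zero (a := (0 : ℝ)) (b := 1)
    (fun t ht => (hd t ht).continuousAt.continuousWithinAt)
    (fun t ht => (hd t (Set.Ico_subset_Icc_self ht)).hasDerivWithinAt) 1 (by simp)
  simpa [hb, hv] using this

/-- A smooth function killed by powers of `∂/∂x` and `∂/∂y` is a polynomial in `x`, `y`. -/
theorem exists_eq_sum_mono (k : ℕ) (f : smoothFun (box I J L))
    (hx : (der hB.isOpen (1, 0, 0) ^ k) f = 0) (hy : (der hB.isOpen (0, 1, 0) ^ k) f = 0) :
    ∃ g : ℕ × ℕ → ℝ → ℝ, (∀ p, g p ∈ smoothFun L) ∧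
      (f : Space → ℝ) = ∑ p ∈ Finset.range k ×ˢ Finset.range k,
        mono (box I J L) p.1 p.2 (g p) := by
  set Dx := der hB.isOpen (1, 0, 0)
  set Dy := der hB.isOpen (0, 1, 0)
  set X := mulBy (U := box I J L) contDiff_cx.contDiffOn
  set Y := mulBy (U := box I J L) contDiff_cy.contDiffOn
  have hDX : Dx * X - X * Dx = 1 := by
    simpa using der_mul_mulBy hB.isOpen (1, 0, 0) contDiff_cx.contDiffOn _
      fun a _ => hasFDerivAt_cx a
  have hDY : Dy * Y - Y * Dy = 1 := by
    simpa using der_mul_mulBy hB.isOpen (0, 1, 0) contDiff_cy.contDiffOn _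
      fun a _ => hasFDerivAt_cy a
  have hDxY : Commute Dx Y := sub_eq_zero.1 (by
    simpa using der_mul_mulBy hB.isOpen (1, 0, 0) contDiff_cy.contDiffOn _
      fun a _ => hasFDerivAt_cy a)
  have hDyX : Commute Dy X := sub_eq_zero.1 (by
    simpa using der_mul_mulBy hB.isOpen (0, 1, 0) contDiff_cx.contDiffOn _
      fun a _ => hasFDerivAt_cx a)
  have hDD : Commute Dx Dy := der_comm hB.isOpen _ _
  have hker : ∀ {A B : Module.End ℝ (smoothFun (box I J L))}, Commute A B →
      ∀ v ∈ LinearMap.ker A, B v ∈ LinearMap.ker A := by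
    intro A B h v hv
    rw [LinearMap.mem_ker] at hv ⊢
    rw [← Module.End.mul_apply, h.eq, Module.End.mul_apply, hv, map_zero]
  -- Expand in powers of `y` with coefficients kept in the kernel of `Dx ^ k`, then each coefficient
  -- in powers of `x`, staying in the kernel of `Dy`. The final coefficients are killed by both
  -- derivatives.
  obtain ⟨u, hu, hfu⟩ := weyl_expansion hDY (LinearMap.ker (Dx ^ k)) (hker (hDD.pow_left k))
    (hker (hDxY.pow_left k)) k f hx hy
  choose w hw huw using fun j => weyl_expansion hDX (LinearMap.ker Dy) (hker hDD.symm)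
    (hker hDyX) k (u j) (hu j).2 (hu j).1
  have hz : ∀ i j, ∃ g ∈ smoothFun L, (w j i : Space → ℝ) = mono (box I J L) 0 0 g := by
    intro i j
    refine exists_eq_mono_zero hB (w j i).2 (fun a ha => ?_) (fun a ha => ?_)
    · rw [← der_apply hB.isOpen _ _ ha, (hw j i).2]; rfl
    · rw [← der_apply hB.isOpen _ _ ha, show der hB.isOpen (0, 1, 0) (w j i) = 0 from (hw j i).1]
      rfl
  choose g hg hgw using hz
  refine ⟨fun p => g p.1 p.2, fun p => hg _ _, ?_⟩
  rw [Finset.sum_product_right, hfu, AddSubmonoidClass.coe_finsetSum]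
  refine Finset.sum_congr rfl fun j _ => ?_
  rw [huw j, map_sum, AddSubmonoidClass.coe_finsetSum]
  refine Finset.sum_congr rfl fun i _ => ?_
  ext a
  rw [mulBy_pow_apply, mulBy_pow_apply, hgw]
  by_cases ha : a ∈ box I J L
  · rw [mono_apply ha, mono_apply ha]; simp [cx, cy]; ring
  · simp [mono_of_notMem ha]

/-! ### Decomposition of an `sl₂`-module into its components. -/

section Sl2

variable {N : Submodule ℝ (Space → ℝ)}
  (hN : IsFixedModule (box I J L) (Submodule.span ℝ sl2) N)
include hN

omit hB in
theorem sl2_stable : (∀ f ∈ N, act (box I J L) (cx • vq, 0) f ∈ N) ∧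
    (∀ f ∈ N, act (box I J L) (cx • vp - cy • vq, 0) f ∈ N) ∧
    (∀ f ∈ N, act (box I J L) (cy • vp, 0) f ∈ N) := by
  refine ⟨hN.stable _ (Submodule.subset_span ?_), hN.stable _ (Submodule.subset_span ?_),
    hN.stable _ (Submodule.subset_span ?_)⟩ <;> simp [sl2]

/-- `x q` and `y p` are nilpotent on a finite-dimensional module. -/
theorem exists_der_pow_eq_zero : ∃ k : ℕ, ∀ f : smoothFun (box I J L), (f : Space → ℝ) ∈ N →
    (der hB.isOpen (1, 0, 0) ^ k) f = 0 ∧ (der hB.isOpen (0, 1, 0) ^ k) f = 0 := by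
  set Dx := der hB.isOpen (1, 0, 0) with hDxdef
  set Dy := der hB.isOpen (0, 1, 0) with hDydef
  set X := mulBy (U := box I J L) contDiff_cx.contDiffOn with hXdef
  set Y := mulBy (U := box I J L) contDiff_cy.contDiffOn with hYdef
  have hDX : ∀ v, Dx (X v) = X (Dx v) + v := weyl_apply (by
    simpa using der_mul_mulBy hB.isOpen (1, 0, 0) contDiff_cx.contDiffOn _
      fun a _ => hasFDerivAt_cx a)
  have hDY : ∀ v, Dy (Y v) = Y (Dy v) + v := weyl_apply (by
    simpa using der_mul_mulBy hB.isOpen (0, 1, 0) contDiff_cy.contDiffOn _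
      fun a _ => hasFDerivAt_cy a)
  have hDxY : Commute Dx Y := sub_eq_zero.1 (by
    simpa using der_mul_mulBy hB.isOpen (1, 0, 0) contDiff_cy.contDiffOn _
      fun a _ => hasFDerivAt_cy a)
  have hDyX : Commute Dy X := sub_eq_zero.1 (by
    simpa using der_mul_mulBy hB.isOpen (0, 1, 0) contDiff_cx.contDiffOn _
      fun a _ => hasFDerivAt_cx a)
  have hDD : Commute Dx Dy := der_comm hB.isOpen _ _
  have hXY : Commute X Y := mulBy_comm _ _
  have e1 : ∀ v, Dx (Y v) = Y (Dx v) := fun v => congrArg (fun f => f v) hDxY.eq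
  have e2 : ∀ v, Dy (X v) = X (Dy v) := fun v => congrArg (fun f => f v) hDyX.eq
  have e3 : ∀ v, Dx (Dy v) = Dy (Dx v) := fun v => congrArg (fun f => f v) hDD.eq
  have e4 : ∀ v, X (Y v) = Y (X v) := fun v => congrArg (fun f => f v) hXY.eq
  set W := N.comap (smoothFun (box I J L)).subtype with hW
  have : FiniteDimensional ℝ N := hN.finite
  have : FiniteDimensional ℝ W := Module.Finite.of_injective
    ((smoothFun (box I J L)).subtype.restrict (p := W) (q := N) fun _ h => h)
    fun a b h => Subtype.ext (Subtype.ext (congrArg (fun c : N => (c : Space → ℝ)) h))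
  obtain ⟨sE, sH, sF⟩ := sl2_stable hN
  have hE : ∀ w ∈ W, (X * Dy) w ∈ W := fun w hw => by
    rw [hW, Submodule.mem_comap, Submodule.subtype_apply, mulBy_der_eq_act]; exact sE w hw
  have hF : ∀ w ∈ W, (Y * Dx) w ∈ W := fun w hw => by
    rw [hW, Submodule.mem_comap, Submodule.subtype_apply, mulBy_der_eq_act]; exact sF w hw
  have hH : ∀ w ∈ W, (X * Dx - Y * Dy) w ∈ W := fun w hw => by
    rw [hW, Submodule.mem_comap, Submodule.subtype_apply, mulBy_der_sub_eq_act]; exact sH w hw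
  -- The weights of the root vectors `xq` and `yp` under `xp - yq` are `2` and `-2`.
  obtain ⟨k₁, h₁⟩ := nilpotent_of_commutator W (X * Dy) (X * Dx - Y * Dy) hE hH
    (c := 2) (by norm_num) (by
      intro w _
      simp only [Module.End.mul_apply, LinearMap.sub_apply, hDX, hDY, e2, e3, e4, map_add, map_sub]
      module)
  obtain ⟨k₂, h₂⟩ := nilpotent_of_commutator W (Y * Dx) (X * Dx - Y * Dy) hF hH
    (c := -2) (by norm_num) (by
      intro w _
      simp only [Module.End.mul_apply, LinearMap.sub_apply, hDX, hDY, e1, e3, e4, map_add, map_sub]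
      module)
  refine ⟨k₁ + k₂, fun f hf => ⟨?_, ?_⟩⟩
  -- Since `y` commutes with `p`, `(yp)^k = y^k p^k`, and multiplication by `y^k` is injective on
  -- smooth functions.
  · have := h₂ f hf
    rw [hDxY.symm.mul_pow, Module.End.mul_apply] at this
    rw [pow_add, Module.End.mul_apply, mulBy_pow_injective hB.isOpen _ (0, 1, 0)
      (fun a t => by simp [cy]) k₂ this, map_zero]
  · have := h₁ f hf
    rw [hDyX.symm.mul_pow, Module.End.mul_apply] at this
    rw [add_comm, pow_add, Module.End.mul_apply, mulBy_pow_injective hB.isOpen _ (1, 0, 0)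
      (fun a t => by simp [cx]) k₁ this, map_zero]

/-- A module containing `x^i y^j g` contains all `x^i' y^j' g` with `i' + j' = i + j`. -/
theorem mem_comp_of_mono_mem {i j : ℕ} {g : ℝ → ℝ} (hg : g ∈ smoothFun L)
    (h : mono (box I J L) i j g ∈ N) : g ∈ comp I J L N (i + j) := by
  obtain ⟨sE, -, sF⟩ := sl2_stable hN
  -- Repeated `xq` turns the monomial into `x^(i+j) g`, and repeated `yp` leads from there to any
  -- monomial of the same degree; all factors met on the way are nonzero.
  have h1 : ∀ j i, mono (box I J L) i j g ∈ N → mono (box I J L) (i + j) 0 g ∈ N := by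
    intro j
    induction j with
    | zero => simp
    | succ j ih =>
      intro i h
      have h2 := sE _ h
      rw [act_xq hB.isOpen hB.oL hg] at h2
      have := ih (i + 1) ((N.smul_mem_iff (by positivity)).1 h2)
      rwa [show i + (j + 1) = i + 1 + j by ring]
  have h2 : ∀ i j, mono (box I J L) (i + j) 0 g ∈ N → mono (box I J L) i j g ∈ N := by
    intro i j
    induction j generalizing i with
    | zero => simp
    | succ j ih =>
      intro h
      have h2 := sF _ (ih (i + 1) (by rwa [show i + 1 + j = i + (j + 1) by ring]))
      rw [act_yp hB.isOpen hB.oL hg] at h2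
      exact (N.smul_mem_iff (by positivity)).1 h2
  refine mem_comp.2 ⟨hg, fun i' j' hij => h2 _ _ ?_⟩
  rw [hij]
  exact h1 _ _ h

/-- A module contains, with a polynomial in `x` and `y`, all its terms. -/
theorem mono_mem_of_sum_mem (s : Finset (ℕ × ℕ)) {g : ℕ × ℕ → ℝ → ℝ}
    (hg : ∀ p ∈ s, g p ∈ smoothFun L) (h : ∑ p ∈ s, mono (box I J L) p.1 p.2 (g p) ∈ N) :
    ∀ p ∈ s, mono (box I J L) p.1 p.2 (g p) ∈ N := by
  classical
  obtain ⟨sE, sH, sF⟩ := sl2_stable hN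
  set U := box I J L with hU
  -- The eigenvalue of `T = H² - H + 4EF`, the Casimir element plus `H`: `(i-j)² - (i-j) + 4i(j+1) =
  -- (i+j)² + 3i + j`. With `d = i + j` it equals `d² + d + 2i`, `0 ≤ i ≤ d`, and these ranges are
  -- disjoint for different `d`.
  let μ : ℕ × ℕ → ℝ := fun p => (((p.1 + p.2) ^ 2 + 3 * p.1 + p.2 : ℕ) : ℝ)
  have hμ : Function.Injective μ := by
    rintro ⟨i, j⟩ ⟨i', j'⟩ hp
    replace hp : (i + j) ^ 2 + 3 * i + j = (i' + j') ^ 2 + 3 * i' + j' := Nat.cast_injective hp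
    have key : ∀ i j i' j' : ℕ, (i + j) ^ 2 + 3 * i + j = (i' + j') ^ 2 + 3 * i' + j' →
        ¬ i + j < i' + j' := by
      intro i j i' j' hp hlt
      nlinarith
    have h1 : i + j = i' + j' :=
      le_antisymm (not_lt.1 (key _ _ _ _ hp.symm)) (not_lt.1 (key _ _ _ _ hp))
    rw [h1] at hp
    ext <;> simp <;> omega
  let X := mulBy (U := U) contDiff_cx.contDiffOn
  let Y := mulBy (U := U) contDiff_cy.contDiffOn
  let Dx := der hB.isOpen (1, 0, 0)
  let Dy := der hB.isOpen (0, 1, 0)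
  let E := X * Dy
  let F := Y * Dx
  let H := X * Dx - Y * Dy
  have aE : ∀ f : smoothFun U, (E f : Space → ℝ) = act U (cx • vq, 0) f :=
    mulBy_der_eq_act hB.isOpen _ _
  have aF : ∀ f : smoothFun U, (F f : Space → ℝ) = act U (cy • vp, 0) f :=
    mulBy_der_eq_act hB.isOpen _ _
  have aH : ∀ f : smoothFun U, (H f : Space → ℝ) = act U (cx • vp - cy • vq, 0) f :=
    mulBy_der_sub_eq_act hB.isOpen _ _ _ _
  let T := H * H - H + (4 : ℝ) • (E * F)
  let W := N.comap (smoothFun U).subtype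
  have hT : ∀ w ∈ W, T w ∈ W := by
    have hE : ∀ w ∈ W, E w ∈ W := fun w hw => by
      change (E w : Space → ℝ) ∈ N
      rw [aE]; exact sE _ hw
    have hF : ∀ w ∈ W, F w ∈ W := fun w hw => by
      change (F w : Space → ℝ) ∈ N
      rw [aF]; exact sF _ hw
    have hH : ∀ w ∈ W, H w ∈ W := fun w hw => by
      change (H w : Space → ℝ) ∈ N
      rw [aH]; exact sH _ hw
    intro w hw
    exact W.add_mem (W.sub_mem (hH _ (hH _ hw)) (hH _ hw)) (W.smul_mem _ (hE _ (hF _ hw)))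
  let v : ℕ × ℕ → smoothFun U := fun p =>
    if hp : p ∈ s then ⟨mono U p.1 p.2 (g p), mono_mem_smoothFun _ _ (hg p hp)⟩ else 0
  have hv : ∀ p ∈ s, (v p : Space → ℝ) = mono U p.1 p.2 (g p) := fun p hp => by simp [v, hp]
  have hTv : ∀ p ∈ s, T (v p) = μ p • v p := by
    intro p hp
    have h1 : H (v p) = ((p.1 : ℝ) - p.2) • v p := Subtype.ext (by
      rw [aH, hv p hp, act_xp_sub_yq hB.isOpen hB.oL (hg p hp), ← hv p hp]; rfl)
    have h2 : E (F (v p)) = ((p.1 : ℝ) * (p.2 + 1)) • v p := Subtype.ext (by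
      rw [aE, aF, hv p hp, act_yp hB.isOpen hB.oL (hg p hp),
        act_smul_right hB.isOpen _ _ (mono_mem_smoothFun _ _ (hg p hp)),
        act_xq hB.isOpen hB.oL (hg p hp), smul_smul]
      change _ = _ • (v p : Space → ℝ)
      rw [hv p hp]
      rcases Nat.eq_zero_or_pos p.1 with h0 | h0
      · simp [h0]
      · rw [Nat.sub_add_cancel h0]; simp [U])
    change H (H (v p)) - H (v p) + (4 : ℝ) • E (F (v p)) = _
    rw [h2, h1, map_smul, h1, smul_smul, smul_smul, ← sub_smul, ← add_smul]
    congr 1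
    simp only [μ]
    push_cast
    ring
  have := mem_of_sum_eigenvectors_mem T W hT μ v s hTv hμ.injOn (by
    change ((∑ p ∈ s, v p : smoothFun U) : Space → ℝ) ∈ N
    rwa [AddSubmonoidClass.coe_finsetSum, Finset.sum_congr rfl hv])
  intro p hp
  have h1 : (v p : Space → ℝ) ∈ N := this p hp
  rwa [hv p hp] at h1

/-- Some `q^k` kills `N`, but it sends `y^(m+k) g` to a nonzero multiple of `y^m g`. -/
theorem comp_eq_bot_of_le : ∃ k : ℕ, ∀ l, k ≤ l → comp I J L N l = ⊥ := by
  obtain ⟨k, hk⟩ := exists_der_pow_eq_zero hB hN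
  refine ⟨k, fun l hl => (Submodule.eq_bot_iff _).2 fun g hg => ?_⟩
  obtain ⟨m, rfl⟩ := Nat.exists_eq_add_of_le' hl
  obtain ⟨hgs, hg⟩ := mem_comp.1 hg
  set Y := mulBy (U := box I J L) contDiff_cy.contDiffOn
  let e : smoothFun (box I J L) := ⟨mono (box I J L) 0 0 g, mono_mem_smoothFun 0 0 hgs⟩
  have hY : ∀ m, ((Y ^ m) e : Space → ℝ) = mono (box I J L) 0 m g := by
    intro m
    ext a
    rw [mulBy_pow_apply]
    by_cases ha : a ∈ box I J L
    · change _ * mono (box I J L) 0 0 g a = _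
      rw [mono_apply ha, mono_apply ha]; simp [cy]
    · change _ * mono (box I J L) 0 0 g a = _
      simp [mono_of_notMem ha]
  have he : der hB.isOpen (0, 1, 0) e = 0 := by
    refine Subtype.ext (smoothFun_ext (Subtype.property _) (Submodule.zero_mem _) fun a ha => ?_)
    have := congrFun (act_zeta_q hB.isOpen hB.oL hgs 0 0 1) a
    rw [act_of_mem ha] at this
    rw [der_apply _ _ _ ha]
    simpa [ofZ, vq] using this
  have h1 := weyl_pow_pow_add (D := der hB.isOpen (0, 1, 0)) (M := Y) (by
    simpa using der_mul_mulBy hB.isOpen (0, 1, 0) contDiff_cy.contDiffOn _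
      fun a _ => hasFDerivAt_cy a) he m k
  rw [(hk _ (by rw [hY]; exact hg 0 (m + k) (by simp))).2, eq_comm, smul_eq_zero] at h1
  rcases h1 with h1 | h1
  · have : (m + k).descFactorial k ≠ 0 := by
      rw [Ne, Nat.descFactorial_eq_zero_iff_lt]; omega
    exact absurd h1 (by exact_mod_cast this)
  · refine mono_injective hB hgs (i := 0) (j := m) ?_
    rw [← hY, h1]; rfl

/-- The structure of `sl₂`-modules of smooth functions. -/
theorem eq_polyModule_comp {n : ℕ} (hn : ∀ l, n < l → comp I J L N l = ⊥) :
    N = polyModule (box I J L) n (comp I J L N) := by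
  apply le_antisymm
  · intro f hf
    obtain ⟨k, hk⟩ := exists_der_pow_eq_zero hB hN
    obtain ⟨hx, hy⟩ := hk ⟨f, hN.smooth hf⟩ hf
    obtain ⟨g, hg, hfg⟩ := exists_eq_sum_mono hB k ⟨f, hN.smooth hf⟩ hx hy
    change f = _ at hfg
    have hmem := mono_mem_of_sum_mem hB hN _ (fun p _ => hg p) (hfg ▸ hf)
    rw [hfg]
    refine Submodule.sum_mem _ fun p hp => ?_
    have h1 := mem_comp_of_mono_mem hB hN (hg p) (hmem p hp)
    by_cases hpn : p.1 + p.2 ≤ n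
    · exact Submodule.subset_span ⟨p.1, p.2, hpn, g p, h1, rfl⟩
    · rw [hn _ (not_le.1 hpn), Submodule.mem_bot] at h1
      rw [h1, ← monoLin_apply, map_zero]
      exact Submodule.zero_mem _
  · rw [polyModule, Submodule.span_le]
    rintro _ ⟨i, j, -, g, hg, rfl⟩
    exact (mem_comp.1 hg).2 i j rfl

/-- The map `g ↦ x^l g` embeds the component into the finite-dimensional `N`. -/
theorem finiteFamily_comp (n : ℕ) : FiniteFamily L n (comp I J L N) := by
  refine fun l _ => ⟨fun g hg => (mem_comp.1 hg).1, ?_⟩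
  have : FiniteDimensional ℝ N := hN.finite
  refine Module.Finite.of_injective ((monoLin (box I J L) l 0).restrict (q := N)
    fun g hg => (mem_comp.1 hg).2 l 0 (by simp)) ?_
  rw [injective_iff_map_eq_zero]
  intro g hg
  exact Subtype.ext (mono_injective hB (mem_comp.1 g.2).1
    (congrArg (fun c : N => (c : Space → ℝ)) hg))

/-- The degree of a nonzero module. -/
theorem exists_top (h0 : N ≠ ⊥) : ∃ n, comp I J L N n ≠ ⊥ ∧ ∀ l, n < l → comp I J L N l = ⊥ := by
  classical
  obtain ⟨k, hk⟩ := comp_eq_bot_of_le hB hN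
  have hex : ∃ l ≤ k, comp I J L N l ≠ ⊥ := by
    by_contra! hcon
    apply h0
    rw [eq_polyModule_comp hB hN (n := k) fun l hl => hk l hl.le, polyModule, Submodule.span_eq_bot]
    rintro _ ⟨i, j, hij, g, hg, rfl⟩
    rw [hcon _ hij, Submodule.mem_bot] at hg
    change monoLin (box I J L) i j g = 0
    rw [hg, map_zero]
  obtain ⟨l, hl, hl0⟩ := hex
  refine ⟨Nat.findGreatest (fun l => comp I J L N l ≠ ⊥) k,
    Nat.findGreatest_spec (P := fun l => comp I J L N l ≠ ⊥) hl hl0, fun m hm => ?_⟩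
  by_cases hmk : m ≤ k
  · exact not_not.1 (Nat.findGreatest_is_greatest hm hmk)
  · exact hk m (by omega)

end Sl2

end Structure

/-! ### Finite-dimensional spaces of functions of `z` -/

/-- The span of the powers `z^k` with `P k`, on `L`. -/
def powSpan (L : Set ℝ) (P : ℕ → Prop) : Submodule ℝ (ℝ → ℝ) :=
  Submodule.span ℝ {g | ∃ k, P k ∧ g = L.indicator fun z => z ^ k}

theorem pow_mem_powSpan {L : Set ℝ} {P : ℕ → Prop} {k : ℕ} (hk : P k) :
    L.indicator (fun z : ℝ => z ^ k) ∈ powSpan L P := Submodule.subset_span ⟨k, hk, rfl⟩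

theorem indicator_pow_mem_smoothFun (L : Set ℝ) (k : ℕ) :
    L.indicator (fun z : ℝ => z ^ k) ∈ smoothFun L :=
  indicator_mem_smoothFun (contDiff_id.pow k).contDiffOn

theorem powSpan_le_smoothFun (L : Set ℝ) (P : ℕ → Prop) : powSpan L P ≤ smoothFun L := by
  rw [powSpan, Submodule.span_le]
  rintro _ ⟨k, -, rfl⟩
  exact indicator_pow_mem_smoothFun L k

theorem finiteDimensional_powSpan (L : Set ℝ) {P : ℕ → Prop} {b : ℕ} (hP : ∀ k, P k → k ≤ b) :
    FiniteDimensional ℝ (powSpan L P) := by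
  refine FiniteDimensional.span_of_finite ℝ (Set.Finite.subset
    ((Finset.range (b + 1)).finite_toSet.image fun k => L.indicator fun z : ℝ => z ^ k) ?_)
  rintro _ ⟨k, hk, rfl⟩
  exact ⟨k, Finset.mem_coe.2 (Finset.mem_range.2 (Nat.lt_succ_of_le (hP k hk))), rfl⟩

/-- A polynomial that agrees with `z^k` on the infinite set `L` is `z^k`, so degrees can be
compared. -/
theorem lt_of_pow_mem_powSpan {L : Set ℝ} (hL : IsOpen L) (hn : L.Nonempty) {k m : ℕ}
    (h : L.indicator (fun z : ℝ => z ^ k) ∈ powSpan L (· < m)) : k < m := by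
  let φ : Polynomial ℝ →ₗ[ℝ] (ℝ → ℝ) :=
    { toFun := fun p => L.indicator fun z => p.eval z
      map_add' := fun p q => by
        ext z; by_cases hz : z ∈ L <;> simp [hz]
      map_smul' := fun c p => by
        ext z; by_cases hz : z ∈ L <;> simp [hz] }
  have hφ : ∀ k, φ (Polynomial.X ^ k) = L.indicator fun z : ℝ => z ^ k := by
    intro k
    change L.indicator (fun z : ℝ => (Polynomial.X ^ k : Polynomial ℝ).eval z) = _
    simp
  have hle : powSpan L (· < m) ≤ (Polynomial.degreeLT ℝ m).map φ := by
    rw [powSpan, Submodule.span_le]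
    rintro _ ⟨j, hj, rfl⟩
    refine ⟨Polynomial.X ^ j, ?_, hφ j⟩
    rw [SetLike.mem_coe, Polynomial.mem_degreeLT, Polynomial.degree_X_pow]
    exact_mod_cast hj
  obtain ⟨p, hp, hpk⟩ := hle h
  have hinf : L.Infinite := by
    obtain ⟨z, hz⟩ := hn
    exact infinite_of_mem_nhds z (hL.mem_nhds hz)
  have : p = Polynomial.X ^ k := by
    refine Polynomial.eq_of_infinite_eval_eq _ _ (hinf.mono fun z hz => ?_)
    have := congrFun (hpk.trans (hφ k).symm) z
    change L.indicator (fun z : ℝ => p.eval z) z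
      = L.indicator (fun z : ℝ => (Polynomial.X ^ k : Polynomial ℝ).eval z) z at this
    rwa [Set.indicator_of_mem hz, Set.indicator_of_mem hz] at this
  rw [this, SetLike.mem_coe, Polynomial.mem_degreeLT, Polynomial.degree_X_pow] at hp
  exact_mod_cast hp

theorem dz_pow {L : Set ℝ} (hL : IsOpen L) (k : ℕ) : dz L (L.indicator fun z : ℝ => z ^ k)
    = (k : ℝ) • L.indicator fun z : ℝ => z ^ (k - 1) := by
  ext z
  by_cases hz : z ∈ L
  · have h1 : (L.indicator fun z : ℝ => z ^ k) =ᶠ[nhds z] fun z => z ^ k := by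
      filter_upwards [hL.mem_nhds hz] with b hb using Set.indicator_of_mem hb _
    rw [dz, Set.indicator_of_mem hz, h1.deriv_eq]
    simp [hz]
  · simp [dz, hz]

theorem pow_mul_indicator_pow (L : Set ℝ) (e k : ℕ) :
    (fun z : ℝ => z ^ e) * (L.indicator fun z : ℝ => z ^ k)
      = L.indicator fun z : ℝ => z ^ (e + k) := by
  ext z
  by_cases hz : z ∈ L <;> simp [hz, pow_add]

/-- Finite-dimensional spaces of functions stable under `d/dz` and `z d/dz`. -/
theorem exists_eq_powSpan {L : Set ℝ} (hL : IsOpen L) (hc : L.OrdConnected)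
    {G : Submodule ℝ (ℝ → ℝ)} (hG : G ≤ smoothFun L) [FiniteDimensional ℝ G]
    (h1 : ∀ g ∈ G, dz L g ∈ G) (h2 : ∀ g ∈ G, id * dz L g ∈ G) :
    ∃ m, G = powSpan L (· < m) := by
  set D := der hL 1
  have hid : ContDiffOn ℝ ∞ (id : ℝ → ℝ) L := contDiff_id.contDiffOn
  set M := mulBy hid
  have hDM : D * M - M * D = 1 := by
    simpa using der_mul_mulBy hL 1 hid _ fun a _ => hasFDerivAt_id a
  set W := G.comap (smoothFun L).subtype with hW
  have hDc : ∀ g, (D g : ℝ → ℝ) = dz L g := der_one_eq_dz hL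
  have hMc : ∀ g : smoothFun L, (M g : ℝ → ℝ) = id * (g : ℝ → ℝ) := fun _ => rfl
  have hWD : ∀ w ∈ W, D w ∈ W := fun w hw => by
    rw [hW, Submodule.mem_comap, Submodule.subtype_apply, hDc]; exact h1 w hw
  have hWM : ∀ w ∈ W, (M * D) w ∈ W := fun w hw => by
    rw [hW, Submodule.mem_comap, Submodule.subtype_apply, Module.End.mul_apply, hMc, hDc]
    exact h2 w hw
  have : FiniteDimensional ℝ W := Module.Finite.of_injective
    ((smoothFun L).subtype.restrict (p := W) (q := G) fun _ h => h)
    fun a b h => Subtype.ext (Subtype.ext (congrArg (fun c : G => (c : ℝ → ℝ)) h))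
  -- From `[zD, D] = -D` the derivative is nilpotent, so `jordan_string` applies to the string `1,
  -- z, z², …`.
  obtain ⟨k, hk⟩ := nilpotent_of_commutator W D (M * D) hWD hWM (c := -1) (by norm_num) (by
    intro w _
    rw [Module.End.mul_apply, Module.End.mul_apply, weyl_apply hDM]
    module)
  let e : smoothFun L := ⟨_, indicator_pow_mem_smoothFun L 0⟩
  have he : ∀ j, ((M ^ j) e : ℝ → ℝ) = L.indicator fun z => z ^ j := by
    intro j
    ext z
    rw [mulBy_pow_apply]
    by_cases hz : z ∈ L <;> simp [e, hz]
  have hker : ∀ v, D v = 0 → ∃ c : ℝ, v = c • e := by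
    intro v hv
    rcases L.eq_empty_or_nonempty with rfl | ⟨z₀, hz₀⟩
    · exact ⟨0, Subtype.ext (smoothFun_ext v.2 (Subtype.property _) (by simp))⟩
    · refine ⟨(v : ℝ → ℝ) z₀, Subtype.ext (smoothFun_ext v.2 (Subtype.property _) fun z hz => ?_)⟩
      have := hL.is_const_of_deriv_eq_zero hc.isPreconnected
        (fun a ha => (differentiableAt_of_mem_smoothFun hL v.2 ha).differentiableWithinAt)
        (fun a ha => by
          have h0 := hDc v
          rw [hv] at h0
          have := congrFun h0 a
          rw [dz, Set.indicator_of_mem ha] at this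
          simpa using this.symm) hz hz₀
      simp [e, hz, this]
  have heD : D e = 0 := by
    refine Subtype.ext (smoothFun_ext (Subtype.property _) (Submodule.zero_mem _) fun a ha => ?_)
    have h3 : (e : ℝ → ℝ) =ᶠ[nhds a] fun _ => 1 := by
      filter_upwards [hL.mem_nhds ha] with b hb
      simp [e, hb]
    rw [der_apply _ _ _ ha, h3.fderiv_eq]
    simp
  obtain ⟨m, hm⟩ := jordan_string hDM heD hker W hWD k hk
  refine ⟨m, ?_⟩
  have hGW : G = W.map (smoothFun L).subtype := by
    rw [hW, Submodule.map_comap_subtype, inf_eq_right.2 hG]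
  rw [hGW, hm, Submodule.map_span]
  congr 1
  ext g
  constructor
  · rintro ⟨_, ⟨j, hj, rfl⟩, rfl⟩
    exact ⟨j, hj, he j⟩
  · rintro ⟨j, hj, rfl⟩
    exact ⟨_, ⟨j, hj, rfl⟩, he j⟩

/-! ### Complexification -/

/-- The complex functions with real and imaginary parts in a given space. -/
def complexify {X : Type*} (A : Submodule ℝ (X → ℝ)) : Submodule ℂ (X → ℂ) where
  carrier := {f | (fun a => (f a).re) ∈ A ∧ (fun a => (f a).im) ∈ A}
  add_mem' := fun hf hg => ⟨A.add_mem hf.1 hg.1, A.add_mem hf.2 hg.2⟩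
  zero_mem' := ⟨A.zero_mem, A.zero_mem⟩
  smul_mem' := by
    intro c f hf
    constructor
    · convert A.sub_mem (A.smul_mem c.re hf.1) (A.smul_mem c.im hf.2) using 1
      ext a; simp
    · convert A.add_mem (A.smul_mem c.re hf.2) (A.smul_mem c.im hf.1) using 1
      ext a; simp

theorem mem_complexify {X : Type*} {A : Submodule ℝ (X → ℝ)} {f : X → ℂ} :
    f ∈ complexify A ↔ (fun a => (f a).re) ∈ A ∧ (fun a => (f a).im) ∈ A := Iff.rfl

theorem ofReal_mem_complexify {X : Type*} {A : Submodule ℝ (X → ℝ)} {f : X → ℝ} (hf : f ∈ A) :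
    (fun a => (f a : ℂ)) ∈ complexify A :=
  mem_complexify.2 ⟨by simpa using hf, by simp only [Complex.ofReal_im]; exact A.zero_mem⟩

theorem finiteDimensional_complexify {X : Type*} (A : Submodule ℝ (X → ℝ))
    [FiniteDimensional ℝ A] : FiniteDimensional ℂ (complexify A) := by
  let φ : complexify A →ₗ[ℝ] A × A :=
    { toFun := fun f => (⟨_, f.2.1⟩, ⟨_, f.2.2⟩)
      map_add' := fun f g => by ext <;> simp
      map_smul' := fun c f => by ext <;> simp }
  have : Module.Finite ℝ (complexify A) := Module.Finite.of_injective φ (by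
    intro f g h
    ext a
    have h1 := congrArg (fun p : A × A => (p.1 : X → ℝ) a) h
    have h2 := congrArg (fun p : A × A => (p.2 : X → ℝ) a) h
    exact Complex.ext h1 h2)
  exact Module.Finite.of_restrictScalars_finite ℝ ℂ _

/-! ### Exponential spaces of functions of `z`. -/

section Exp

variable {L : Set ℝ}

theorem hasDerivAt_of_mem_smoothFun (hL : IsOpen L) {g : ℝ → ℝ} (hg : g ∈ smoothFun L) {z : ℝ}
    (hz : z ∈ L) : HasDerivAt g (dz L g z) z := by
  rw [dz, Set.indicator_of_mem hz]
  exact (differentiableAt_of_mem_smoothFun hL hg hz).hasDerivAt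

theorem hasDerivAt_of_mem_complexify (hL : IsOpen L) {f : ℝ → ℂ}
    (hf : f ∈ complexify (smoothFun L)) {z : ℝ} (hz : z ∈ L) :
    HasDerivAt f (L.indicator (deriv f) z) z := by
  have h1 := (hasDerivAt_of_mem_smoothFun hL hf.1 hz).ofReal_comp
  have h2 := (hasDerivAt_of_mem_smoothFun hL hf.2 hz).ofReal_comp
  have h3 := h1.add (h2.mul_const Complex.I)
  have h4 : (fun z => ((f z).re : ℂ)) + (fun z => ((f z).im : ℂ) * Complex.I) = f := by
    ext z; simp
  rw [h4] at h3
  rw [Set.indicator_of_mem hz]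
  exact h3.differentiableAt.hasDerivAt

theorem dz_re (hL : IsOpen L) {f : ℝ → ℂ} (hf : f ∈ complexify (smoothFun L)) :
    dz L (fun z => (f z).re) = fun z => (L.indicator (deriv f) z).re := by
  ext z
  by_cases hz : z ∈ L
  · have h1 := Complex.reCLM.hasFDerivAt.comp_hasDerivAt z (hasDerivAt_of_mem_complexify hL hf hz)
    exact (hasDerivAt_of_mem_smoothFun hL hf.1 hz).unique h1
  · simp [dz, hz]

theorem dz_im (hL : IsOpen L) {f : ℝ → ℂ} (hf : f ∈ complexify (smoothFun L)) :
    dz L (fun z => (f z).im) = fun z => (L.indicator (deriv f) z).im := by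
  ext z
  by_cases hz : z ∈ L
  · have h1 := Complex.imCLM.hasFDerivAt.comp_hasDerivAt z (hasDerivAt_of_mem_complexify hL hf hz)
    exact (hasDerivAt_of_mem_smoothFun hL hf.2 hz).unique h1
  · simp [dz, hz]

theorem deriv_mem_complexify (hL : IsOpen L) {G : Submodule ℝ (ℝ → ℝ)} (hG : G ≤ smoothFun L)
    (h : ∀ g ∈ G, dz L g ∈ G) {f : ℝ → ℂ} (hf : f ∈ complexify G) :
    L.indicator (deriv f) ∈ complexify G := by
  have hf' : f ∈ complexify (smoothFun L) := ⟨hG hf.1, hG hf.2⟩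
  refine mem_complexify.2 ⟨?_, ?_⟩
  · rw [← dz_re hL hf']; exact h _ hf.1
  · rw [← dz_im hL hf']; exact h _ hf.2

theorem zero_of_mem_complexify {f : ℝ → ℂ} (hf : f ∈ complexify (smoothFun L)) {z : ℝ}
    (hz : z ∉ L) : f z = 0 := Complex.ext (hf.1.2 z hz) (hf.2.2 z hz)

/-- `d/dz` on complex smooth functions. -/
def derC (hL : IsOpen L) : Module.End ℂ (complexify (smoothFun L)) where
  toFun f := ⟨L.indicator (deriv f), deriv_mem_complexify hL le_rfl
    (fun _ => dz_mem_smoothFun hL) f.2⟩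
  map_add' f g := by
    ext z
    by_cases hz : z ∈ L
    · have := ((hasDerivAt_of_mem_complexify hL f.2 hz).add
        (hasDerivAt_of_mem_complexify hL g.2 hz)).deriv
      simpa [hz] using this
    · simp [hz]
  map_smul' c f := by
    ext z
    by_cases hz : z ∈ L
    · have := ((hasDerivAt_of_mem_complexify hL f.2 hz).const_smul c).deriv
      simpa [hz] using this
    · simp [hz]

theorem mul_mem_complexify {f : ℝ → ℂ} (hf : f ∈ complexify (smoothFun L)) :
    (fun z : ℝ => (z : ℂ) * f z) ∈ complexify (smoothFun L) := by
  have hid : ContDiffOn ℝ ∞ (id : ℝ → ℝ) L := contDiff_id.contDiffOn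
  refine mem_complexify.2 ⟨?_, ?_⟩
  · convert mul_mem_smoothFun hid hf.1 using 1
    ext z; simp
  · convert mul_mem_smoothFun hid hf.2 using 1
    ext z; simp

variable (L) in
/-- Multiplication by `z` on complex smooth functions. -/
def mulC : Module.End ℂ (complexify (smoothFun L)) where
  toFun f := ⟨_, mul_mem_complexify f.2⟩
  map_add' f g := by ext z; simp [mul_add]
  map_smul' c f := by ext z; simp [mul_left_comm]

theorem derC_mulC (hL : IsOpen L) : derC hL * mulC L - mulC L * derC hL = 1 := by
  ext f z
  change L.indicator (deriv fun z : ℝ => (z : ℂ) * (f : ℝ → ℂ) z) z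
    - (z : ℂ) * L.indicator (deriv f) z = (f : ℝ → ℂ) z
  by_cases hz : z ∈ L
  · have h1 : HasDerivAt (fun z : ℝ => (z : ℂ)) 1 z := by
      simpa using (hasDerivAt_id z).ofReal_comp
    have h2 := (h1.mul (hasDerivAt_of_mem_complexify hL f.2 hz)).deriv
    change deriv (fun z : ℝ => (z : ℂ) * (f : ℝ → ℂ) z) z = _ at h2
    rw [Set.indicator_of_mem hz, h2]
    ring
  · simp [hz, zero_of_mem_complexify f.2 hz]

/-- The function `z^k e^{λz}`. -/
def cexpMonomial (lam : ℂ) (k : ℕ) : ℝ → ℂ := fun z => (z : ℂ) ^ k * Complex.exp (lam * z)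

theorem contDiff_cexpMonomial (lam : ℂ) (k : ℕ) : ContDiff ℝ ∞ (cexpMonomial lam k) := by
  have : ContDiff ℝ ∞ (fun z : ℝ => (z : ℂ)) := Complex.ofRealCLM.contDiff
  exact (this.pow k).mul ((contDiff_const.mul this).cexp)

/-- For `k = 0` the truncated exponent `k - 1` does not matter, its term having the factor `k`. -/
theorem hasDerivAt_cexpMonomial (lam : ℂ) (k : ℕ) (z : ℝ) :
    HasDerivAt (cexpMonomial lam k)
      (k * cexpMonomial lam (k - 1) z + lam * cexpMonomial lam k z) z := by
  have h1 : HasDerivAt (fun z : ℝ => (z : ℂ)) 1 z := by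
    simpa using (hasDerivAt_id z).ofReal_comp
  have h2 := (h1.pow k).mul ((h1.const_mul lam).cexp)
  refine h2.congr_deriv ?_
  simp [cexpMonomial]
  ring

theorem indicator_cexpMonomial_mem {G : Submodule ℝ (ℝ → ℝ)} {lam : ℂ} {k : ℕ} :
    L.indicator (cexpMonomial lam k) ∈ complexify G ↔
      L.indicator (fun z => (cexpMonomial lam k z).re) ∈ G ∧
      L.indicator (fun z => (cexpMonomial lam k z).im) ∈ G := by
  rw [mem_complexify]
  have h1 : (fun z => (L.indicator (cexpMonomial lam k) z).re)
      = L.indicator (fun z => (cexpMonomial lam k z).re) := by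
    ext z; by_cases hz : z ∈ L <;> simp [hz]
  have h2 : (fun z => (L.indicator (cexpMonomial lam k) z).im)
      = L.indicator (fun z => (cexpMonomial lam k z).im) := by
    ext z; by_cases hz : z ∈ L <;> simp [hz]
  rw [h1, h2]

theorem indicator_cexpMonomial_mem_smooth (L : Set ℝ) (lam : ℂ) (k : ℕ) :
    L.indicator (cexpMonomial lam k) ∈ complexify (smoothFun L) :=
  indicator_cexpMonomial_mem.2
    ⟨indicator_mem_smoothFun (Complex.reCLM.contDiff.comp (contDiff_cexpMonomial lam k)).contDiffOn,
      indicator_mem_smoothFun (Complex.imCLM.contDiff.comp (contDiff_cexpMonomial lam k)).contDiffOn⟩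

theorem cexpMonomial_mem_expModule {Λ : Finset ℂ} {m : ℂ → ℕ} {lam : ℂ} (hlam : lam ∈ Λ) {k : ℕ}
    (hk : k ≤ m lam) : L.indicator (cexpMonomial lam k) ∈ complexify (expModule L Λ m) :=
  indicator_cexpMonomial_mem.2
    ⟨Submodule.subset_span ⟨_, ⟨lam, hlam, k, hk, Or.inl rfl⟩, rfl⟩,
      Submodule.subset_span ⟨_, ⟨lam, hlam, k, hk, Or.inr rfl⟩, rfl⟩⟩

/-- A space of functions contains the exponential space when its complexification contains the
complex exponential monomials. -/
theorem expModule_le {Λ : Finset ℂ} {m : ℂ → ℕ} {G : Submodule ℝ (ℝ → ℝ)}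
    (h : ∀ lam ∈ Λ, ∀ k ≤ m lam, L.indicator (cexpMonomial lam k) ∈ complexify G) :
    expModule L Λ m ≤ G := by
  rw [expModule, Submodule.span_le]
  rintro _ ⟨_, ⟨lam, hlam, k, hk, rfl | rfl⟩, rfl⟩
  · exact (indicator_cexpMonomial_mem.1 (h lam hlam k hk)).1
  · exact (indicator_cexpMonomial_mem.1 (h lam hlam k hk)).2

theorem expModule_le_smoothFun (L : Set ℝ) (Λ : Finset ℂ) (m : ℂ → ℕ) :
    expModule L Λ m ≤ smoothFun L :=
  expModule_le fun lam _ k _ => indicator_cexpMonomial_mem_smooth L lam k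

theorem finiteDimensional_expModule (L : Set ℝ) (Λ : Finset ℂ) (m : ℂ → ℕ) :
    FiniteDimensional ℝ (expModule L Λ m) := by
  refine FiniteDimensional.span_of_finite ℝ (Set.Finite.subset (s :=
    ⋃ lam ∈ Λ, ⋃ k ∈ Finset.range (m lam + 1),
      {L.indicator (fun z => (cexpMonomial lam k z).re),
        L.indicator (fun z => (cexpMonomial lam k z).im)}) ?_ ?_)
  · exact Set.Finite.biUnion Λ.finite_toSet fun lam _ =>
      Set.Finite.biUnion (Finset.finite_toSet _) fun k _ => Set.toFinite _
  · rintro _ ⟨_, ⟨lam, hlam, k, hk, rfl | rfl⟩, rfl⟩ <;>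
    · simp only [Set.mem_iUnion]
      refine ⟨lam, hlam, k, Finset.mem_range.2 (by omega), ?_⟩
      simp [cexpMonomial]

theorem dz_zero (L : Set ℝ) : dz L 0 = 0 := by
  ext z
  by_cases hz : z ∈ L <;> simp [dz, hz]

theorem dz_add (hL : IsOpen L) {f g : ℝ → ℝ} (hf : f ∈ smoothFun L) (hg : g ∈ smoothFun L) :
    dz L (f + g) = dz L f + dz L g := by
  have := der_one_eq_dz hL (⟨f, hf⟩ + ⟨g, hg⟩)
  rw [map_add, Submodule.coe_add, der_one_eq_dz, der_one_eq_dz] at this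
  exact this.symm

theorem dz_smul (hL : IsOpen L) (c : ℝ) {f : ℝ → ℝ} (hf : f ∈ smoothFun L) :
    dz L (c • f) = c • dz L f := by
  have := der_one_eq_dz hL (c • ⟨f, hf⟩)
  rw [map_smul, Submodule.coe_smul, der_one_eq_dz] at this
  exact this.symm

/-- A first-order operator in `z` maps a space of functions into another when it does so on a
spanning set. -/
theorem vert_mem_of_span (hL : IsOpen L) {S : Set (ℝ → ℝ)} {H : Submodule ℝ (ℝ → ℝ)}
    (hS : Submodule.span ℝ S ≤ smoothFun L) {A B C : ℝ → ℝ} {t : ℝ}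
    (h : ∀ g ∈ S, A * dz L g + t • (B * g) + C * g ∈ H) :
    ∀ g ∈ Submodule.span ℝ S, A * dz L g + t • (B * g) + C * g ∈ H := by
  intro g hg
  induction hg using Submodule.span_induction with
  | mem g hg => exact h g hg
  | zero => simp [dz_zero]
  | add f g hf hg ihf ihg =>
    rw [dz_add hL (hS hf) (hS hg)]
    convert H.add_mem ihf ihg using 1
    simp only [mul_add, smul_add]
    abel
  | smul c f hf ih =>
    rw [dz_smul hL c (hS hf)]
    convert H.smul_mem c ih using 1
    simp only [mul_smul_comm, smul_add, smul_comm t c]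

theorem dz_mem_of_span (hL : IsOpen L) {S : Set (ℝ → ℝ)} {H : Submodule ℝ (ℝ → ℝ)}
    (hS : Submodule.span ℝ S ≤ smoothFun L) (h : ∀ g ∈ S, dz L g ∈ H) :
    ∀ g ∈ Submodule.span ℝ S, dz L g ∈ H := by
  intro g hg
  have := vert_mem_of_span hL hS (A := 1) (B := 0) (C := 0) (t := 0) (H := H)
    (by simpa using h) g hg
  simpa using this

theorem dz_mem_expModule (hL : IsOpen L) (Λ : Finset ℂ) (m : ℂ → ℕ) :
    ∀ g ∈ expModule L Λ m, dz L g ∈ expModule L Λ m := by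
  refine dz_mem_of_span hL (expModule_le_smoothFun L Λ m) ?_
  have key : ∀ lam ∈ Λ, ∀ k ≤ m lam,
      L.indicator (deriv (L.indicator (cexpMonomial lam k))) ∈ complexify (expModule L Λ m) := by
    intro lam hlam k hk
    convert (complexify (expModule L Λ m)).add_mem
      ((complexify (expModule L Λ m)).smul_mem (k : ℂ)
        (cexpMonomial_mem_expModule (L := L) hlam (show k - 1 ≤ m lam by omega)))
      ((complexify (expModule L Λ m)).smul_mem lam (cexpMonomial_mem_expModule (L := L) hlam hk))
      using 1
    ext z
    by_cases hz : z ∈ L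
    · have h1 : L.indicator (cexpMonomial lam k) =ᶠ[nhds z] cexpMonomial lam k := by
        filter_upwards [hL.mem_nhds hz] with b hb using Set.indicator_of_mem hb _
      rw [Set.indicator_of_mem hz, h1.deriv_eq, (hasDerivAt_cexpMonomial lam k z).deriv]
      simp [hz]
    · simp [hz]
  rintro _ ⟨_, ⟨lam, hlam, k, hk, rfl | rfl⟩, rfl⟩
  · have h1 := dz_re hL (indicator_cexpMonomial_mem_smooth L lam k)
    have h2 : (fun z => (L.indicator (cexpMonomial lam k) z).re)
        = L.indicator (fun z => (cexpMonomial lam k z).re) := by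
      ext z; by_cases hz : z ∈ L <;> simp [hz]
    rw [h2] at h1
    change dz L (L.indicator fun z => (cexpMonomial lam k z).re) ∈ _
    rw [h1]
    exact (key lam hlam k hk).1
  · have h1 := dz_im hL (indicator_cexpMonomial_mem_smooth L lam k)
    have h2 : (fun z => (L.indicator (cexpMonomial lam k) z).im)
        = L.indicator (fun z => (cexpMonomial lam k z).im) := by
      ext z; by_cases hz : z ∈ L <;> simp [hz]
    rw [h2] at h1
    change dz L (L.indicator fun z => (cexpMonomial lam k z).im) ∈ _
    rw [h1]
    exact (key lam hlam k hk).2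

/-- The solutions of `f' = λ f` on an interval. -/
theorem exists_eq_smul_exp (hL : IsOpen L) (hc : L.OrdConnected) {lam : ℂ}
    {f : complexify (smoothFun L)} (hf : (derC hL - lam • 1) f = 0) :
    ∃ c : ℂ, f = c • ⟨_, indicator_cexpMonomial_mem_smooth L lam 0⟩ := by
  rcases L.eq_empty_or_nonempty with rfl | ⟨z₀, hz₀⟩
  · refine ⟨0, Subtype.ext (funext fun z => ?_)⟩
    rw [zero_of_mem_complexify f.2 (by simp)]; simp
  have hd : ∀ z ∈ L, HasDerivAt (f : ℝ → ℂ) (lam * (f : ℝ → ℂ) z) z := by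
    intro z hz
    have h1 := hasDerivAt_of_mem_complexify hL f.2 hz
    have h2 : (derC hL f : ℝ → ℂ) z = lam * (f : ℝ → ℂ) z := by
      rw [LinearMap.sub_apply, sub_eq_zero] at hf
      rw [hf]; rfl
    rwa [← h2]
  -- The integrating factor `e^{-λz}` makes the product constant on the interval.
  have hd0 : ∀ z ∈ L, HasDerivAt (fun z : ℝ => Complex.exp (-lam * z) * (f : ℝ → ℂ) z) 0 z := by
    intro z hz
    have h1 : HasDerivAt (fun z : ℝ => (z : ℂ)) 1 z := by
      simpa using (hasDerivAt_id z).ofReal_comp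
    refine ((h1.const_mul (-lam)).cexp.mul (hd z hz)).congr_deriv ?_
    ring
  refine ⟨Complex.exp (-lam * z₀) * (f : ℝ → ℂ) z₀, Subtype.ext (funext fun z => ?_)⟩
  by_cases hz : z ∈ L
  · have := hL.is_const_of_deriv_eq_zero hc.isPreconnected
      (fun a ha => (hd0 a ha).differentiableAt.differentiableWithinAt)
      (fun a ha => (hd0 a ha).deriv) hz hz₀
    simp only [Submodule.coe_smul, Pi.smul_apply, Set.indicator_of_mem hz, smul_eq_mul,
      cexpMonomial, pow_zero, one_mul]
    rw [← this, mul_right_comm, ← Complex.exp_add]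
    simp
  · rw [zero_of_mem_complexify f.2 hz]; simp [hz]

/-- Finite-dimensional spaces of functions stable under `d/dz` are exponential spaces. -/
theorem exists_eq_expModule (hL : IsOpen L) (hc : L.OrdConnected) (hn : L.Nonempty)
    {G : Submodule ℝ (ℝ → ℝ)} (hG : G ≤ smoothFun L) [FiniteDimensional ℝ G]
    (h : ∀ g ∈ G, dz L g ∈ G) : ∃ (Λ : Finset ℂ) (m : ℂ → ℕ), G = expModule L Λ m := by
  classical
  set D := derC hL
  set M := mulC L
  set W := (complexify G).comap (complexify (smoothFun L)).subtype with hW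
  have := finiteDimensional_complexify G
  have : FiniteDimensional ℂ W := Module.Finite.of_injective
    ((complexify (smoothFun L)).subtype.restrict (p := W) (q := complexify G) fun _ h => h)
    fun a b h => Subtype.ext (Subtype.ext (congrArg (fun c : complexify G => (c : ℝ → ℂ)) h))
  have hWD : ∀ w ∈ W, D w ∈ W := fun w hw => deriv_mem_complexify hL hG h hw
  obtain ⟨ge, k, hsup, hgefin, hge⟩ := exists_generalized_eigenspaces D W hWD
  let e : ℂ → complexify (smoothFun L) := fun lam =>
    ⟨_, indicator_cexpMonomial_mem_smooth L lam 0⟩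
  have hMe : ∀ lam j, ((M ^ j) (e lam) : ℝ → ℂ) = L.indicator (cexpMonomial lam j) := by
    intro lam j
    induction j with
    | zero => rfl
    | succ j ih =>
      rw [pow_succ', Module.End.mul_apply]
      ext z
      change (z : ℂ) * ((M ^ j) (e lam) : ℝ → ℂ) z = _
      rw [ih]
      by_cases hz : z ∈ L
      · simp [hz, cexpMonomial]; ring
      · simp [hz]
  have hstring : ∀ lam : ℂ, ∃ m : ℕ, ge lam = Submodule.span ℂ {v | ∃ j < m, v = (M ^ j) (e lam)} := by
    intro lam
    refine jordan_string (D := D - lam • 1) (M := M) ?_ (e := e lam) ?_ ?_ _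
      (fun w hw => (hge lam w hw).1) k (fun w hw => (hge lam w hw).2)
    -- Subtracting a scalar from `D` leaves its commutator with `M` unchanged, so each generalized
    -- eigenspace is a string `z^j e^{λz}`.
    · refine Eq.trans ?_ (derC_mulC hL)
      refine LinearMap.ext fun v => ?_
      simp only [Module.End.mul_apply, LinearMap.sub_apply, LinearMap.smul_apply,
        Module.End.one_apply, map_sub, map_smul]
      abel
    · refine Subtype.ext (funext fun z => ?_)
      change L.indicator (deriv (L.indicator (cexpMonomial lam 0))) z
        - lam * L.indicator (cexpMonomial lam 0) z = 0
      by_cases hz : z ∈ L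
      · have h1 : L.indicator (cexpMonomial lam 0) =ᶠ[nhds z] cexpMonomial lam 0 := by
          filter_upwards [hL.mem_nhds hz] with b hb using Set.indicator_of_mem hb _
        rw [Set.indicator_of_mem hz, h1.deriv_eq, (hasDerivAt_cexpMonomial lam 0 z).deriv]
        simp [hz]
      · simp [hz]
    · exact fun v hv => exists_eq_smul_exp hL hc hv
  choose m hm using hstring
  have hfin : {lam | m lam ≠ 0}.Finite := by
    refine hgefin.subset fun lam hlam h2 => ?_
    have h1 : (M ^ 0) (e lam) ∈ ge lam := by
      rw [hm]; exact Submodule.subset_span ⟨0, Nat.pos_of_ne_zero hlam, rfl⟩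
    rw [h2, Submodule.mem_bot] at h1
    obtain ⟨z, hz⟩ := hn
    have h3 := congrArg (fun f : complexify (smoothFun L) => (f : ℝ → ℂ) z) h1
    simp [e, hz, cexpMonomial] at h3
  -- Here `m lam` is the length of the string, so its largest exponent is `m lam - 1`; empty strings
  -- are left out of the finite set.
  refine ⟨hfin.toFinset, fun lam => m lam - 1, le_antisymm ?_ (expModule_le ?_)⟩
  · intro g hg
    have h1 : W ≤ (complexify (expModule L hfin.toFinset fun lam => m lam - 1)).comap
        (complexify (smoothFun L)).subtype := by
      rw [← hsup]
      refine iSup_le fun lam => ?_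
      rw [hm, Submodule.span_le]
      rintro _ ⟨j, hj, rfl⟩
      rw [SetLike.mem_coe, Submodule.mem_comap, Submodule.subtype_apply, hMe]
      refine cexpMonomial_mem_expModule ?_ (by omega)
      rw [Set.Finite.mem_toFinset, Set.mem_ofPred_eq]
      omega
    have h2 : (⟨_, ofReal_mem_complexify (hG hg)⟩ : complexify (smoothFun L)) ∈ W :=
      ofReal_mem_complexify hg
    simpa using (h1 h2).1
  · intro lam hlam k hk
    rw [Set.Finite.mem_toFinset, Set.mem_ofPred_eq] at hlam
    rw [← hMe]
    have h1 : ge lam ≤ W := (le_iSup ge lam).trans_eq hsup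
    exact h1 (by rw [hm]; exact Submodule.subset_span ⟨k, by omega, rfl⟩)

end Exp

/-! ### Normal forms of the generators -/

/-- The operator `A(z) r + B(z) (xp + yq) + C(z)`. -/
def vert (A B C : ℝ → ℝ) : DiffOp := (ofZ A • vr + ofZ B • euler, ofZ C)

/-- The operator `x (xp + yq) + C(z) x`. -/
def raiseX (C : ℝ → ℝ) : DiffOp := (cx ^ 2 • vp + (cx * cy) • vq, cx * ofZ C)

/-- The operator `y (xp + yq) + C(z) y`. -/
def raiseY (C : ℝ → ℝ) : DiffOp := ((cx * cy) • vp + cy ^ 2 • vq, cy * ofZ C)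

theorem vr_eq_vert : ((vr, 0) : DiffOp) = vert 1 0 0 := by
  ext a <;> simp [vert, ofZ]

theorem euler_eq_vert (C : ℝ → ℝ) : ((euler, ofZ C) : DiffOp) = vert 0 1 C := by
  ext a <;> simp [vert, ofZ]

theorem euler_zero_eq_vert : ((euler, 0) : DiffOp) = vert 0 1 0 := by
  ext a <;> simp [vert, ofZ]

theorem euler_smul_cz_eq_vert (c : ℝ) : ((euler, c • cz) : DiffOp) = vert 0 1 (c • id) := by
  ext a <;> simp [vert, ofZ, cz]

theorem cz_vr_add_eq_vert (b : ℝ) :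
    ((cz • vr + b • euler, 0) : DiffOp) = vert id (fun _ => b) 0 := by
  ext a <;> simp [vert, ofZ, cz]

theorem cz_sq_vr_add_eq_vert (b c : ℝ) :
    ((cz ^ 2 • vr + b • cz • euler, c • cz) : DiffOp) = vert (id ^ 2) (b • id) (c • id) := by
  ext a <;> simp [vert, ofZ, cz, mul_assoc]

theorem vp_eq : ((vp, 0) : DiffOp) = (ofZ 1 • vp, 0) := by
  ext a <;> simp [ofZ]

theorem vq_eq : ((vq, 0) : DiffOp) = (ofZ 1 • vq, 0) := by
  ext a <;> simp [ofZ]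

theorem raiseX_const (c : ℝ) :
    ((cx ^ 2 • vp + (cx * cy) • vq, c • cx) : DiffOp) = raiseX fun _ => c := by
  ext a <;> simp [raiseX, ofZ, mul_comm]

theorem raiseY_const (c : ℝ) :
    (((cx * cy) • vp + cy ^ 2 • vq, c • cy) : DiffOp) = raiseY fun _ => c := by
  ext a <;> simp [raiseY, ofZ, mul_comm]

theorem raiseX_three (K : ℝ → ℝ) :
    ((cx ^ 2 • vp + (cx * cy) • vq, 3 • (cx * ofZ K)) : DiffOp) = raiseX fun z => 3 * K z := by
  ext a <;> simp [raiseX, ofZ]; ring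

theorem raiseY_three (K : ℝ → ℝ) :
    (((cx * cy) • vp + cy ^ 2 • vq, 3 • (cy * ofZ K)) : DiffOp) = raiseY fun z => 3 * K z := by
  ext a <;> simp [raiseY, ofZ]; ring

/-! ### Polynomial modules -/

theorem polyModule_congr {U : Set Space} {n : ℕ} {G G' : ℕ → Submodule ℝ (ℝ → ℝ)}
    (h : ∀ l ≤ n, G l = G' l) : polyModule U n G = polyModule U n G' := by
  unfold polyModule
  congr 1
  ext f
  constructor
  · rintro ⟨i, j, hij, g, hg, rfl⟩
    exact ⟨i, j, hij, g, h _ hij ▸ hg, rfl⟩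
  · rintro ⟨i, j, hij, g, hg, rfl⟩
    exact ⟨i, j, hij, g, (h _ hij).symm ▸ hg, rfl⟩

theorem mono_mem_polyModule {U : Set Space} {n i j : ℕ} {G : ℕ → Submodule ℝ (ℝ → ℝ)}
    (hij : i + j ≤ n) {g : ℝ → ℝ} (hg : g ∈ G (i + j)) : mono U i j g ∈ polyModule U n G :=
  Submodule.subset_span ⟨i, j, hij, g, hg, rfl⟩

/-- Writes the module as a finite supremum of images of the `G^{(l)}`, from which finite dimension
is inherited. -/
theorem polyModule_eq_iSup (U : Set Space) (n : ℕ) (G : ℕ → Submodule ℝ (ℝ → ℝ)) :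
    polyModule U n G = ⨆ p : (Finset.range (n + 1) ×ˢ Finset.range (n + 1)).filter
      (fun p : ℕ × ℕ => p.1 + p.2 ≤ n), (G (p.1.1 + p.1.2)).map (monoLin U p.1.1 p.1.2) := by
  apply le_antisymm
  · rw [polyModule, Submodule.span_le]
    rintro _ ⟨i, j, hij, g, hg, rfl⟩
    refine Submodule.mem_iSup_of_mem ⟨(i, j), ?_⟩ ⟨g, hg, rfl⟩
    simp only [Finset.mem_filter, Finset.mem_product, Finset.mem_range]
    omega
  · refine iSup_le fun p => ?_
    rintro _ ⟨g, hg, rfl⟩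
    exact mono_mem_polyModule (Finset.mem_filter.1 p.2).2 hg

theorem finiteDimensional_polyModule {L : Set ℝ} (U : Set Space) {n : ℕ}
    {G : ℕ → Submodule ℝ (ℝ → ℝ)} (hG : FiniteFamily L n G) :
    FiniteDimensional ℝ (polyModule U n G) := by
  rw [polyModule_eq_iSup]
  have (p : (Finset.range (n + 1) ×ˢ Finset.range (n + 1)).filter
      (fun p : ℕ × ℕ => p.1 + p.2 ≤ n)) :
      FiniteDimensional ℝ ((G (p.1.1 + p.1.2)).map (monoLin U p.1.1 p.1.2)) := by
    have := (hG _ (Finset.mem_filter.1 p.2).2).2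
    infer_instance
  exact Submodule.finiteDimensional_iSup _

section Modules

variable {I J L : Set ℝ}

theorem polyModule_le_smoothFun {n : ℕ} {G : ℕ → Submodule ℝ (ℝ → ℝ)}
    (hG : FiniteFamily L n G) : polyModule (box I J L) n G ≤ smoothFun (box I J L) := by
  rw [polyModule, Submodule.span_le]
  rintro _ ⟨i, j, hij, g, hg, rfl⟩
  exact mono_mem_smoothFun i j ((hG _ hij).1 hg)

/-- The operator `T` maps the generators `x^i y^j g(z)` of `polyModule` into `polyModule`. -/
def Preserves (I J L : Set ℝ) (n : ℕ) (G : ℕ → Submodule ℝ (ℝ → ℝ)) (T : DiffOp) : Prop :=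
  ∀ i j, i + j ≤ n → ∀ g ∈ G (i + j),
    act (box I J L) T (mono (box I J L) i j g) ∈ polyModule (box I J L) n G

variable (hB : IsOpenBox I J L)
include hB

theorem isFixedModule_polyModule {𝒯 : Set DiffOp} {n : ℕ} {G : ℕ → Submodule ℝ (ℝ → ℝ)}
    (hG : FiniteFamily L n G) (h : ∀ T ∈ 𝒯, Preserves I J L n G T) :
    IsFixedModule (box I J L) (Submodule.span ℝ 𝒯) (polyModule (box I J L) n G) where
  smooth := polyModule_le_smoothFun hG
  finite := finiteDimensional_polyModule _ hG
  stable := by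
    refine act_mem_of_generators hB.isOpen ?_ ?_
    · rintro _ ⟨i, j, hij, g, hg, rfl⟩
      exact mono_mem_smoothFun i j ((hG _ hij).1 hg)
    · rintro T hT _ ⟨i, j, hij, g, hg, rfl⟩
      exact h T hT i j hij g hg

/-! ### Conditions under which a generator preserves a polynomial module. -/

section Preserves

variable {n : ℕ} {G : ℕ → Submodule ℝ (ℝ → ℝ)} (hG : FiniteFamily L n G)
include hG

theorem preserves_xq : Preserves I J L n G (cx • vq, 0) := by
  intro i j hij g hg
  rw [act_xq hB.isOpen hB.oL ((hG _ hij).1 hg)]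
  rcases j with _ | j
  · simp
  · exact Submodule.smul_mem _ _ (mono_mem_polyModule (by omega)
      (by rwa [show i + 1 + (j + 1 - 1) = i + (j + 1) by omega]))

theorem preserves_yp : Preserves I J L n G (cy • vp, 0) := by
  intro i j hij g hg
  rw [act_yp hB.isOpen hB.oL ((hG _ hij).1 hg)]
  rcases i with _ | i
  · simp
  · exact Submodule.smul_mem _ _ (mono_mem_polyModule (by omega)
      (by rwa [show i + 1 - 1 + (j + 1) = i + 1 + j by omega]))

theorem preserves_sl2 : ∀ T ∈ sl2, Preserves I J L n G T := by
  rintro T (rfl | rfl | rfl)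
  · exact preserves_xq hB hG
  · intro i j hij g hg
    rw [act_xp_sub_yq hB.isOpen hB.oL ((hG _ hij).1 hg)]
    exact Submodule.smul_mem _ _ (mono_mem_polyModule hij hg)
  · exact preserves_yp hB hG

theorem preserves_xp_add {C : ℝ → ℝ} (h : ∀ l ≤ n, ∀ g ∈ G l, C * g ∈ G l) :
    Preserves I J L n G (cx • vp, ofZ C) := by
  intro i j hij g hg
  rw [act_xp_add hB.isOpen hB.oL ((hG _ hij).1 hg)]
  exact mono_mem_polyModule hij ((G _).add_mem ((G _).smul_mem _ hg) (h _ hij g hg))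

theorem preserves_yq_add {C : ℝ → ℝ} (h : ∀ l ≤ n, ∀ g ∈ G l, C * g ∈ G l) :
    Preserves I J L n G (cy • vq, ofZ C) := by
  intro i j hij g hg
  rw [act_yq_add hB.isOpen hB.oL ((hG _ hij).1 hg)]
  exact mono_mem_polyModule hij ((G _).add_mem ((G _).smul_mem _ hg) (h _ hij g hg))

theorem preserves_zeta_p {ζ : ℝ → ℝ} (h : ∀ l < n, ∀ g ∈ G (l + 1), ζ * g ∈ G l) :
    Preserves I J L n G (ofZ ζ • vp, 0) := by
  intro i j hij g hg
  rw [act_zeta_p hB.isOpen hB.oL ((hG _ hij).1 hg)]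
  rcases i with _ | i
  · simp
  · refine Submodule.smul_mem _ _ (mono_mem_polyModule (by omega) (h _ (by omega) g ?_))
    rwa [show i + 1 - 1 + j + 1 = i + 1 + j by omega]

theorem preserves_zeta_q {ζ : ℝ → ℝ} (h : ∀ l < n, ∀ g ∈ G (l + 1), ζ * g ∈ G l) :
    Preserves I J L n G (ofZ ζ • vq, 0) := by
  intro i j hij g hg
  rw [act_zeta_q hB.isOpen hB.oL ((hG _ hij).1 hg)]
  rcases j with _ | j
  · simp
  · refine Submodule.smul_mem _ _ (mono_mem_polyModule (by omega) (h _ (by omega) g ?_))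
    rwa [show i + (j + 1 - 1) + 1 = i + (j + 1) by omega]

theorem preserves_translations {S : Set (ℝ → ℝ)} (h : Lowers S n G) :
    ∀ T ∈ translations S, Preserves I J L n G T := by
  rintro T ⟨ζ, hζ, rfl | rfl⟩
  · exact preserves_zeta_p hB hG (h ζ hζ)
  · exact preserves_zeta_q hB hG (h ζ hζ)

theorem preserves_vert {A B C : ℝ → ℝ}
    (h : ∀ l ≤ n, ∀ g ∈ G l, A * dz L g + (l : ℝ) • (B * g) + C * g ∈ G l) :
    Preserves I J L n G (vert A B C) := by
  intro i j hij g hg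
  rw [vert, act_vertical hB.isOpen hB.oL ((hG _ hij).1 hg)]
  exact mono_mem_polyModule hij (h _ hij g hg)

omit hB in
theorem preserves_one : Preserves I J L n G one := by
  intro i j hij g hg
  rw [act_one (mono_mem_smoothFun i j ((hG _ hij).1 hg))]
  exact mono_mem_polyModule hij hg

theorem preserves_vr (h : ∀ l ≤ n, ∀ g ∈ G l, dz L g ∈ G l) : Preserves I J L n G (vr, 0) := by
  rw [vr_eq_vert]
  exact preserves_vert hB hG fun l hl g hg => by simpa using h l hl g hg

/-- In degree `l` these operators multiply by `l - n`; the factor vanishes at `l = n`, so nothing of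
degree `n + 1` is produced. -/
theorem preserves_raise {C : ℝ → ℝ} (hC : ∀ z ∈ L, C z = -(n : ℝ))
    (h : ∀ l < n, G l ≤ G (l + 1)) :
    Preserves I J L n G (raiseX C) ∧ Preserves I J L n G (raiseY C) := by
  have key : ∀ l ≤ n, ∀ g ∈ G l, (l : ℝ) • g + C * g = ((l : ℝ) - n) • g := by
    intro l hl g hg
    ext z
    by_cases hz : z ∈ L
    · simp [hC z hz]; ring
    · simp [((hG l hl).1 hg).2 z hz]
  constructor <;> intro i j hij g hg
  · rw [raiseX, act_raise_x hB.isOpen hB.oL ((hG _ hij).1 hg), key _ hij g hg,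
      ← monoLin_apply, map_smul]
    rcases hij.eq_or_lt with rfl | hlt
    · simp
    · refine Submodule.smul_mem _ _ (mono_mem_polyModule (by omega) ?_)
      rw [show i + 1 + j = i + j + 1 by ring]
      exact h _ hlt hg
  · rw [raiseY, act_raise_y hB.isOpen hB.oL ((hG _ hij).1 hg), key _ hij g hg,
      ← monoLin_apply, map_smul]
    rcases hij.eq_or_lt with rfl | hlt
    · simp
    · exact Submodule.smul_mem _ _ (mono_mem_polyModule (by omega) (h _ hlt hg))

theorem preserves_sl3 (h : ∀ l ≤ n, G l = G 0) : ∀ T ∈ sl3 (-(n : ℝ)), Preserves I J L n G T := by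
  have h1 : ∀ l < n, ∀ g ∈ G (l + 1), (1 : ℝ → ℝ) * g ∈ G l := by
    intro l hl g hg
    rw [one_mul, h l hl.le, ← h (l + 1) hl]
    exact hg
  have h2 := preserves_raise hB hG (C := fun _ => -(n : ℝ)) (fun _ _ => rfl)
    fun l hl => ((h l hl.le).trans (h (l + 1) hl).symm).le
  have h3 : ∀ l ≤ n, ∀ g ∈ G l, (0 : ℝ → ℝ) * g ∈ G l := fun l _ g _ => by simp
  rintro T (rfl | rfl | rfl | rfl | rfl | rfl | rfl | rfl)
  · rw [vp_eq]; exact preserves_zeta_p hB hG h1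
  · rw [vq_eq]; exact preserves_zeta_q hB hG h1
  · exact preserves_xp_add hB hG h3
  · exact preserves_yq_add hB hG h3
  · exact preserves_xq hB hG
  · exact preserves_yp hB hG
  · rw [raiseX_const]; exact h2.1
  · rw [raiseY_const]; exact h2.2

end Preserves

/-! ### The components of a module -/

section Components

variable {N : Submodule ℝ (Space → ℝ)}
  (hN : IsFixedModule (box I J L) (Submodule.span ℝ sl2) N)
include hN

/-- It suffices to test the operator on `x^l g`: `mem_comp_of_mono_mem` spreads the result over all
monomials of degree `l`. -/
theorem comp_vert {A B C : ℝ → ℝ} (hA : ContDiffOn ℝ ∞ A L) (hB' : ContDiffOn ℝ ∞ B L)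
    (hC : ContDiffOn ℝ ∞ C L) (h : ∀ f ∈ N, act (box I J L) (vert A B C) f ∈ N) (l : ℕ) :
    ∀ g ∈ comp I J L N l, A * dz L g + (l : ℝ) • (B * g) + C * g ∈ comp I J L N l := by
  intro g hg
  obtain ⟨hgs, hg⟩ := mem_comp.1 hg
  have h1 := h _ (hg l 0 (by simp))
  rw [vert, act_vertical hB.isOpen hB.oL hgs, add_zero] at h1
  have hs : A * dz L g + (l : ℝ) • (B * g) + C * g ∈ smoothFun L := (smoothFun L).add_mem ((smoothFun L).add_mem
    (mul_mem_smoothFun hA (dz_mem_smoothFun hB.oL hgs))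
    ((smoothFun L).smul_mem _ (mul_mem_smoothFun hB' hgs))) (mul_mem_smoothFun hC hgs)
  have h2 := mem_comp_of_mono_mem hB hN hs h1
  rwa [add_zero] at h2

theorem comp_dz (h : ∀ f ∈ N, act (box I J L) (vr, 0) f ∈ N) (l : ℕ) :
    ∀ g ∈ comp I J L N l, dz L g ∈ comp I J L N l := by
  intro g hg
  have := comp_vert hB hN (A := 1) (B := 0) (C := 0) contDiffOn_const contDiffOn_const
    contDiffOn_const (by rwa [← vr_eq_vert]) l g hg
  simpa using this

theorem comp_lower {ζ : ℝ → ℝ} (hζ : ContDiffOn ℝ ∞ ζ L)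
    (h : ∀ f ∈ N, act (box I J L) (ofZ ζ • vp, 0) f ∈ N) (l : ℕ) :
    ∀ g ∈ comp I J L N (l + 1), ζ * g ∈ comp I J L N l := by
  intro g hg
  obtain ⟨hgs, hg⟩ := mem_comp.1 hg
  have h1 := h _ (hg (l + 1) 0 (by simp))
  rw [act_zeta_p hB.isOpen hB.oL hgs] at h1
  have h2 := mem_comp_of_mono_mem hB hN (mul_mem_smoothFun hζ hgs)
    ((N.smul_mem_iff (by positivity)).1 h1)
  rwa [add_zero, Nat.add_sub_cancel] at h2

theorem comp_raise {C : ℝ → ℝ} (hC : ContDiffOn ℝ ∞ C L)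
    (h : ∀ f ∈ N, act (box I J L) (raiseX C) f ∈ N) (l : ℕ) :
    ∀ g ∈ comp I J L N l, (l : ℝ) • g + C * g ∈ comp I J L N (l + 1) := by
  intro g hg
  obtain ⟨hgs, hg⟩ := mem_comp.1 hg
  have h1 := h _ (hg l 0 (by simp))
  rw [raiseX, act_raise_x hB.isOpen hB.oL hgs, add_zero] at h1
  have hs : (l : ℝ) • g + C * g ∈ smoothFun L :=
    (smoothFun L).add_mem ((smoothFun L).smul_mem _ hgs) (mul_mem_smoothFun hC hgs)
  have h2 := mem_comp_of_mono_mem hB hN hs h1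
  rwa [add_zero] at h2

/-- The degree of a module on which `x(xp + yq) + cx` acts. -/
theorem exists_degree (h0 : N ≠ ⊥) {c : ℝ} {C : ℝ → ℝ} (hc : ∀ z ∈ L, C z = c)
    (h : ∀ f ∈ N, act (box I J L) (raiseX C) f ∈ N) : ∃ n : ℕ, c = -(n : ℝ) := by
  obtain ⟨n, hn, hn'⟩ := exists_top hB hN h0
  obtain ⟨g, hg, hg0⟩ := Submodule.exists_mem_ne_zero_of_ne_bot hn
  -- At the top degree the raised function lies in a zero component, so the factor `n + c` is zero.
  have h1 := comp_raise hB hN (contDiffOn_const.congr hc) h n g hg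
  rw [hn' _ n.lt_succ_self, Submodule.mem_bot] at h1
  have h2 : ((n : ℝ) + c) • g = 0 := by
    rw [← h1]
    ext z
    by_cases hz : z ∈ L
    · simp [hc z hz]; ring
    · simp [(mem_comp.1 hg).1.2 z hz]
  exact ⟨n, by linarith [(smul_eq_zero.1 h2).resolve_right hg0]⟩

/-- The components of a module on which `p` and `x(xp + yq) - nx` act. -/
theorem comp_eq_of_raise {n : ℕ} {C : ℝ → ℝ} (hc : ∀ z ∈ L, C z = -(n : ℝ))
    (h : ∀ f ∈ N, act (box I J L) (raiseX C) f ∈ N)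
    (hp : ∀ f ∈ N, act (box I J L) (vp, 0) f ∈ N) :
    (∀ l, comp I J L N (l + 1) ≤ comp I J L N l) ∧
    (∀ l, n < l → comp I J L N l = ⊥) ∧ ∀ l ≤ n, comp I J L N l = comp I J L N 0 := by
  have hlow : ∀ l, comp I J L N (l + 1) ≤ comp I J L N l := by
    intro l g hg
    have := comp_lower hB hN (ζ := 1) contDiffOn_const (by rwa [← vp_eq]) l g hg
    simpa using this
  -- The factor `l - n` can be divided out except in degree `n`.
  have hup : ∀ l, l ≠ n → comp I J L N l ≤ comp I J L N (l + 1) := by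
    intro l hl g hg
    have h1 := comp_raise hB hN (contDiffOn_const.congr hc) h l g hg
    have h2 : (l : ℝ) • g + C * g = ((l : ℝ) - n) • g := by
      ext z
      by_cases hz : z ∈ L
      · simp [hc z hz]; ring
      · simp [(mem_comp.1 hg).1.2 z hz]
    rw [h2] at h1
    exact ((comp I J L N (l + 1)).smul_mem_iff
      (sub_ne_zero.2 (by exact_mod_cast hl))).1 h1
  refine ⟨hlow, ?_, ?_⟩
  · obtain ⟨k, hk⟩ := comp_eq_bot_of_le hB hN
    intro l hl
    -- Above degree `n` the components increase with the degree, yet they vanish for large degree.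
    have : ∀ m, comp I J L N l ≤ comp I J L N (l + m) := by
      intro m
      induction m with
      | zero => exact le_rfl
      | succ m ih => exact ih.trans (hup _ (by omega))
    exact le_bot_iff.1 ((this k).trans_eq (hk _ (by omega)))
  · intro l hl
    induction l with
    | zero => rfl
    | succ l ih => rw [← ih (by omega)]; exact le_antisymm (hlow l) (hup l (by omega))

/-- Transfers the multiplier from the components to all of `N`, where
`exists_polynomial_of_mul_stable` is used. -/
theorem mul_mem_of_comp {C : ℝ → ℝ} (h : ∀ l, ∀ g ∈ comp I J L N l, C * g ∈ comp I J L N l) :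
    ∀ f ∈ N, ofZ C * f ∈ N := by
  obtain ⟨k, hk⟩ := comp_eq_bot_of_le hB hN
  have hle : polyModule (box I J L) k (comp I J L N)
      ≤ (polyModule (box I J L) k (comp I J L N)).comap (LinearMap.mulLeft ℝ (ofZ C)) := by
    conv_lhs => rw [polyModule]
    rw [Submodule.span_le]
    rintro _ ⟨i, j, hij, g, hg, rfl⟩
    have h1 : ofZ C * mono (box I J L) i j g = mono (box I J L) i j (C * g) := by
      ext a
      by_cases ha : a ∈ box I J L
      · simp only [Pi.mul_apply, mono_apply ha, ofZ]; ring
      · simp [mono_of_notMem ha]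
    change ofZ C * mono (box I J L) i j g ∈ polyModule (box I J L) k (comp I J L N)
    rw [h1]
    exact mono_mem_polyModule hij (h _ g hg)
  rw [← eq_polyModule_comp hB hN fun l hl => hk l hl.le] at hle
  exact hle

/-- A multiplier preserving all components of a locally nontrivial module is constant. -/
theorem const_of_locallyNontrivial (hlN : LocallyNontrivial (box I J L) N) {C : ℝ → ℝ}
    (hC : ContDiffOn ℝ ∞ C L) (h : ∀ l, ∀ g ∈ comp I J L N l, C * g ∈ comp I J L N l) :
    ∃ κ : ℝ, ∀ z ∈ L, C z = κ := by
  have := hN.finite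
  obtain ⟨P, hP, hPf⟩ := exists_polynomial_of_mul_stable N (ofZ C) (mul_mem_of_comp hB hN h)
  -- Where `P(C(z)) ≠ 0`, an open condition, every function of `N` vanishes; local nontriviality
  -- forbids such points.
  have hroot : ∀ z ∈ L, P.eval (C z) = 0 := by
    intro z hz
    by_contra hne
    have hcont : ContinuousOn (fun a : Space => P.eval (ofZ C a)) (box I J L) :=
      P.continuous.comp_continuousOn (contDiffOn_ofZ hC).continuousOn
    have hopen := hcont.isOpen_inter_preimage hB.isOpen isOpen_compl_singleton (t := {0}ᶜ)
    obtain ⟨x, hx⟩ := hB.nI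
    obtain ⟨y, hy⟩ := hB.nJ
    obtain ⟨f, hf, a, ha, hfa⟩ := hlN _ Set.inter_subset_left hopen
      ⟨(x, y, z), ⟨hx, hy, hz⟩, hne⟩
    exact ha.2 (hPf f hf a hfa)
  have hfin : (C '' L).Finite := P.roots.toFinset.finite_toSet.subset (by
    rintro _ ⟨z, hz, rfl⟩
    simpa [hP] using hroot z hz)
  -- The image of the interval is connected and consists of finitely many roots of `P`.
  have hsub : (C '' L).Subsingleton := hfin.countable.isTotallyDisconnected _ subset_rfl
    (hB.cL.isPreconnected.image C hC.continuousOn)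
  obtain ⟨z₀, hz₀⟩ := hB.nL
  exact ⟨C z₀, fun z hz => hsub ⟨z, hz, rfl⟩ ⟨z₀, hz₀, rfl⟩⟩

end Components

/-- The components of a polynomial module. -/
theorem comp_polyModule {n : ℕ} {G : ℕ → Submodule ℝ (ℝ → ℝ)} (hG : FiniteFamily L n G) {l : ℕ}
    (hl : l ≤ n) : comp I J L (polyModule (box I J L) n G) l = G l := by
  classical
  apply le_antisymm
  · intro g hg
    obtain ⟨hgs, hg⟩ := mem_comp.1 hg
    set s := Finset.range (n + 1) ×ˢ Finset.range (n + 1) with hs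
    have hexp : ∀ f ∈ polyModule (box I J L) n G, ∃ h : ℕ × ℕ → ℝ → ℝ,
        (∀ p, h p ∈ smoothFun L) ∧ (∀ p, p.1 + p.2 ≤ n → h p ∈ G (p.1 + p.2)) ∧
        f = ∑ p ∈ s, mono (box I J L) p.1 p.2 (h p) := by
      intro f hf
      induction hf using Submodule.span_induction with
      | mem f hf =>
        obtain ⟨i, j, hij, g, hg, rfl⟩ := hf
        refine ⟨fun p => if p = (i, j) then g else 0, fun p => ?_, fun p _ => ?_, ?_⟩
        · beta_reduce
          split_ifs
          · exact (hG _ hij).1 hg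
          · exact Submodule.zero_mem _
        · beta_reduce
          split_ifs with hp
          · rw [hp]; exact hg
          · exact Submodule.zero_mem _
        · rw [Finset.sum_eq_single (i, j)]
          · simp [mono]
          · intro p _ hp
            beta_reduce
            rw [if_neg hp, ← monoLin_apply, map_zero]
          · intro hp
            exfalso; apply hp
            simp only [hs, Finset.mem_product, Finset.mem_range]
            omega
      | zero =>
        refine ⟨0, fun _ => Submodule.zero_mem _, fun _ _ => Submodule.zero_mem _, ?_⟩
        symm
        exact Finset.sum_eq_zero fun p _ => (monoLin (box I J L) p.1 p.2).map_zero
      | add f f' _ _ ih ih' =>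
        obtain ⟨h, h1, h2, rfl⟩ := ih
        obtain ⟨h', h1', h2', rfl⟩ := ih'
        refine ⟨h + h', fun p => Submodule.add_mem _ (h1 p) (h1' p),
          fun p hp => Submodule.add_mem _ (h2 p hp) (h2' p hp), ?_⟩
        rw [← Finset.sum_add_distrib]
        exact Finset.sum_congr rfl fun p _ =>
          ((monoLin (box I J L) p.1 p.2).map_add (h p) (h' p)).symm
      | smul c f _ ih =>
        obtain ⟨h, h1, h2, rfl⟩ := ih
        refine ⟨c • h, fun p => Submodule.smul_mem _ _ (h1 p),
          fun p hp => Submodule.smul_mem _ _ (h2 p hp), ?_⟩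
        rw [Finset.smul_sum]
        exact Finset.sum_congr rfl fun p _ =>
          ((monoLin (box I J L) p.1 p.2).map_smul c (h p)).symm
    obtain ⟨h, h1, h2, h3⟩ := hexp _ (hg l 0 (by simp))
    have hls : (l, 0) ∈ s := by
      simp only [hs, Finset.mem_product, Finset.mem_range]
      omega
    -- Subtracting `x^l g` from its own expansion gives a vanishing sum, whose terms must vanish one
    -- by one; so `g` is the coefficient `h (l, 0)`.
    have h4 : ∑ p ∈ s, mono (box I J L) p.1 p.2 (h p - if p = (l, 0) then g else 0) = 0 := by
      have h5 : ∀ p : ℕ × ℕ, mono (box I J L) p.1 p.2 (h p - if p = (l, 0) then g else 0)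
          = mono (box I J L) p.1 p.2 (h p)
            - if p = (l, 0) then mono (box I J L) l 0 g else 0 := by
        intro p
        rw [← monoLin_apply, map_sub, monoLin_apply]
        split_ifs with hp
        · rw [hp]; rfl
        · rw [map_zero]
      rw [Finset.sum_congr rfl fun p _ => h5 p, Finset.sum_sub_distrib, ← h3,
        Finset.sum_ite_eq' s (l, 0), if_pos hls, sub_self]
    have h6 := mono_mem_of_sum_mem hB isFixedModule_bot s (g := fun p =>
      h p - if p = (l, 0) then g else 0) (fun p _ => by
        refine Submodule.sub_mem _ (h1 p) ?_
        split_ifs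
        · exact hgs
        · exact Submodule.zero_mem _) (by rw [h4]; exact Submodule.zero_mem _) (l, 0) hls
    simp only [if_true, Submodule.mem_bot] at h6
    have h7 := mono_injective hB ((smoothFun L).sub_mem (h1 (l, 0)) hgs) h6
    rw [← sub_eq_zero.1 h7]
    exact h2 (l, 0) (by simpa using hl)
  · intro g hg
    exact mem_comp.2 ⟨(hG l hl).1 hg, fun i j hij => mono_mem_polyModule (by omega) (hij ▸ hg)⟩

end Modules

theorem IsFixedModule.stable_of_mem {U : Set Space} {𝒯 : Set DiffOp} {N : Submodule ℝ (Space → ℝ)}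
    (hN : IsFixedModule U (Submodule.span ℝ 𝒯) N) {T : DiffOp} (hT : T ∈ 𝒯) :
    ∀ f ∈ N, act U T f ∈ N := hN.stable T (Submodule.subset_span hT)

section Cases

variable {I J L : Set ℝ}

theorem lowers_comp (hB : IsOpenBox I J L) {𝒯 : Set DiffOp} {N : Submodule ℝ (Space → ℝ)}
    (hN : IsFixedModule (box I J L) (Submodule.span ℝ 𝒯) N) (hs : sl2 ⊆ 𝒯) {S : Set (ℝ → ℝ)}
    (hS : ∀ ζ ∈ S, ContDiffOn ℝ ∞ ζ L) (ht : translations S ⊆ 𝒯) (n : ℕ) :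
    Lowers S n (comp I J L N) := fun ζ hζ l _ =>
  comp_lower hB (hN.mono (Submodule.span_mono hs)) (hS ζ hζ)
    (hN.stable_of_mem (ht ⟨ζ, hζ, Or.inl rfl⟩)) l

/-! ### The algebra with coefficients `K(z)` and `3K(z)` -/

/-- The multipliers `K` cancel in `(xp + K) - (yq + K)`. -/
theorem span_sl2_le_alg1 (K : ℝ → ℝ) : Submodule.span ℝ sl2 ≤ alg1 K := by
  rw [Submodule.span_le]
  rintro T (rfl | rfl | rfl)
  · exact Submodule.subset_span (by simp)
  · have h1 : ((cx • vp, ofZ K) : DiffOp) ∈ alg1 K := Submodule.subset_span (by simp)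
    have h2 : ((cy • vq, ofZ K) : DiffOp) ∈ alg1 K := Submodule.subset_span (by simp)
    simpa using (alg1 K).sub_mem h1 h2
  · exact Submodule.subset_span (by simp)

section Alg1

variable (hB : IsOpenBox I J L) {K : ℝ → ℝ} {N : Submodule ℝ (Space → ℝ)}
include hB

omit hB in
theorem alg1_raise (hN : IsFixedModule (box I J L) (alg1 K) N) :
    ∀ f ∈ N, act (box I J L) (raiseX fun z => 3 * K z) f ∈ N := by
  rw [← raiseX_three]
  exact hN.stable_of_mem (by simp)

/-- The sum of `xp + K` and `yq + K` acts in degree `l` as `l + 2K`, so `K` preserves every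
component and is constant. The top degree then fixes the value of `3K`. -/
theorem alg1_cocycle (hK : ContDiffOn ℝ ∞ K L) (hN : IsFixedModule (box I J L) (alg1 K) N)
    (hl : LocallyNontrivial (box I J L) N) : ∃ n : ℕ, ∀ z ∈ L, 3 * K z = -(n : ℝ) := by
  have hN' := hN.mono (span_sl2_le_alg1 K)
  have hv : vert 0 1 ((2 : ℝ) • K) ∈ alg1 K := by
    have h1 : ((cx • vp, ofZ K) : DiffOp) ∈ alg1 K := Submodule.subset_span (by simp)
    have h2 : ((cy • vq, ofZ K) : DiffOp) ∈ alg1 K := Submodule.subset_span (by simp)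
    convert (alg1 K).add_mem h1 h2 using 1
    ext a <;> simp [vert, ofZ, euler]; ring
  have hKc : ∀ l, ∀ g ∈ comp I J L N l, K * g ∈ comp I J L N l := by
    intro l g hg
    have h1 := comp_vert hB hN' (A := 0) (B := 1) (C := (2 : ℝ) • K) contDiffOn_const
      contDiffOn_const (hK.const_smul (2 : ℝ)) (hN.stable _ hv) l g hg
    convert (comp I J L N l).smul_mem (2 : ℝ)⁻¹ ((comp I J L N l).sub_mem h1
      ((comp I J L N l).smul_mem (l : ℝ) hg)) using 1
    ext z
    simp
  obtain ⟨κ, hκ⟩ := const_of_locallyNontrivial hB hN' hl hK hKc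
  have h0 : N ≠ ⊥ := by
    rintro rfl
    obtain ⟨x, hx⟩ := hB.nI
    obtain ⟨y, hy⟩ := hB.nJ
    obtain ⟨z, hz⟩ := hB.nL
    obtain ⟨f, hf, a, -, ha⟩ := hl _ subset_rfl hB.isOpen ⟨(x, y, z), hx, hy, hz⟩
    rw [Submodule.mem_bot] at hf
    exact ha (by rw [hf]; rfl)
  obtain ⟨n, hn⟩ := exists_degree hB hN' h0 (C := fun z => 3 * K z) (c := 3 * κ)
    (fun z hz => by rw [hκ z hz]) (alg1_raise hN)
  exact ⟨n, fun z hz => by rw [hκ z hz, hn]⟩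

theorem alg1_comp {n : ℕ} (hK : ∀ z ∈ L, 3 * K z = -(n : ℝ))
    (hN : IsFixedModule (box I J L) (alg1 K) N) :
    (∀ l, comp I J L N (l + 1) ≤ comp I J L N l) ∧
    (∀ l, n < l → comp I J L N l = ⊥) ∧ ∀ l ≤ n, comp I J L N l = comp I J L N 0 :=
  comp_eq_of_raise hB (hN.mono (span_sl2_le_alg1 K)) hK (alg1_raise hN)
    (hN.stable_of_mem (by simp))

theorem alg1_polyModule {n : ℕ} (hK : ∀ z ∈ L, 3 * K z = -(n : ℝ))
    {G : ℕ → Submodule ℝ (ℝ → ℝ)} (hG : FiniteFamily L n G) (hG0 : ∀ l ≤ n, G l = G 0) :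
    IsFixedModule (box I J L) (alg1 K) (polyModule (box I J L) n G) := by
  have h1 : ∀ l < n, ∀ g ∈ G (l + 1), (1 : ℝ → ℝ) * g ∈ G l := by
    intro l hl g hg
    rw [one_mul, hG0 l hl.le, ← hG0 (l + 1) hl]
    exact hg
  have h2 := preserves_raise hB hG hK fun l hl => ((hG0 l hl.le).trans (hG0 (l + 1) hl).symm).le
  have h3 : ∀ l ≤ n, ∀ g ∈ G l, K * g ∈ G l := by
    intro l hl g hg
    convert (G l).smul_mem (-(n : ℝ) / 3) hg using 1
    ext z
    by_cases hz : z ∈ L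
    · simp [← hK z hz]
    · simp [((hG l hl).1 hg).2 z hz]
  refine isFixedModule_polyModule hB hG ?_
  rintro T (rfl | rfl | rfl | rfl | rfl | rfl | rfl | rfl | rfl)
  · rw [vp_eq]; exact preserves_zeta_p hB hG h1
  · rw [vq_eq]; exact preserves_zeta_q hB hG h1
  · exact preserves_xp_add hB hG h3
  · exact preserves_yq_add hB hG h3
  · exact preserves_xq hB hG
  · exact preserves_yp hB hG
  · rw [raiseX_three]; exact h2.1
  · rw [raiseY_three]; exact h2.2
  · exact preserves_one hG

theorem alg1_iff {n : ℕ} (hK : ∀ z ∈ L, 3 * K z = -(n : ℝ)) :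
    IsFixedModule (box I J L) (alg1 K) N ↔
      ∃ G : ℕ → Submodule ℝ (ℝ → ℝ), FiniteFamily L n G ∧
        (∀ l < n, G (l + 1) ≤ G l) ∧ (∀ l ≤ n, G l = G 0) ∧
        N = polyModule (box I J L) n G := by
  constructor
  · intro hN
    have hN' := hN.mono (span_sl2_le_alg1 K)
    obtain ⟨h1, h2, h3⟩ := alg1_comp hB hK hN
    exact ⟨comp I J L N, finiteFamily_comp hB hN' n, fun l _ => h1 l, h3,
      eq_polyModule_comp hB hN' h2⟩
  · rintro ⟨G, hG, -, hG0, rfl⟩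
    exact alg1_polyModule hB hK hG hG0

/-- By `comp_polyModule` the equality forced on the components is an equality of the given `G l`. -/
theorem alg1_polyModule_iff {n : ℕ} (hK : ∀ z ∈ L, 3 * K z = -(n : ℝ))
    {G : ℕ → Submodule ℝ (ℝ → ℝ)} (hG : FiniteFamily L n G) :
    IsFixedModule (box I J L) (alg1 K) (polyModule (box I J L) n G) ↔ ∀ l ≤ n, G l = G 0 := by
  refine ⟨fun hN l hl => ?_, alg1_polyModule hB hK hG⟩
  obtain ⟨-, -, h3⟩ := alg1_comp hB hK hN
  rw [← comp_polyModule hB hG hl, h3 l hl, comp_polyModule hB hG n.zero_le]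

end Alg1

/-! ### The algebras without `r` -/

theorem alg2_iff (hB : IsOpenBox I J L) {s : ℕ} {Z : Fin s → ℝ → ℝ}
    (hZ : ∀ i, ContDiffOn ℝ ∞ (Z i) L) (N : Submodule ℝ (Space → ℝ)) :
    IsFixedModule (box I J L) (alg2 Z) N ↔
      ∃ (n : ℕ) (G : ℕ → Submodule ℝ (ℝ → ℝ)), FiniteFamily L n G ∧
        Lowers (Set.range Z) n G ∧ N = polyModule (box I J L) n G := by
  constructor
  · intro hN
    have hs : sl2 ⊆ sl2 ∪ translations (Set.range Z) ∪ {one} := fun T h => Or.inl (Or.inl h)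
    have hN' := hN.mono (Submodule.span_mono hs)
    -- Any bound on the degree will do, since components may be zero; this also covers the zero
    -- module.
    obtain ⟨k, hk⟩ := comp_eq_bot_of_le hB hN'
    exact ⟨k, comp I J L N, finiteFamily_comp hB hN' k,
      lowers_comp hB hN hs (Set.forall_mem_range.2 hZ) (fun T h => Or.inl (Or.inr h)) k,
      eq_polyModule_comp hB hN' fun l hl => hk l hl.le⟩
  · rintro ⟨n, G, hG, hlow, rfl⟩
    refine isFixedModule_polyModule hB hG ?_
    rintro T ((h | h) | rfl)
    · exact preserves_sl2 hB hG T h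
    · exact preserves_translations hB hG hlow T h
    · exact preserves_one hG

/-- In degree `l` the generator `xp + yq + K` acts as `l + K`, so `K` preserves every component. -/
theorem alg3_const (hB : IsOpenBox I J L) {s : ℕ} {Z : Fin s → ℝ → ℝ} {K : ℝ → ℝ}
    (hK : ContDiffOn ℝ ∞ K L) {N : Submodule ℝ (Space → ℝ)}
    (hN : IsFixedModule (box I J L) (alg3 Z K) N) (hl : LocallyNontrivial (box I J L) N) :
    ∃ κ : ℝ, ∀ z ∈ L, K z = κ := by
  have hN' := hN.mono (Submodule.span_mono
    (show sl2 ⊆ sl2 ∪ translations (Set.range Z) ∪ {(euler, ofZ K), one} from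
      fun T h => Or.inl (Or.inl h)))
  refine const_of_locallyNontrivial hB hN' hl hK fun l g hg => ?_
  have h1 := comp_vert hB hN' (A := 0) (B := 1) contDiffOn_const contDiffOn_const hK
    (by rw [← euler_eq_vert]; exact hN.stable_of_mem (by simp)) l g hg
  convert (comp I J L N l).sub_mem h1 ((comp I J L N l).smul_mem (l : ℝ) hg) using 1
  ext z
  simp

/-- For constant `K` the additional generator is the scalar `l + κ` in degree `l` and imposes no
condition beyond those of `alg2_iff`. -/
theorem alg3_iff (hB : IsOpenBox I J L) {s : ℕ} {Z : Fin s → ℝ → ℝ} {K : ℝ → ℝ}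
    (hZ : ∀ i, ContDiffOn ℝ ∞ (Z i) L) {κ : ℝ} (hK : ∀ z ∈ L, K z = κ)
    (N : Submodule ℝ (Space → ℝ)) :
    IsFixedModule (box I J L) (alg3 Z K) N ↔
      ∃ (n : ℕ) (G : ℕ → Submodule ℝ (ℝ → ℝ)), FiniteFamily L n G ∧
        Lowers (Set.range Z) n G ∧ N = polyModule (box I J L) n G := by
  constructor
  · intro hN
    refine (alg2_iff hB hZ N).1 (hN.mono (Submodule.span_mono ?_))
    rintro T ((h | h) | rfl)
    · exact Or.inl (Or.inl h)
    · exact Or.inl (Or.inr h)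
    · simp
  · rintro ⟨n, G, hG, hlow, rfl⟩
    refine isFixedModule_polyModule hB hG ?_
    rintro T ((h | h) | rfl | rfl)
    · exact preserves_sl2 hB hG T h
    · exact preserves_translations hB hG hlow T h
    · rw [euler_eq_vert]
      refine preserves_vert hB hG fun l hl g hg => ?_
      convert (G l).smul_mem ((l : ℝ) + κ) hg using 1
      ext z
      by_cases hz : z ∈ L
      · simp [hK z hz]; ring
      · simp [((hG l hl).1 hg).2 z hz]
    · exact preserves_one hG

/-! ### The algebras with `r` and exponential coefficients -/

theorem span_sl2_le_span_sl3 (c : ℝ) (R : Set DiffOp) :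
    Submodule.span ℝ sl2 ≤ Submodule.span ℝ (sl3 c ∪ R) := by
  rw [Submodule.span_le]
  rintro T (rfl | rfl | rfl)
  · exact Submodule.subset_span (Or.inl (by simp [sl3]))
  · have h1 : ((cx • vp, 0) : DiffOp) ∈ Submodule.span ℝ (sl3 c ∪ R) :=
      Submodule.subset_span (Or.inl (by simp [sl3]))
    have h2 : ((cy • vq, 0) : DiffOp) ∈ Submodule.span ℝ (sl3 c ∪ R) :=
      Submodule.subset_span (Or.inl (by simp [sl3]))
    simpa using (Submodule.span ℝ (sl3 c ∪ R)).sub_mem h1 h2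
  · exact Submodule.subset_span (Or.inl (by simp [sl3]))

/-- The structure of nonzero modules over an algebra containing `sl₃`. -/
theorem sl3_structure (hB : IsOpenBox I J L) {c : ℝ} {R : Set DiffOp}
    {N : Submodule ℝ (Space → ℝ)} (h0 : N ≠ ⊥)
    (hN : IsFixedModule (box I J L) (Submodule.span ℝ (sl3 c ∪ R)) N) :
    ∃ n : ℕ, c = -(n : ℝ) ∧ comp I J L N 0 ≠ ⊥ ∧
      N = polyModule (box I J L) n fun _ => comp I J L N 0 := by
  have hN' := hN.mono (span_sl2_le_span_sl3 c R)
  have hr : ∀ f ∈ N, act (box I J L) (raiseX fun _ => c) f ∈ N := by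
    rw [← raiseX_const]
    exact hN.stable_of_mem (Or.inl (by simp [sl3]))
  obtain ⟨n, hn⟩ := exists_degree hB hN' h0 (fun _ _ => rfl) hr
  obtain ⟨-, h2, h3⟩ := comp_eq_of_raise hB hN' (fun _ _ => hn) hr
    (hN.stable_of_mem (Or.inl (by simp [sl3])))
  have h4 := eq_polyModule_comp hB hN' h2
  rw [polyModule_congr (G' := fun _ => comp I J L N 0) h3] at h4
  refine ⟨n, hn, fun hbot => h0 ?_, h4⟩
  rw [h4, polyModule, Submodule.span_eq_bot]
  rintro _ ⟨i, j, hij, g, hg, rfl⟩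
  rw [hbot, Submodule.mem_bot] at hg
  change monoLin (box I J L) i j g = 0
  rw [hg, map_zero]

theorem finiteFamily_expModule {n : ℕ} {G : ℕ → Submodule ℝ (ℝ → ℝ)}
    (hG : ∀ l ≤ n, ∃ (Λ : Finset ℂ) (m : ℂ → ℕ), G l = expModule L Λ m) : FiniteFamily L n G := by
  intro l hl
  obtain ⟨Λ, m, h⟩ := hG l hl
  rw [h]
  exact ⟨expModule_le_smoothFun L Λ m, finiteDimensional_expModule L Λ m⟩

theorem dz_mem_of_eq_expModule (hB : IsOpenBox I J L) {n : ℕ} {G : ℕ → Submodule ℝ (ℝ → ℝ)}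
    (hG : ∀ l ≤ n, ∃ (Λ : Finset ℂ) (m : ℂ → ℕ), G l = expModule L Λ m) :
    ∀ l ≤ n, ∀ g ∈ G l, dz L g ∈ G l := by
  intro l hl
  obtain ⟨Λ, m, h⟩ := hG l hl
  rw [h]
  exact dz_mem_expModule hB.oL Λ m

theorem comp_eq_expModule (hB : IsOpenBox I J L) {N : Submodule ℝ (Space → ℝ)}
    (hN : IsFixedModule (box I J L) (Submodule.span ℝ sl2) N)
    (h : ∀ f ∈ N, act (box I J L) (vr, 0) f ∈ N) (l : ℕ) :
    ∃ (Λ : Finset ℂ) (m : ℂ → ℕ), comp I J L N l = expModule L Λ m := by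
  have h1 := finiteFamily_comp hB hN l l le_rfl
  have := h1.2
  exact exists_eq_expModule hB.oL hB.cL hB.nL h1.1 (comp_dz hB hN h l)

theorem alg4_iff (hB : IsOpenBox I J L) (c : ℝ) {N : Submodule ℝ (Space → ℝ)} (h0 : N ≠ ⊥) :
    IsFixedModule (box I J L) (alg4 c) N ↔
      ∃ (n : ℕ) (Λ : Finset ℂ) (m : ℂ → ℕ), c = -(n : ℝ) ∧
        N = polyModule (box I J L) n fun _ => expModule L Λ m := by
  constructor
  · intro hN
    obtain ⟨n, hn, -, hNn⟩ := sl3_structure hB h0 hN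
    obtain ⟨Λ, m, h⟩ := comp_eq_expModule hB (hN.mono (span_sl2_le_span_sl3 c _))
      (hN.stable_of_mem (by simp)) 0
    exact ⟨n, Λ, m, hn, by rwa [h] at hNn⟩
  · rintro ⟨n, Λ, m, rfl, rfl⟩
    have hE : ∀ l ≤ n, ∃ (Λ' : Finset ℂ) (m' : ℂ → ℕ), expModule L Λ m = expModule L Λ' m' :=
      fun _ _ => ⟨Λ, m, rfl⟩
    have hG : FiniteFamily L n fun _ => expModule L Λ m := finiteFamily_expModule hE
    refine isFixedModule_polyModule hB hG ?_
    rintro T (h | rfl | rfl)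
    · exact preserves_sl3 hB hG (fun _ _ => rfl) T h
    · exact preserves_vr hB hG (dz_mem_of_eq_expModule hB hE)
    · exact preserves_one hG

theorem contDiffOn_of_mem_expMonomials {Λ : Finset ℂ} {m : ℂ → ℕ} :
    ∀ ζ ∈ expMonomials Λ m, ContDiffOn ℝ ∞ ζ L := by
  rintro _ ⟨lam, -, k, -, rfl | rfl⟩
  · exact (Complex.reCLM.contDiff.comp (contDiff_cexpMonomial lam k)).contDiffOn
  · exact (Complex.imCLM.contDiff.comp (contDiff_cexpMonomial lam k)).contDiffOn

theorem exp_structure (hB : IsOpenBox I J L) {Λ₀ : Finset ℂ} {ν : ℂ → ℕ} {𝒯 : Set DiffOp}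
    {N : Submodule ℝ (Space → ℝ)} (hN : IsFixedModule (box I J L) (Submodule.span ℝ 𝒯) N)
    (hs : sl2 ⊆ 𝒯) (ht : translations (expMonomials Λ₀ ν) ⊆ 𝒯) (hr : (vr, 0) ∈ 𝒯) :
    ∃ (n : ℕ) (G : ℕ → Submodule ℝ (ℝ → ℝ)),
      (∀ l ≤ n, ∃ (Λ : Finset ℂ) (m : ℂ → ℕ), G l = expModule L Λ m) ∧
      Lowers (expMonomials Λ₀ ν) n G ∧ N = polyModule (box I J L) n G := by
  have hN' := hN.mono (Submodule.span_mono hs)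
  obtain ⟨k, hk⟩ := comp_eq_bot_of_le hB hN'
  exact ⟨k, comp I J L N, fun l _ => comp_eq_expModule hB hN' (hN.stable_of_mem hr) l,
    lowers_comp hB hN hs contDiffOn_of_mem_expMonomials ht k,
    eq_polyModule_comp hB hN' fun l hl => hk l hl.le⟩

theorem alg5_iff (hB : IsOpenBox I J L) (Λ₀ : Finset ℂ) (ν : ℂ → ℕ)
    (N : Submodule ℝ (Space → ℝ)) :
    IsFixedModule (box I J L) (alg5 Λ₀ ν) N ↔
      ∃ (n : ℕ) (G : ℕ → Submodule ℝ (ℝ → ℝ)),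
        (∀ l ≤ n, ∃ (Λ : Finset ℂ) (m : ℂ → ℕ), G l = expModule L Λ m) ∧
        Lowers (expMonomials Λ₀ ν) n G ∧ N = polyModule (box I J L) n G := by
  constructor
  · intro hN
    exact exp_structure hB hN (fun T h => Or.inl (Or.inl h)) (fun T h => Or.inl (Or.inr h))
      (by simp)
  · rintro ⟨n, G, hE, hlow, rfl⟩
    have hG := finiteFamily_expModule hE
    refine isFixedModule_polyModule hB hG ?_
    rintro T ((h | h) | rfl | rfl)
    · exact preserves_sl2 hB hG T h
    · exact preserves_translations hB hG hlow T h
    · exact preserves_vr hB hG (dz_mem_of_eq_expModule hB hE)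
    · exact preserves_one hG

/-- No nonzero finite-dimensional space of smooth functions is stable under multiplication
by `z`. -/
theorem eq_bot_of_id_mul_mem (hL : IsOpen L) {G : Submodule ℝ (ℝ → ℝ)} (hG : G ≤ smoothFun L)
    [FiniteDimensional ℝ G] (h : ∀ g ∈ G, id * g ∈ G) : G = ⊥ := by
  obtain ⟨P, hP, hPg⟩ := exists_polynomial_of_mul_stable G id h
  rw [Submodule.eq_bot_iff]
  intro g hg
  by_contra hne
  obtain ⟨z, hz⟩ := Function.ne_iff.1 hne
  have hzL : z ∈ L := by
    by_contra hzL
    exact hz ((hG hg).2 z hzL)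
  have hc := (contDiffAt_of_mem_smoothFun hL (hG hg) hzL).continuousAt.eventually_ne hz
  -- Each point of a neighbourhood on which `g` is nonzero would be a root of `P`.
  refine (infinite_of_mem_nhds z hc) (P.roots.toFinset.finite_toSet.subset fun w hw => ?_)
  simpa [hP] using hPg g hg w hw

/-- In degree `n` the generator `xp + yq + cz` acts as `n + cz`; with `c ≠ 0` the nonzero top
component would be stable under multiplication by `z`, which `eq_bot_of_id_mul_mem` excludes. -/
theorem alg6_iff (hB : IsOpenBox I J L) (Λ₀ : Finset ℂ) (ν : ℂ → ℕ) (c : ℝ)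
    {N : Submodule ℝ (Space → ℝ)} (h0 : N ≠ ⊥) :
    IsFixedModule (box I J L) (alg6 Λ₀ ν c) N ↔
      c = 0 ∧ ∃ (n : ℕ) (G : ℕ → Submodule ℝ (ℝ → ℝ)),
        (∀ l ≤ n, ∃ (Λ : Finset ℂ) (m : ℂ → ℕ), G l = expModule L Λ m) ∧
        Lowers (expMonomials Λ₀ ν) n G ∧ N = polyModule (box I J L) n G := by
  constructor
  · intro hN
    have hs : sl2 ⊆ sl2 ∪ translations (expMonomials Λ₀ ν) ∪
      {(euler, c • cz), (vr, 0), one} := fun T h => Or.inl (Or.inl h)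
    refine ⟨?_, exp_structure hB hN hs (fun T h => Or.inl (Or.inr h)) (by simp)⟩
    have hN' := hN.mono (Submodule.span_mono hs)
    by_contra hc
    obtain ⟨n, hn, -⟩ := exists_top hB hN' h0
    have hf := finiteFamily_comp hB hN' n n le_rfl
    have := hf.2
    refine hn (eq_bot_of_id_mul_mem hB.oL hf.1 fun g hg => ?_)
    have h1 := comp_vert hB hN' (A := 0) (B := 1) (C := c • id) contDiffOn_const contDiffOn_const
      (contDiff_id.contDiffOn.const_smul c)
      (by rw [← euler_smul_cz_eq_vert]; exact hN.stable_of_mem (by simp)) n g hg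
    convert (comp I J L N n).smul_mem c⁻¹ ((comp I J L N n).sub_mem h1
      ((comp I J L N n).smul_mem (n : ℝ) hg)) using 1
    ext z
    simp
    field_simp
  · rintro ⟨rfl, n, G, hE, hlow, rfl⟩
    have hG := finiteFamily_expModule hE
    refine isFixedModule_polyModule hB hG ?_
    rintro T ((h | h) | rfl | rfl | rfl)
    · exact preserves_sl2 hB hG T h
    · exact preserves_translations hB hG hlow T h
    · rw [euler_smul_cz_eq_vert]
      refine preserves_vert hB hG fun l hl g hg => ?_
      simpa using (G l).smul_mem (l : ℝ) hg
    · exact preserves_vr hB hG (dz_mem_of_eq_expModule hB hE)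
    · exact preserves_one hG

end Cases

/-! ### Modules spanned by monomials -/

section Monomials

variable {I J L : Set ℝ}

theorem powSpan_congr {P Q : ℕ → Prop} (h : ∀ k, P k ↔ Q k) : powSpan L P = powSpan L Q := by
  rw [funext fun k => propext (h k)]

theorem mono_indicator_pow (i j k : ℕ) :
    mono (box I J L) i j (L.indicator fun z => z ^ k)
      = (box I J L).indicator (cx ^ i * cy ^ j * cz ^ k) := by
  ext a
  by_cases ha : a ∈ box I J L
  · rw [mono_apply ha]
    simp [ha, ha.2.2, cx, cy, cz]
  · simp [mono_of_notMem ha, ha]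

/-- Passes from components spanned by powers to sets of exponents; `P d k` selects the powers `z^k`
occurring in degree `d`. -/
theorem polyModule_powSpan (n : ℕ) (P : ℕ → ℕ → Prop) :
    polyModule (box I J L) n (fun d => powSpan L (P d))
      = monoModule (box I J L) {t | t.1 + t.2.1 ≤ n ∧ P (t.1 + t.2.1) t.2.2} := by
  apply le_antisymm
  · rw [polyModule, Submodule.span_le]
    rintro _ ⟨i, j, hij, g, hg, rfl⟩
    have hle : powSpan L (P (i + j))
        ≤ (monoModule (box I J L) {t | t.1 + t.2.1 ≤ n ∧ P (t.1 + t.2.1) t.2.2}).comap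
          (monoLin (box I J L) i j) := by
      rw [powSpan, Submodule.span_le]
      rintro _ ⟨k, hk, rfl⟩
      exact Submodule.subset_span ⟨i, j, k, ⟨hij, hk⟩, mono_indicator_pow i j k⟩
    exact hle hg
  · rw [monoModule, Submodule.span_le]
    rintro _ ⟨i, j, k, ⟨hij, hk⟩, rfl⟩
    rw [← mono_indicator_pow]
    exact mono_mem_polyModule hij (pow_mem_powSpan hk)

theorem monoModule_congr {U : Set Space} {S S' : Set (ℕ × ℕ × ℕ)} (h : ∀ t, t ∈ S ↔ t ∈ S') :
    monoModule U S = monoModule U S' := by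
  rw [Set.ext h]

theorem pow_mul_mem_powSpan {P Q : ℕ → Prop} {e : ℕ} (h : ∀ k, P k → Q (e + k)) :
    ∀ g ∈ powSpan L P, (fun z => z ^ e) * g ∈ powSpan L Q := by
  have hle : powSpan L P ≤ (powSpan L Q).comap (LinearMap.mulLeft ℝ fun z : ℝ => z ^ e) := by
    rw [powSpan, Submodule.span_le]
    rintro _ ⟨k, hk, rfl⟩
    change (fun z : ℝ => z ^ e) * (L.indicator fun z => z ^ k) ∈ powSpan L Q
    rw [pow_mul_indicator_pow]
    exact pow_mem_powSpan (h k hk)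
  exact fun g hg => hle hg

theorem dz_mem_powSpan (hL : IsOpen L) {P : ℕ → Prop} (h : ∀ k, P (k + 1) → P k) :
    ∀ g ∈ powSpan L P, dz L g ∈ powSpan L P := by
  refine dz_mem_of_span hL (powSpan_le_smoothFun L P) ?_
  rintro _ ⟨k, hk, rfl⟩
  rw [dz_pow hL]
  rcases k with _ | k
  · simp
  · exact Submodule.smul_mem _ _ (pow_mem_powSpan (h k hk))

/-- The operator `z d/dz + tb` on powers of `z`. -/
theorem vert_one_pow (hL : IsOpen L) (b t : ℝ) (k : ℕ) :
    id * dz L (L.indicator fun z => z ^ k) + t • ((fun _ => b) * L.indicator fun z => z ^ k)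
        + 0 * (L.indicator fun z => z ^ k)
      = ((k : ℝ) + t * b) • L.indicator fun z => z ^ k := by
  ext z
  by_cases hz : z ∈ L
  · rw [dz_pow hL]
    rcases k with _ | k
    · simp [hz]
    · simp [hz]; ring
  · simp [dz, hz]

/-- The operator `z² d/dz + tbz + cz` on powers of `z`. -/
theorem vert_two_pow (hL : IsOpen L) (b c t : ℝ) (k : ℕ) :
    id ^ 2 * dz L (L.indicator fun z => z ^ k) + t • ((b • id) * L.indicator fun z => z ^ k)
        + (c • id) * (L.indicator fun z => z ^ k)
      = ((k : ℝ) + b * t + c) • L.indicator fun z => z ^ (k + 1) := by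
  ext z
  by_cases hz : z ∈ L
  · rw [dz_pow hL]
    rcases k with _ | k <;> simp [hz] <;> ring
  · simp [dz, hz]

section Preserves

variable (hB : IsOpenBox I J L) {n : ℕ} {P : ℕ → ℕ → Prop}
include hB

omit hB in
theorem finiteFamily_powSpan {b : ℕ} (hb : ∀ d ≤ n, ∀ k, P d k → k ≤ b) :
    FiniteFamily L n fun d => powSpan L (P d) := fun d hd =>
  ⟨powSpan_le_smoothFun L _, finiteDimensional_powSpan L (hb d hd)⟩

variable (hG : FiniteFamily L n fun d => powSpan L (P d))
include hG

theorem preserves_cz_vr_add (b : ℝ) :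
    Preserves I J L n (fun d => powSpan L (P d)) (cz • vr + b • euler, 0) := by
  rw [cz_vr_add_eq_vert]
  refine preserves_vert hB hG fun d _ => vert_mem_of_span hB.oL (powSpan_le_smoothFun L _) ?_
  rintro _ ⟨k, hk, rfl⟩
  rw [vert_one_pow hB.oL]
  exact Submodule.smul_mem _ _ (pow_mem_powSpan hk)

theorem preserves_cz_vr : Preserves I J L n (fun d => powSpan L (P d)) (cz • vr, 0) := by
  simpa using preserves_cz_vr_add hB hG 0

theorem preserves_euler : Preserves I J L n (fun d => powSpan L (P d)) (euler, 0) := by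
  rw [euler_zero_eq_vert]
  exact preserves_vert hB hG fun d _ g hg => by simpa using Submodule.smul_mem _ (d : ℝ) hg

/-- The operator sends `z^k` to a multiple of `z^(k+1)`: either the next power is available or the
multiple is zero. -/
theorem preserves_cz_sq (b c : ℝ)
    (h : ∀ d ≤ n, ∀ k, P d k → P d (k + 1) ∨ (k : ℝ) + b * d + c = 0) :
    Preserves I J L n (fun d => powSpan L (P d)) (cz ^ 2 • vr + b • cz • euler, c • cz) := by
  rw [cz_sq_vr_add_eq_vert]
  refine preserves_vert hB hG fun d hd => vert_mem_of_span hB.oL (powSpan_le_smoothFun L _) ?_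
  rintro _ ⟨k, hk, rfl⟩
  rw [vert_two_pow hB.oL]
  rcases h d hd k hk with h | h
  · exact Submodule.smul_mem _ _ (pow_mem_powSpan h)
  · rw [h, zero_smul]; exact Submodule.zero_mem _

omit hB hG in
theorem lowers_powers {l : ℕ} (h : ∀ d < n, ∀ k, P (d + 1) k → ∀ e ≤ l, P d (e + k)) :
    Lowers (powers l) n fun d => powSpan L (P d) := by
  rintro _ ⟨e, he, rfl⟩ d hd
  exact pow_mul_mem_powSpan fun k hk => h d hd k hk e he

end Preserves

/-! ### Modules over the algebras containing `r` and `zr` -/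

section Structure

variable (hB : IsOpenBox I J L) {N : Submodule ℝ (Space → ℝ)}
  (hN : IsFixedModule (box I J L) (Submodule.span ℝ sl2) N)
include hB hN

/-- In degree `d` the Euler term is the scalar `d * b`; removing it leaves stability under `z d/dz`,
whatever `b` is. -/
theorem comp_eq_powSpan (h1 : ∀ f ∈ N, act (box I J L) (vr, 0) f ∈ N) {b : ℝ}
    (h2 : ∀ f ∈ N, act (box I J L) (cz • vr + b • euler, 0) f ∈ N) (d : ℕ) :
    ∃ m, comp I J L N d = powSpan L (· < m) := by
  have hf := finiteFamily_comp hB hN d d le_rfl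
  have := hf.2
  refine exists_eq_powSpan hB.oL hB.cL hf.1 (comp_dz hB hN h1 d) fun g hg => ?_
  have h3 := comp_vert hB hN (A := id) (B := fun _ => b) (C := 0) contDiff_id.contDiffOn
    contDiffOn_const contDiffOn_const (by rwa [← cz_vr_add_eq_vert]) d g hg
  convert (comp I J L N d).sub_mem h3 ((comp I J L N d).smul_mem ((d : ℝ) * b) hg) using 1
  ext z
  simp
  ring

/-- The top power of `z` in a component determines the coefficient of the quadratic generator. -/
theorem coeff_of_cz_sq {b c : ℝ}
    (h : ∀ f ∈ N, act (box I J L) (cz ^ 2 • vr + b • cz • euler, c • cz) f ∈ N) {d m : ℕ}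
    (hd : comp I J L N d = powSpan L (· < m + 1)) : (m : ℝ) + b * d + c = 0 := by
  have h1 := comp_vert hB hN (A := id ^ 2) (B := b • id) (C := c • id)
    (contDiff_id.pow 2).contDiffOn (contDiff_id.contDiffOn.const_smul b)
    (contDiff_id.contDiffOn.const_smul c) (by rwa [← cz_sq_vr_add_eq_vert]) d
    (L.indicator fun z => z ^ m) (hd ▸ pow_mem_powSpan m.lt_succ_self)
  rw [vert_two_pow hB.oL, hd] at h1
  -- A nonzero coefficient would put `z^(m+1)` into the span of `1, …, z^m`.
  by_contra hne
  exact lt_irrefl _ (lt_of_pow_mem_powSpan hB.oL hB.nL ((Submodule.smul_mem_iff _ hne).1 h1))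

end Structure

omit I J in
theorem powSpan_lt_zero : powSpan L (· < 0) = ⊥ := by
  rw [powSpan, Submodule.span_eq_bot]
  rintro _ ⟨k, hk, -⟩
  exact absurd hk (Nat.not_lt_zero k)

/-- Nonzero modules over an algebra containing `z^k p`, `z^k q` (`k ≤ l`), `r` and
`zr + b(xp + yq)`. -/
theorem powers_structure (hB : IsOpenBox I J L) {N : Submodule ℝ (Space → ℝ)} {𝒯 : Set DiffOp}
    (h0 : N ≠ ⊥) (hN : IsFixedModule (box I J L) (Submodule.span ℝ 𝒯) N) (hs : sl2 ⊆ 𝒯) {l : ℕ}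
    (ht : translations (powers l) ⊆ 𝒯) (hr : (vr, 0) ∈ 𝒯) {b : ℝ}
    (hz : (cz • vr + b • euler, 0) ∈ 𝒯) :
    ∃ (n : ℕ) (μ : ℕ → ℕ), (∀ d < n, l + μ (d + 1) ≤ μ d) ∧
      (∀ d ≤ n, comp I J L N d = powSpan L (· < μ d + 1)) ∧
      N = monoModule (box I J L) {t | t.1 + t.2.1 ≤ n ∧ t.2.2 ≤ μ (t.1 + t.2.1)} := by
  have hN' := hN.mono (Submodule.span_mono hs)
  choose m hm using comp_eq_powSpan hB hN' (hN.stable_of_mem hr) (hN.stable_of_mem hz)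
  obtain ⟨n, hn, hn'⟩ := exists_top hB hN' h0
  have hpow : ∀ ζ ∈ powers l, ContDiffOn ℝ ∞ ζ L := by
    rintro _ ⟨k, -, rfl⟩
    exact (contDiff_id.pow k).contDiffOn
  have hlow := fun k => lowers_comp hB hN hs hpow ht k
  -- Multiplying the top power `z^(m (d+1) - 1)` by `z^l` must land in the component of degree `d`.
  have hstep : ∀ d, 0 < m (d + 1) → l + m (d + 1) ≤ m d := by
    intro d hd
    have h1 := hlow (d + 1) _ ⟨l, le_rfl, rfl⟩ d d.lt_succ_self
      (L.indicator fun z => z ^ (m (d + 1) - 1))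
      (by rw [hm]; exact pow_mem_powSpan (Nat.sub_lt hd one_pos))
    rw [pow_mul_indicator_pow, hm] at h1
    have := lt_of_pow_mem_powSpan hB.oL hB.nL h1
    omega
  -- Descending from the nonzero top component, no lower component can vanish.
  have hpos : ∀ k ≤ n, 0 < m (n - k) := by
    intro k
    induction k with
    | zero =>
      intro _
      refine Nat.pos_of_ne_zero fun h => hn ?_
      rw [hm, show m n = 0 from h, powSpan_lt_zero]
    | succ k ih =>
      intro hk
      have h1 := ih (by omega)
      rw [show n - k = n - (k + 1) + 1 by omega] at h1
      have := hstep _ h1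
      omega
  have hpos' : ∀ d ≤ n, 0 < m d := by
    intro d hd
    have := hpos (n - d) (by omega)
    rwa [Nat.sub_sub_self hd] at this
  have hcomp : ∀ d ≤ n, comp I J L N d = powSpan L (· < m d - 1 + 1) := by
    intro d hd
    rw [hm d]
    exact powSpan_congr fun k => by have := hpos' d hd; omega
  -- `m d` counts the powers in degree `d`, so the largest exponent is `m d - 1`; positivity of `m
  -- d` makes the truncated subtraction exact.
  refine ⟨n, fun d => m d - 1, ?_, hcomp, ?_⟩
  · intro d hd
    have h1 := hpos' (d + 1) hd
    have := hstep d h1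
    change l + (m (d + 1) - 1) ≤ m d - 1
    omega
  · rw [eq_polyModule_comp hB hN' hn', polyModule_congr hcomp,
      polyModule_powSpan n fun d k => k < m d - 1 + 1]
    exact monoModule_congr fun t => and_congr_right fun _ => Nat.lt_succ_iff

theorem sl3_powers_structure (hB : IsOpenBox I J L) {c : ℝ} {R : Set DiffOp}
    {N : Submodule ℝ (Space → ℝ)} (h0 : N ≠ ⊥)
    (hN : IsFixedModule (box I J L) (Submodule.span ℝ (sl3 c ∪ R)) N) (hr : (vr, 0) ∈ R)
    (hz : (cz • vr, 0) ∈ R) :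
    ∃ n m : ℕ, c = -(n : ℝ) ∧ comp I J L N 0 = powSpan L (· < m + 1) ∧
      N = monoModule (box I J L) {t | t.1 + t.2.1 ≤ n ∧ t.2.2 ≤ m} := by
  obtain ⟨n, hn, hbot, hNn⟩ := sl3_structure hB h0 hN
  obtain ⟨m, hm⟩ := comp_eq_powSpan hB (hN.mono (span_sl2_le_span_sl3 c R))
    (hN.stable_of_mem (Or.inr hr)) (b := 0)
    (by simpa using hN.stable_of_mem (Or.inr hz)) 0
  have hpos : m ≠ 0 := by
    rintro rfl
    exact hbot (by rw [hm, powSpan_lt_zero])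
  obtain ⟨m, rfl⟩ := Nat.exists_eq_succ_of_ne_zero hpos
  refine ⟨n, m, hn, hm, ?_⟩
  rw [hNn, hm, polyModule_powSpan n fun _ k => k < m.succ]
  exact monoModule_congr fun t => and_congr_right fun _ => Nat.lt_succ_iff

end Monomials

/-! ### The algebras with polynomial coefficients -/

section Cases

variable {I J L : Set ℝ} (hB : IsOpenBox I J L)
include hB

theorem alg7_iff (c : ℝ) {N : Submodule ℝ (Space → ℝ)} (h0 : N ≠ ⊥) :
    IsFixedModule (box I J L) (alg7 c) N ↔
      ∃ n m : ℕ, c = -(n : ℝ) ∧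
        N = monoModule (box I J L) {t | t.1 + t.2.1 ≤ n ∧ t.2.2 ≤ m} := by
  constructor
  · intro hN
    obtain ⟨n, m, hn, -, h⟩ := sl3_powers_structure hB h0 hN (by simp) (by simp)
    exact ⟨n, m, hn, h⟩
  · rintro ⟨n, m, rfl, rfl⟩
    have hG : FiniteFamily L n fun _ => powSpan L (· ≤ m) := finiteFamily_powSpan fun _ _ _ h => h
    rw [← polyModule_powSpan n fun _ k => k ≤ m]
    refine isFixedModule_polyModule hB hG ?_
    rintro T (h | rfl | rfl | rfl)
    · exact preserves_sl3 hB hG (fun _ _ => rfl) T h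
    · exact preserves_vr hB hG fun _ _ => dz_mem_powSpan hB.oL fun k hk => by omega
    · exact preserves_cz_vr hB hG
    · exact preserves_one hG

theorem alg10_iff (c d : ℝ) {N : Submodule ℝ (Space → ℝ)} (h0 : N ≠ ⊥) :
    IsFixedModule (box I J L) (alg10 c d) N ↔
      ∃ n m : ℕ, c = -(n : ℝ) ∧ d = -(m : ℝ) ∧
        N = monoModule (box I J L) {t | t.1 + t.2.1 ≤ n ∧ t.2.2 ≤ m} := by
  constructor
  · intro hN
    obtain ⟨n, m, hn, hm, h⟩ := sl3_powers_structure hB h0 hN (by simp) (by simp)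
    refine ⟨n, m, hn, ?_, h⟩
    have := coeff_of_cz_sq hB (hN.mono (span_sl2_le_span_sl3 c _)) (b := 0) (c := d)
      (by simpa using hN.stable_of_mem (T := (cz ^ 2 • vr, d • cz)) (by simp)) hm
    linarith
  · rintro ⟨n, m, rfl, rfl, rfl⟩
    have hG : FiniteFamily L n fun _ => powSpan L (· ≤ m) := finiteFamily_powSpan fun _ _ _ h => h
    rw [← polyModule_powSpan n fun _ k => k ≤ m]
    refine isFixedModule_polyModule hB hG ?_
    rintro T (h | rfl | rfl | rfl | rfl)
    · exact preserves_sl3 hB hG (fun _ _ => rfl) T h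
    · exact preserves_vr hB hG fun _ _ => dz_mem_powSpan hB.oL fun k hk => by omega
    · exact preserves_cz_vr hB hG
    · have := preserves_cz_sq hB hG 0 (-(m : ℝ)) fun _ _ k hk => by
        rcases Nat.lt_or_ge k m with h | h
        · exact Or.inl h
        · right
          rw [le_antisymm hk h]
          ring
      simpa using this
    · exact preserves_one hG

/-- A general `P` serves both the graded modules `l * d + k ≤ m` and the filtered ones `k ≤ μ d`.
The two closure conditions answer to `d/dz` and to the translations `z^e p`, `z^e q`. -/
theorem alg8_polyModule (l : ℕ) (a : ℝ) {n b : ℕ} {P : ℕ → ℕ → Prop}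
    (hb : ∀ d ≤ n, ∀ k, P d k → k ≤ b) (h1 : ∀ d, ∀ k, P d (k + 1) → P d k)
    (h2 : ∀ d < n, ∀ k, P (d + 1) k → ∀ e ≤ l, P d (e + k)) :
    IsFixedModule (box I J L) (alg8 l a)
      (monoModule (box I J L) {t | t.1 + t.2.1 ≤ n ∧ P (t.1 + t.2.1) t.2.2}) := by
  have hG : FiniteFamily L n fun d => powSpan L (P d) := finiteFamily_powSpan hb
  rw [← polyModule_powSpan]
  refine isFixedModule_polyModule hB hG ?_
  rintro T ((h | h) | rfl | rfl | rfl)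
  · exact preserves_sl2 hB hG T h
  · exact preserves_translations hB hG (lowers_powers h2) T h
  · exact preserves_vr hB hG fun d _ => dz_mem_powSpan hB.oL (h1 d)
  · exact preserves_cz_vr_add hB hG a
  · exact preserves_one hG

theorem alg9_polyModule (l : ℕ) {n b : ℕ} {P : ℕ → ℕ → Prop}
    (hb : ∀ d ≤ n, ∀ k, P d k → k ≤ b) (h1 : ∀ d, ∀ k, P d (k + 1) → P d k)
    (h2 : ∀ d < n, ∀ k, P (d + 1) k → ∀ e ≤ l, P d (e + k)) :
    IsFixedModule (box I J L) (alg9 l)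
      (monoModule (box I J L) {t | t.1 + t.2.1 ≤ n ∧ P (t.1 + t.2.1) t.2.2}) := by
  have hG : FiniteFamily L n fun d => powSpan L (P d) := finiteFamily_powSpan hb
  rw [← polyModule_powSpan]
  refine isFixedModule_polyModule hB hG ?_
  rintro T ((h | h) | rfl | rfl | rfl | rfl)
  · exact preserves_sl2 hB hG T h
  · exact preserves_translations hB hG (lowers_powers h2) T h
  · exact preserves_euler hB hG
  · exact preserves_vr hB hG fun d _ => dz_mem_powSpan hB.oL (h1 d)
  · exact preserves_cz_vr hB hG
  · exact preserves_one hG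

omit hB in
theorem le_of_graded {l n m : ℕ} : ∀ d ≤ n, ∀ k, l * d + k ≤ m → k ≤ m := fun _ _ _ h => by omega

omit hB in
theorem lower_of_graded {l n m : ℕ} :
    ∀ d < n, ∀ k, l * (d + 1) + k ≤ m → ∀ e ≤ l, l * d + (e + k) ≤ m := by
  intro d _ k h e he
  rw [mul_add] at h
  omega

omit hB in
theorem le_of_filtered {l n : ℕ} {μ : ℕ → ℕ} (hμ : ∀ d < n, l + μ (d + 1) ≤ μ d) :
    ∀ d ≤ n, ∀ k, k ≤ μ d → k ≤ μ 0 := by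
  intro d hd k hk
  induction d with
  | zero => exact hk
  | succ d ih => exact ih (by omega) (by have := hμ d (by omega); omega)

omit hB in
theorem lower_of_filtered {l n : ℕ} {μ : ℕ → ℕ} (hμ : ∀ d < n, l + μ (d + 1) ≤ μ d) :
    ∀ d < n, ∀ k, k ≤ μ (d + 1) → ∀ e ≤ l, e + k ≤ μ d := by
  intro d hd k hk e he
  have := hμ d hd
  omega

theorem alg8_graded (l : ℕ) (a : ℝ) (n m : ℕ) :
    IsFixedModule (box I J L) (alg8 l a)
      (monoModule (box I J L) {t | t.1 + t.2.1 ≤ n ∧ l * (t.1 + t.2.1) + t.2.2 ≤ m}) :=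
  alg8_polyModule hB l a (P := fun d k => l * d + k ≤ m) le_of_graded
    (fun d k h => by omega) lower_of_graded

theorem alg9_graded (l : ℕ) (n m : ℕ) :
    IsFixedModule (box I J L) (alg9 l)
      (monoModule (box I J L) {t | t.1 + t.2.1 ≤ n ∧ l * (t.1 + t.2.1) + t.2.2 ≤ m}) :=
  alg9_polyModule hB l (P := fun d k => l * d + k ≤ m) le_of_graded
    (fun d k h => by omega) lower_of_graded

theorem alg8_iff (l : ℕ) (a : ℝ) {N : Submodule ℝ (Space → ℝ)} (h0 : N ≠ ⊥) :
    IsFixedModule (box I J L) (alg8 l a) N ↔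
      ∃ (n : ℕ) (μ : ℕ → ℕ), (∀ d < n, l + μ (d + 1) ≤ μ d) ∧
        N = monoModule (box I J L) {t | t.1 + t.2.1 ≤ n ∧ t.2.2 ≤ μ (t.1 + t.2.1)} := by
  constructor
  · intro hN
    obtain ⟨n, μ, hμ, -, h⟩ := powers_structure hB h0 hN (fun T h => Or.inl (Or.inl h))
      (fun T h => Or.inl (Or.inr h)) (by simp) (b := a) (by simp)
    exact ⟨n, μ, hμ, h⟩
  · rintro ⟨n, μ, hμ, rfl⟩
    exact alg8_polyModule hB l a (P := fun d k => k ≤ μ d) (le_of_filtered hμ)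
      (fun d k h => by omega) (lower_of_filtered hμ)

theorem alg9_iff (l : ℕ) {N : Submodule ℝ (Space → ℝ)} (h0 : N ≠ ⊥) :
    IsFixedModule (box I J L) (alg9 l) N ↔
      ∃ (n : ℕ) (μ : ℕ → ℕ), (∀ d < n, l + μ (d + 1) ≤ μ d) ∧
        N = monoModule (box I J L) {t | t.1 + t.2.1 ≤ n ∧ t.2.2 ≤ μ (t.1 + t.2.1)} := by
  constructor
  · intro hN
    obtain ⟨n, μ, hμ, -, h⟩ := powers_structure hB h0 hN (fun T h => Or.inl (Or.inl h))
      (fun T h => Or.inl (Or.inr h)) (by simp) (b := 0) (by simp)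
    exact ⟨n, μ, hμ, h⟩
  · rintro ⟨n, μ, hμ, rfl⟩
    exact alg9_polyModule hB l (P := fun d k => k ≤ μ d) (le_of_filtered hμ)
      (fun d k h => by omega) (lower_of_filtered hμ)

/-- Nonzero modules when moreover `z²r + lz(xp + yq) + cz` acts. -/
theorem graded_structure {N : Submodule ℝ (Space → ℝ)} {𝒯 : Set DiffOp}
    (h0 : N ≠ ⊥) (hN : IsFixedModule (box I J L) (Submodule.span ℝ 𝒯) N) (hs : sl2 ⊆ 𝒯) {l : ℕ}
    (ht : translations (powers l) ⊆ 𝒯) (hr : (vr, 0) ∈ 𝒯) {b c : ℝ}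
    (hz : (cz • vr + b • euler, 0) ∈ 𝒯)
    (hq : (cz ^ 2 • vr + (l : ℝ) • cz • euler, c • cz) ∈ 𝒯) :
    ∃ n m : ℕ, c = -(m : ℝ) ∧
      N = monoModule (box I J L) {t | t.1 + t.2.1 ≤ n ∧ l * (t.1 + t.2.1) + t.2.2 ≤ m} := by
  obtain ⟨n, μ, -, hμ, h⟩ := powers_structure hB h0 hN hs ht hr hz
  -- The quadratic generator fixes the top exponent of every component, turning the inequalities
  -- between successive `μ d` into equalities `μ d = μ 0 - l * d`.
  have key : ∀ d ≤ n, (μ d : ℝ) + l * d + c = 0 := fun d hd =>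
    coeff_of_cz_sq hB (hN.mono (Submodule.span_mono hs)) (hN.stable_of_mem hq) (hμ d hd)
  have hc : c = -(μ 0 : ℝ) := by
    have := key 0 n.zero_le
    push_cast at this
    linarith
  refine ⟨n, μ 0, hc, h.trans (monoModule_congr fun t => and_congr_right fun ht => ?_)⟩
  have h1 := key _ ht
  rw [hc] at h1
  have h2 : μ (t.1 + t.2.1) + l * (t.1 + t.2.1) = μ 0 := by
    have : ((μ (t.1 + t.2.1) + l * (t.1 + t.2.1) : ℕ) : ℝ) = (μ 0 : ℝ) := by
      push_cast at h1 ⊢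
      linarith
    exact_mod_cast this
  omega

omit hB in
-- On the boundary `l * d + k = m`, where raising the exponent of `z` would leave the module, the
-- coefficient vanishes.
theorem quadratic_of_graded {l m : ℕ} (d k : ℕ) (h : l * d + k ≤ m) :
    l * d + (k + 1) ≤ m ∨ (k : ℝ) + l * d + -(m : ℝ) = 0 := by
  rcases Nat.lt_or_ge (l * d + k) m with h1 | h1
  · exact Or.inl h1
  · right
    have : ((l * d + k : ℕ) : ℝ) = m := congrArg _ (le_antisymm h h1)
    push_cast at this
    linarith

theorem alg11_iff (l : ℕ) (c : ℝ) {N : Submodule ℝ (Space → ℝ)} (h0 : N ≠ ⊥) :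
    IsFixedModule (box I J L) (alg11 l c) N ↔
      ∃ n m : ℕ, c = -(m : ℝ) ∧
        N = monoModule (box I J L)
          {t | t.1 + t.2.1 ≤ n ∧ l * (t.1 + t.2.1) + t.2.2 ≤ m} := by
  constructor
  · intro hN
    exact graded_structure hB h0 hN (fun T h => Or.inl (Or.inl h)) (fun T h => Or.inl (Or.inr h))
      (by simp) (b := (l : ℝ) / 2) (by simp) (by simp)
  · rintro ⟨n, m, rfl, rfl⟩
    have hG : FiniteFamily L n fun d => powSpan L fun k => l * d + k ≤ m :=
      finiteFamily_powSpan (P := fun d k => l * d + k ≤ m) le_of_graded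
    rw [← polyModule_powSpan n fun d k => l * d + k ≤ m]
    refine isFixedModule_polyModule hB hG ?_
    rintro T ((h | h) | rfl | rfl | rfl | rfl)
    · exact preserves_sl2 hB hG T h
    · exact preserves_translations hB hG
        (lowers_powers (P := fun d k => l * d + k ≤ m) lower_of_graded) T h
    · exact preserves_vr hB hG fun d _ => dz_mem_powSpan hB.oL fun k hk => by omega
    · exact preserves_cz_vr_add hB (P := fun d k => l * d + k ≤ m) hG _
    · exact preserves_cz_sq hB (P := fun d k => l * d + k ≤ m) hG _ _
        fun d _ k hk => quadratic_of_graded d k hk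
    · exact preserves_one hG

theorem alg12_iff (l : ℕ) (c : ℝ) {N : Submodule ℝ (Space → ℝ)} (h0 : N ≠ ⊥) :
    IsFixedModule (box I J L) (alg12 l c) N ↔
      ∃ n m : ℕ, c = -(m : ℝ) ∧
        N = monoModule (box I J L)
          {t | t.1 + t.2.1 ≤ n ∧ l * (t.1 + t.2.1) + t.2.2 ≤ m} := by
  constructor
  · intro hN
    exact graded_structure hB h0 hN (fun T h => Or.inl (Or.inl h)) (fun T h => Or.inl (Or.inr h))
      (by simp) (b := 0) (by simp) (by simp)
  · rintro ⟨n, m, rfl, rfl⟩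
    have hG : FiniteFamily L n fun d => powSpan L fun k => l * d + k ≤ m :=
      finiteFamily_powSpan (P := fun d k => l * d + k ≤ m) le_of_graded
    rw [← polyModule_powSpan n fun d k => l * d + k ≤ m]
    refine isFixedModule_polyModule hB hG ?_
    rintro T ((h | h) | rfl | rfl | rfl | rfl | rfl)
    · exact preserves_sl2 hB hG T h
    · exact preserves_translations hB hG
        (lowers_powers (P := fun d k => l * d + k ≤ m) lower_of_graded) T h
    · exact preserves_euler hB (P := fun d k => l * d + k ≤ m) hG
    · exact preserves_vr hB hG fun d _ => dz_mem_powSpan hB.oL fun k hk => by omega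
    · exact preserves_cz_vr hB (P := fun d k => l * d + k ≤ m) hG
    · exact preserves_cz_sq hB (P := fun d k => l * d + k ≤ m) hG _ _
        fun d _ k hk => quadratic_of_graded d k hk
    · exact preserves_one hG

end Cases

end QES

end

/-! ### Assembly of the twelve cases. -/

theorem mainTheorem3 (I J L : Set ℝ)
    (hIo : IsOpen I) (hIc : I.OrdConnected) (hIn : I.Nonempty)
    (hJo : IsOpen J) (hJc : J.OrdConnected) (hJn : J.Nonempty)
    (hLo : IsOpen L) (hLc : L.OrdConnected) (hLn : L.Nonempty) :
    -- case 1
    (∀ K : ℝ → ℝ, ContDiffOn ℝ ∞ K L →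
      (∀ N, QES.IsFixedModule (QES.box I J L) (QES.alg1 K) N →
        QES.LocallyNontrivial (QES.box I J L) N →
        ∃ n : ℕ, ∀ z ∈ L, 3 * K z = -(n : ℝ)) ∧
      (∀ n : ℕ, (∀ z ∈ L, 3 * K z = -(n : ℝ)) →
        (∀ N, QES.IsFixedModule (QES.box I J L) (QES.alg1 K) N ↔
          ∃ G : ℕ → Submodule ℝ (ℝ → ℝ), QES.FiniteFamily L n G ∧
            (∀ l < n, G (l + 1) ≤ G l) ∧ (∀ l ≤ n, G l = G 0) ∧
            N = QES.polyModule (QES.box I J L) n G) ∧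
        (∀ G : ℕ → Submodule ℝ (ℝ → ℝ), QES.FiniteFamily L n G → (∀ l < n, G (l + 1) ≤ G l) →
          (QES.IsFixedModule (QES.box I J L) (QES.alg1 K)
              (QES.polyModule (QES.box I J L) n G) ↔
            ∀ l ≤ n, G l = G 0)))) ∧
    -- case 2
    (∀ (s : ℕ) (Z : Fin s → ℝ → ℝ), (∀ i, ContDiffOn ℝ ∞ (Z i) L) →
      ∀ N, QES.IsFixedModule (QES.box I J L) (QES.alg2 Z) N ↔
        ∃ (n : ℕ) (G : ℕ → Submodule ℝ (ℝ → ℝ)), QES.FiniteFamily L n G ∧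
          QES.Lowers (Set.range Z) n G ∧ N = QES.polyModule (QES.box I J L) n G) ∧
    -- case 3
    (∀ (s : ℕ) (Z : Fin s → ℝ → ℝ) (K : ℝ → ℝ), (∀ i, ContDiffOn ℝ ∞ (Z i) L) →
      ContDiffOn ℝ ∞ K L →
      (∀ N, QES.IsFixedModule (QES.box I J L) (QES.alg3 Z K) N →
        QES.LocallyNontrivial (QES.box I J L) N → ∃ κ : ℝ, ∀ z ∈ L, K z = κ) ∧
      (∀ κ : ℝ, (∀ z ∈ L, K z = κ) →
        ∀ N, QES.IsFixedModule (QES.box I J L) (QES.alg3 Z K) N ↔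
          ∃ (n : ℕ) (G : ℕ → Submodule ℝ (ℝ → ℝ)), QES.FiniteFamily L n G ∧
            QES.Lowers (Set.range Z) n G ∧ N = QES.polyModule (QES.box I J L) n G)) ∧
    -- case 4
    (∀ (c : ℝ) (N : Submodule ℝ (QES.Space → ℝ)), N ≠ ⊥ →
      (QES.IsFixedModule (QES.box I J L) (QES.alg4 c) N ↔
        ∃ (n : ℕ) (Λ : Finset ℂ) (m : ℂ → ℕ), c = -(n : ℝ) ∧
          N = QES.polyModule (QES.box I J L) n (fun _ => QES.expModule L Λ m))) ∧
    -- case 5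
    (∀ (Λ₀ : Finset ℂ) (ν : ℂ → ℕ) (N : Submodule ℝ (QES.Space → ℝ)),
      QES.IsFixedModule (QES.box I J L) (QES.alg5 Λ₀ ν) N ↔
        ∃ (n : ℕ) (G : ℕ → Submodule ℝ (ℝ → ℝ)),
          (∀ l ≤ n, ∃ (Λ : Finset ℂ) (m : ℂ → ℕ), G l = QES.expModule L Λ m) ∧
          QES.Lowers (QES.expMonomials Λ₀ ν) n G ∧
          N = QES.polyModule (QES.box I J L) n G) ∧
    -- case 6
    (∀ (Λ₀ : Finset ℂ) (ν : ℂ → ℕ) (c : ℝ) (N : Submodule ℝ (QES.Space → ℝ)), N ≠ ⊥ →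
      (QES.IsFixedModule (QES.box I J L) (QES.alg6 Λ₀ ν c) N ↔
        c = 0 ∧ ∃ (n : ℕ) (G : ℕ → Submodule ℝ (ℝ → ℝ)),
          (∀ l ≤ n, ∃ (Λ : Finset ℂ) (m : ℂ → ℕ), G l = QES.expModule L Λ m) ∧
          QES.Lowers (QES.expMonomials Λ₀ ν) n G ∧
          N = QES.polyModule (QES.box I J L) n G)) ∧
    -- case 7
    (∀ (c : ℝ) (N : Submodule ℝ (QES.Space → ℝ)), N ≠ ⊥ →
      (QES.IsFixedModule (QES.box I J L) (QES.alg7 c) N ↔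
        ∃ n m : ℕ, c = -(n : ℝ) ∧
          N = QES.monoModule (QES.box I J L) {t | t.1 + t.2.1 ≤ n ∧ t.2.2 ≤ m})) ∧
    -- case 8
    (∀ (l : ℕ) (a : ℝ),
      (∀ n m : ℕ, QES.IsFixedModule (QES.box I J L) (QES.alg8 l a)
        (QES.monoModule (QES.box I J L)
          {t | t.1 + t.2.1 ≤ n ∧ l * (t.1 + t.2.1) + t.2.2 ≤ m})) ∧
      (∀ N : Submodule ℝ (QES.Space → ℝ), N ≠ ⊥ →
        (QES.IsFixedModule (QES.box I J L) (QES.alg8 l a) N ↔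
          ∃ (n : ℕ) (μ : ℕ → ℕ), (∀ d < n, l + μ (d + 1) ≤ μ d) ∧
            N = QES.monoModule (QES.box I J L)
              {t | t.1 + t.2.1 ≤ n ∧ t.2.2 ≤ μ (t.1 + t.2.1)}))) ∧
    -- case 9
    (∀ l : ℕ,
      (∀ n m : ℕ, QES.IsFixedModule (QES.box I J L) (QES.alg9 l)
        (QES.monoModule (QES.box I J L)
          {t | t.1 + t.2.1 ≤ n ∧ l * (t.1 + t.2.1) + t.2.2 ≤ m})) ∧
      (∀ N : Submodule ℝ (QES.Space → ℝ), N ≠ ⊥ →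
        (QES.IsFixedModule (QES.box I J L) (QES.alg9 l) N ↔
          ∃ (n : ℕ) (μ : ℕ → ℕ), (∀ d < n, l + μ (d + 1) ≤ μ d) ∧
            N = QES.monoModule (QES.box I J L)
              {t | t.1 + t.2.1 ≤ n ∧ t.2.2 ≤ μ (t.1 + t.2.1)}))) ∧
    -- case 10
    (∀ (c d : ℝ) (N : Submodule ℝ (QES.Space → ℝ)), N ≠ ⊥ →
      (QES.IsFixedModule (QES.box I J L) (QES.alg10 c d) N ↔
        ∃ n m : ℕ, c = -(n : ℝ) ∧ d = -(m : ℝ) ∧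
          N = QES.monoModule (QES.box I J L) {t | t.1 + t.2.1 ≤ n ∧ t.2.2 ≤ m})) ∧
    -- case 11
    (∀ (l : ℕ) (c : ℝ) (N : Submodule ℝ (QES.Space → ℝ)), N ≠ ⊥ →
      (QES.IsFixedModule (QES.box I J L) (QES.alg11 l c) N ↔
        ∃ n m : ℕ, c = -(m : ℝ) ∧
          N = QES.monoModule (QES.box I J L)
            {t | t.1 + t.2.1 ≤ n ∧ l * (t.1 + t.2.1) + t.2.2 ≤ m})) ∧
    -- case 12
    (∀ (l : ℕ) (c : ℝ) (N : Submodule ℝ (QES.Space → ℝ)), N ≠ ⊥ →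
      (QES.IsFixedModule (QES.box I J L) (QES.alg12 l c) N ↔
        ∃ n m : ℕ, c = -(m : ℝ) ∧
          N = QES.monoModule (QES.box I J L)
            {t | t.1 + t.2.1 ≤ n ∧ l * (t.1 + t.2.1) + t.2.2 ≤ m})) := by
  have hB : QES.IsOpenBox I J L := ⟨hIo, hIc, hIn, hJo, hJc, hJn, hLo, hLc, hLn⟩
  refine ⟨fun K hK => ⟨fun N hN hl => QES.alg1_cocycle hB hK hN hl, fun n hn =>
      ⟨fun N => QES.alg1_iff hB hn, fun G hG _ => QES.alg1_polyModule_iff hB hn hG⟩⟩,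
    fun s Z hZ N => QES.alg2_iff hB hZ N,
    fun s Z K hZ hK => ⟨fun N hN hl => QES.alg3_const hB hK hN hl,
      fun κ hκ N => QES.alg3_iff hB hZ hκ N⟩,
    fun c N h0 => QES.alg4_iff hB c h0,
    fun Λ₀ ν N => QES.alg5_iff hB Λ₀ ν N,
    fun Λ₀ ν c N h0 => QES.alg6_iff hB Λ₀ ν c h0,
    fun c N h0 => QES.alg7_iff hB c h0,
    fun l a => ⟨QES.alg8_graded hB l a, fun N h0 => QES.alg8_iff hB l a h0⟩,
    fun l => ⟨QES.alg9_graded hB l, fun N h0 => QES.alg9_iff hB l h0⟩,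
    fun c d N h0 => QES.alg10_iff hB c d h0,
    fun l c N h0 => QES.alg11_iff hB l c h0,
    fun l c N h0 => QES.alg12_iff hB l c h0⟩
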